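/- **Theorem.** Let $X$ be a compact connected complex manifold with $\dim_{\mathbb C}X=n$ and universal cover $\pi:\widetilde X\to X$. A *Hermitian metric* on $X$ is a $C^\infty$ positive definite $(1,1)$-form $\omega$; put $\widetilde\omega=\pi^*\omega$. A $C^\infty$ $k$-form $\phi$ on $X$ is called *$\widetilde d$-bounded* (with respect to $\omega$) if $\pi^*\phi=d\beta$, and *$\widetilde{(\partial+\bar\partial)}$-bounded* if $\pi^*\phi=\partial\alpha+\bar\partial\beta$, for some $C^\infty$ $(k-1)$-forms $\beta$, resp. $\alpha,\beta$, on $\widetilde X$ that are bounded with respect to $\widetilde\omega$. One says that $X$ is * *Kähler hyperbolic* if it carries a Hermitian metric $\omega$ with $d\omega=0$ that is $\widetilde d$-bounded with respect to $\omega$; * *SKT hyperbolic* if it carries a Hermitian metric $\omega$ with $\partial\bar\partial\omega=0$ that is $\widetilde{(\partial+\bar\partial)}$-bounded with respect to $\omega$; * *Kobayashi hyperbolic* if the Kobayashi pseudo-distance of $X$ is a distance; and, for $n\ge 2$, * *balanced hyperbolic* if it carries a Hermitian metric $\omega$ with $d\omega^{n-1}=0$ such that $\omega^{n-1}$ is $\widetilde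 d$-bounded with respect to $\omega$; * *degenerate balanced* if it carries a Hermitian metric $\omega$ such that $\omega^{n-1}$ is $d$-exact on $X$; * *Gauduchon hyperbolic* if it carries a Hermitian metric $\omega$ such that $\omega^{n-1}$ is $\widetilde{(\partial+\bar\partial)}$-bounded with respect to $\omega$; * *divisorially hyperbolic* if for no Hermitian metric $\omega$ on $X$ is there a holomorphic map $f:\mathbb C^{n-1}\to X$ whose differential is injective at some point and which has subexponential growth, in the following sense. Let $B_t$ and $S_t$ be the open ball and the sphere of radius $t$ centred at $0$ in $\mathbb C^{n-1}$, $\tau(z)=|z|^2$, $\mathrm{Vol}(B_t)=\int_{B_t}f^*\omega^{n-1}/(n-1)!$, and let $d\sigma_t$ be the restriction to $S_t$ of $\star_{f^*\omega}\big(d\tau/|d\tau|_{f^*\omega}\big)$, the area measure induced by the (possibly degenerate) metric $f^*\omega$. Then $f$ has *subexponential growth* if (i) there are constants $C_1>0$, $r_0>0$ with $\int_{S_t}|d\tau|_{f^*\omega}\,d\sigma_t\le C_1\,t\,\mathrm{Vol}(B_t)$ for all $t>r_0$, and (ii) $\limsup_{b\to+\infty}\big(\tfrac bC-\log\int_0^b\mathrm{Vol}(B_t)\,dt\big)=+\infty$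 for every $C>0$. Then $$X\text{ Kähler hyperbolic}\implies X\text{ SKT hyperbolic}\implies X\text{ Kobayashi hyperbolic},$$ and, if $n\ge2$, $$X\text{ balanced hyperbolic}\implies X\text{ Gauduchon hyperbolic}\implies X\text{ divisorially hyperbolic},$$ and moreover $X$ Kähler hyperbolic $\implies$ $X$ balanced hyperbolic, $X$ Kobayashi hyperbolic $\implies$ $X$ divisorially hyperbolic, and $X$ degenerate balanced $\implies$ $X$ balanced hyperbolic. -/

import Mathlib

open scoped Manifold ContDiff Topology

noncomputable section

namespace HermitianHyperbolicity

/-! ### Pointwise multilinear algebra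

`E [⋀^Fin k]→L[ℝ] ℂ` is the space of complex-valued real-alternating `k`-forms on the complex
vector space `E`. -/

section Algebra

variable {E : Type*} [NormedAddCommGroup E] [NormedSpace ℂ E] {k l : ℕ}

/-- The multilinear map `(v₁, …, v_{k+l}) ↦ α(v₁, …, v_k) β(v_{k+1}, …, v_{k+l})`. -/
def tensorForm (α : E [⋀^Fin k]→L[ℝ] ℂ) (β : E [⋀^Fin l]→L[ℝ] ℂ) :
    ContinuousMultilinearMap ℝ (fun _ : Fin (k + l) => E) ℂ where
  toMultilinearMap :=
    ((LinearMap.mul' ℝ ℂ).compMultilinearMap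
      (MultilinearMap.domCoprod α.toAlternatingMap.toMultilinearMap
        β.toAlternatingMap.toMultilinearMap)).domDomCongr finSumFinEquiv
  cont := by
    change Continuous fun v : Fin (k + l) → E =>
      α (fun i => v (Fin.castAdd l i)) * β (fun j => v (Fin.natAdd k j))
    fun_prop

/-- The wedge product
`(α ∧ β)(v) = (1 / (k! l!)) ∑_σ sgn(σ) α(v_σ(1), …, v_σ(k)) β(v_σ(k+1), …, v_σ(k+l))`. -/
def wedge (α : E [⋀^Fin k]→L[ℝ] ℂ) (β : E [⋀^Fin l]→L[ℝ] ℂ) : E [⋀^Fin (k + l)]→L[ℝ] ℂ :=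
  ((k.factorial * l.factorial : ℕ) : ℝ)⁻¹ •
    ContinuousMultilinearMap.alternatization (tensorForm α β)

/-- The `p`-th exterior power `θ^p = θ ∧ ⋯ ∧ θ` of a `2`-form; a form of degree `2p`. -/
def wedgePow (θ : E [⋀^Fin 2]→L[ℝ] ℂ) : (p : ℕ) → E [⋀^Fin (2 * p)]→L[ℝ] ℂ
  | 0 => ContinuousAlternatingMap.constOfIsEmpty ℝ E (Fin 0) 1
  | p + 1 => wedge (wedgePow θ p) θ

/-- Transport of a form along an equality of degrees. -/
def castDegree (h : k = l) (α : E [⋀^Fin k]→L[ℝ] ℂ) : E [⋀^Fin l]→L[ℝ] ℂ :=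
  h ▸ α

/-- The norm `|v|_θ = √θ(v, iv)` of a tangent vector with respect to a (semi-)positive
`(1,1)`-form `θ`. -/
def vecNorm (θ : E [⋀^Fin 2]→L[ℝ] ℂ) (v : E) : ℝ :=
  Real.sqrt (θ ![v, Complex.I • v]).re

/-- The `ℂ`-linear part `½(L - i L(i ·))` of a real-linear map `L` into complex-valued forms. -/
def linPart (L : E →L[ℝ] (E [⋀^Fin k]→L[ℝ] ℂ)) : E →L[ℝ] (E [⋀^Fin k]→L[ℝ] ℂ) :=
  (1 / 2 : ℂ) • (L - Complex.I • L.comp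
    ((Complex.I • ContinuousLinearMap.id ℂ E : E →L[ℂ] E).restrictScalars ℝ))

/-- The `ℂ`-antilinear part `½(L + i L(i ·))`. -/
def antilinPart (L : E →L[ℝ] (E [⋀^Fin k]→L[ℝ] ℂ)) : E →L[ℝ] (E [⋀^Fin k]→L[ℝ] ℂ) :=
  (1 / 2 : ℂ) • (L + Complex.I • L.comp
    ((Complex.I • ContinuousLinearMap.id ℂ E : E →L[ℂ] E).restrictScalars ℝ))

end Algebra

/-! ### Differential forms on complex manifolds

In Mathlib the tangent space of a manifold modelled on `E` at a point `x` is `E` itself, identified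
through the preferred chart at `x`; as that chart is holomorphic, the complex structure of the
tangent space is the one of `E`. A (not necessarily smooth) complex-valued `k`-form on `M` is thus
a function `M → E [⋀^Fin k]→L[ℝ] ℂ`. -/

section Forms

variable {E : Type*} [NormedAddCommGroup E] [NormedSpace ℂ E]
  {F : Type*} [NormedAddCommGroup F] [NormedSpace ℂ F]
  {M : Type*} [TopologicalSpace M] [ChartedSpace E M]
  {N : Type*} [TopologicalSpace N] [ChartedSpace F N] {k : ℕ}

/-- The differential of a holomorphic map, as a complex-linear map of the model spaces. -/
def complexDeriv (f : M → N) (x : M) : E →L[ℂ] F :=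
  mfderiv 𝓘(ℂ, E) 𝓘(ℂ, F) f x

/-- The differential of a holomorphic map as a real-linear map. -/
def realDeriv (f : M → N) (x : M) : E →L[ℝ] F :=
  (complexDeriv f x).restrictScalars ℝ

/-- The pullback `f^*φ` of a form under a holomorphic map. -/
def pullback (f : M → N) (φ : N → F [⋀^Fin k]→L[ℝ] ℂ) (x : M) : E [⋀^Fin k]→L[ℝ] ℂ :=
  (φ (f x)).compContinuousLinearMap (realDeriv f x)

/-- The expression of a form in the preferred chart at `c`: a form on the chart's target, which is
an open subset of `E`. -/
def inChart (c : M) (φ : M → E [⋀^Fin k]→L[ℝ] ℂ) : E → E [⋀^Fin k]→L[ℝ] ℂ :=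
  pullback (chartAt E c).symm φ

/-- `φ` is of class `C^∞` (in the real sense). -/
def IsSmoothForm (φ : M → E [⋀^Fin k]→L[ℝ] ℂ) : Prop :=
  ∀ c : M, ContDiffOn ℝ ∞ (inChart c φ) (chartAt E c).target

/-- The exterior derivative `dφ`, computed at each point `x` in the preferred chart at `x`. -/
def dForm (φ : M → E [⋀^Fin k]→L[ℝ] ℂ) (x : M) : E [⋀^Fin (k + 1)]→L[ℝ] ℂ :=
  extDeriv (inChart x φ) (chartAt E x x)

/-- The operator `∂`: in holomorphic coordinates,
`∂(∑ φ_{IJ} dz_I ∧ dz̄_J) = ∑ (∂φ_{IJ}/∂z_i) dz_i ∧ dz_I ∧ dz̄_J`, that is, the exterior derivative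
with the derivative of the coefficients replaced by its `ℂ`-linear part. -/
def delForm (φ : M → E [⋀^Fin k]→L[ℝ] ℂ) (x : M) : E [⋀^Fin (k + 1)]→L[ℝ] ℂ :=
  .alternatizeUncurryFin (linPart (fderiv ℝ (inChart x φ) (chartAt E x x)))

/-- The operator `∂̄`: the exterior derivative with the derivative of the coefficients replaced by
its `ℂ`-antilinear part. -/
def delbarForm (φ : M → E [⋀^Fin k]→L[ℝ] ℂ) (x : M) : E [⋀^Fin (k + 1)]→L[ℝ] ℂ :=
  .alternatizeUncurryFin (antilinPart (fderiv ℝ (inChart x φ) (chartAt E x x)))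

theorem dForm_eq_delForm_add_delbarForm (φ : M → E [⋀^Fin k]→L[ℝ] ℂ) (x : M) :
    dForm φ x = delForm φ x + delbarForm φ x := by
  rw [dForm, extDeriv, delForm, delbarForm, ← ContinuousAlternatingMap.alternatizeUncurryFin_add]
  congr 1
  ext v w
  simp [linPart, antilinPart]
  ring

/-- The `p`-th power of the `2`-form `θ`. -/
def powForm (θ : M → E [⋀^Fin 2]→L[ℝ] ℂ) (p : ℕ) (x : M) : E [⋀^Fin (2 * p)]→L[ℝ] ℂ :=
  wedgePow (θ x) p

/-- A Hermitian metric, given by its fundamental form: a `C^∞`, real, positive definite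
`(1,1)`-form. -/
structure IsHermitianMetric (Ω : M → E [⋀^Fin 2]→L[ℝ] ℂ) : Prop where
  smooth : IsSmoothForm Ω
  real : ∀ (x : M) (v w : E), (Ω x ![v, w]).im = 0
  type_one_one : ∀ (x : M) (v w : E), Ω x ![Complex.I • v, Complex.I • w] = Ω x ![v, w]
  pos : ∀ (x : M) (v : E), v ≠ 0 → 0 < (Ω x ![v, Complex.I • v]).re

/-- `β` is bounded with respect to the metric `Ω`. -/
def IsBoundedForm (Ω : M → E [⋀^Fin 2]→L[ℝ] ℂ) (β : M → E [⋀^Fin k]→L[ℝ] ℂ) : Prop :=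
  ∃ C : ℝ, ∀ (x : M) (v : Fin k → E), ‖β x v‖ ≤ C * ∏ i, vecNorm (Ω x) (v i)

/-- Kähler metrics: `dΩ = 0`. -/
def IsKahler (Ω : M → E [⋀^Fin 2]→L[ℝ] ℂ) : Prop :=
  IsHermitianMetric Ω ∧ ∀ x, dForm Ω x = 0

/-- SKT (pluriclosed) metrics: `∂∂̄Ω = 0`. -/
def IsSKT (Ω : M → E [⋀^Fin 2]→L[ℝ] ℂ) : Prop :=
  IsHermitianMetric Ω ∧ ∀ x, delForm (delbarForm Ω) x = 0

/-- Balanced metrics in dimension `n`: `dΩ^{n-1} = 0`. -/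
def IsBalanced (n : ℕ) (Ω : M → E [⋀^Fin 2]→L[ℝ] ℂ) : Prop :=
  IsHermitianMetric Ω ∧ ∀ x, dForm (powForm Ω (n - 1)) x = 0

/-! ### Boundedness on the universal cover -/

/-- `π : M' → M` is the universal cover of the complex manifold `M`: a covering map that is locally
biholomorphic, with simply connected total space. -/
structure IsUniversalCover {M' : Type*} [TopologicalSpace M'] [ChartedSpace E M']
    (π : M' → M) : Prop where
  simplyConnected : SimplyConnectedSpace M'
  isCoveringMap : IsCoveringMap π
  isLocalDiffeomorph : IsLocalDiffeomorph 𝓘(ℂ, E) 𝓘(ℂ, E) ω π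

variable {M' : Type*} [TopologicalSpace M'] [ChartedSpace E M']

/-- The `k`-form `φ` on `M` is `d̃`-bounded with respect to `Ω`: `π^*φ = dβ` on the universal cover
for some `C^∞` `(k-1)`-form `β` that is bounded with respect to `π^*Ω`. -/
def IsTildeDBounded (π : M' → M) (Ω : M → E [⋀^Fin 2]→L[ℝ] ℂ) (φ : M → E [⋀^Fin k]→L[ℝ] ℂ) :
    Prop :=
  ∃ (j : ℕ) (h : j + 1 = k) (β : M' → E [⋀^Fin j]→L[ℝ] ℂ),
    IsSmoothForm β ∧ IsBoundedForm (pullback π Ω) β ∧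
      ∀ x, pullback π φ x = castDegree h (dForm β x)

/-- The `k`-form `φ` on `M` is `(∂+∂̄)~`-bounded with respect to `Ω`: `π^*φ = ∂α + ∂̄β` on the
universal cover for some `C^∞` `(k-1)`-forms `α`, `β` that are bounded with respect to `π^*Ω`. -/
def IsTildeDelDelbarBounded (π : M' → M) (Ω : M → E [⋀^Fin 2]→L[ℝ] ℂ)
    (φ : M → E [⋀^Fin k]→L[ℝ] ℂ) : Prop :=
  ∃ (j : ℕ) (h : j + 1 = k) (α β : M' → E [⋀^Fin j]→L[ℝ] ℂ),
    IsSmoothForm α ∧ IsSmoothForm β ∧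
    IsBoundedForm (pullback π Ω) α ∧ IsBoundedForm (pullback π Ω) β ∧
      ∀ x, pullback π φ x = castDegree h (delForm α x + delbarForm β x)

/-- `M` (with universal cover `π`) is Kähler hyperbolic. -/
def KahlerHyperbolic (π : M' → M) : Prop :=
  ∃ Ω : M → E [⋀^Fin 2]→L[ℝ] ℂ, IsKahler Ω ∧ IsTildeDBounded π Ω Ω

/-- `M` (with universal cover `π`) is SKT hyperbolic. -/
def SKTHyperbolic (π : M' → M) : Prop :=
  ∃ Ω : M → E [⋀^Fin 2]→L[ℝ] ℂ, IsSKT Ω ∧ IsTildeDelDelbarBounded π Ω Ω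

/-- `M` (of dimension `n`, with universal cover `π`) is balanced hyperbolic. -/
def BalancedHyperbolic (n : ℕ) (π : M' → M) : Prop :=
  ∃ Ω : M → E [⋀^Fin 2]→L[ℝ] ℂ, IsBalanced n Ω ∧ IsTildeDBounded π Ω (powForm Ω (n - 1))

/-- `M` (of dimension `n`, with universal cover `π`) is Gauduchon hyperbolic. (A metric `Ω` as
below satisfies `∂∂̄Ω^{n-1} = 0`, so it is Gauduchon.) -/
def GauduchonHyperbolic (n : ℕ) (π : M' → M) : Prop :=
  ∃ Ω : M → E [⋀^Fin 2]→L[ℝ] ℂ,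
    IsHermitianMetric Ω ∧ IsTildeDelDelbarBounded π Ω (powForm Ω (n - 1))

variable (E M) in
/-- `M` (of dimension `n`) is degenerate balanced: it carries a Hermitian metric `Ω` such that
`Ω^{n-1}` is `d`-exact on `M`. -/
def DegenerateBalanced (n : ℕ) : Prop :=
  ∃ Ω : M → E [⋀^Fin 2]→L[ℝ] ℂ, IsHermitianMetric Ω ∧
    ∃ (j : ℕ) (h : j + 1 = 2 * (n - 1)) (Γ : M → E [⋀^Fin j]→L[ℝ] ℂ),
      IsSmoothForm Γ ∧ ∀ x, powForm Ω (n - 1) x = castDegree h (dForm Γ x)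

end Forms

/-! ### Kobayashi hyperbolicity -/

section Kobayashi

/-- The Poincaré distance of the unit disc. -/
def poincareDist (a b : ℂ) : ℝ :=
  2 * Real.artanh (‖a - b‖ / ‖1 - (starRingEnd ℂ) a * b‖)

variable (E : Type*) [NormedAddCommGroup E] [NormedSpace ℂ E]
  {M : Type*} [TopologicalSpace M] [ChartedSpace E M]

/-- The infimum of the Poincaré distances `ρ(a, b)` over all holomorphic maps `f` from the unit disc
to `M` and all points `a`, `b` of the disc such that `f a = x` and `f b = y`. -/
def discDist (x y : M) : ENNReal :=
  ⨅ (f : ℂ → M) (a : ℂ) (b : ℂ)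
    (_ : MDifferentiableOn 𝓘(ℂ, ℂ) 𝓘(ℂ, E) f (Metric.ball 0 1))
    (_ : a ∈ Metric.ball (0 : ℂ) 1) (_ : b ∈ Metric.ball (0 : ℂ) 1) (_ : f a = x) (_ : f b = y),
    ENNReal.ofReal (poincareDist a b)

/-- The Kobayashi pseudo-distance: the infimum of the lengths of chains of holomorphic discs. -/
def kobayashiDist (x y : M) : ENNReal :=
  ⨅ (m : ℕ) (p : ℕ → M) (_ : p 0 = x) (_ : p m = y),
    ∑ i ∈ Finset.range m, discDist E (p i) (p (i + 1))

variable (M) in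
/-- `M` is Kobayashi hyperbolic: the Kobayashi pseudo-distance (which is always symmetric and
satisfies the triangle inequality) separates points, i.e. it is a distance. -/
def KobayashiHyperbolic : Prop :=
  ∀ x y : M, kobayashiDist E x y = 0 → x = y

end Kobayashi

/-! ### Divisorial hyperbolicity

Below `m = n - 1`, and `θ` is a `(1,1)`-form on `ℂ^m` (the pullback `f^*Ω`), possibly degenerate. -/

section Divisorial

variable {m : ℕ}

/-- The standard oriented real basis `e₁, ie₁, …, e_m, ie_m` of `ℂ^m`. -/
def stdFrame (m : ℕ) (i : Fin (2 * m)) : EuclideanSpace ℂ (Fin m) :=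
  EuclideanSpace.single ⟨i / 2, by omega⟩ (if (i : ℕ) % 2 = 0 then 1 else Complex.I)

/-- The density of the top-degree form `θ^m / m!` with respect to Lebesgue measure. -/
def volDensity (θ : EuclideanSpace ℂ (Fin m) → EuclideanSpace ℂ (Fin m) [⋀^Fin 2]→L[ℝ] ℂ)
    (z : EuclideanSpace ℂ (Fin m)) : ℝ :=
  ((m.factorial : ℝ)⁻¹ • powForm θ m z (stdFrame m)).re

/-- The volume `∫_{B_r} θ^m / m!` of the ball of radius `r`. -/
def ballVolume (θ : EuclideanSpace ℂ (Fin m) → EuclideanSpace ℂ (Fin m) [⋀^Fin 2]→L[ℝ] ℂ)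
    (r : ℝ) : ℝ :=
  ∫ z in Metric.ball (0 : EuclideanSpace ℂ (Fin m)) r, volDensity θ z

/-- The norm `|dτ|_θ` at `z` of the differential of `τ(z) = |z|²` (the dual norm of the metric
defined by `θ`; it is meaningful at the points where `θ` is non-degenerate). -/
def dtauNorm (θ : EuclideanSpace ℂ (Fin m) → EuclideanSpace ℂ (Fin m) [⋀^Fin 2]→L[ℝ] ℂ)
    (z : EuclideanSpace ℂ (Fin m)) : ℝ :=
  sSup {s | ∃ v : EuclideanSpace ℂ (Fin m), vecNorm (θ z) v ≤ 1 ∧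
    s = |fderiv ℝ (fun u : EuclideanSpace ℂ (Fin m) => ‖u‖ ^ 2) z v|}

/-- The density, with respect to the Euclidean area measure `dA` of the sphere of radius `t = |z|`,
of the area measure `dσ = ⋆(dτ / |dτ|)` induced by `θ`. Indeed `(dτ / |dτ|) ∧ dσ = θ^m / m!`, while
`dτ = 2t dt` and Lebesgue measure is `dt ∧ dA`, so that `dσ = (|dτ| / 2t) (θ^m / m!) / (dt ∧ dA) dA`.
It is `0` where `θ` is degenerate. -/
def areaDensity (θ : EuclideanSpace ℂ (Fin m) → EuclideanSpace ℂ (Fin m) [⋀^Fin 2]→L[ℝ] ℂ)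
    (z : EuclideanSpace ℂ (Fin m)) : ℝ :=
  dtauNorm θ z * volDensity θ z / (2 * ‖z‖)

/-- The integral of `h` over the sphere of radius `t` in `ℂ^m = ℝ^{2m}`, `m ≥ 1`, with respect to
the Euclidean area measure. -/
def sphereIntegral (t : ℝ) (h : EuclideanSpace ℂ (Fin m) → ℝ) : ℝ :=
  t ^ (2 * m - 1) * ∫ u : Metric.sphere (0 : EuclideanSpace ℂ (Fin m)) 1,
    h (t • (u : EuclideanSpace ℂ (Fin m)))
      ∂(MeasureTheory.volume : MeasureTheory.Measure (EuclideanSpace ℂ (Fin m))).toSphere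

variable {E : Type*} [NormedAddCommGroup E] [NormedSpace ℂ E]
  {M : Type*} [TopologicalSpace M] [ChartedSpace E M]

/-- The map `f : ℂ^m → M` has subexponential growth with respect to the metric `Ω`. -/
def HasSubexponentialGrowth (Ω : M → E [⋀^Fin 2]→L[ℝ] ℂ) (f : EuclideanSpace ℂ (Fin m) → M) :
    Prop :=
  (∃ C₁ : ℝ, 0 < C₁ ∧ ∃ r₀ : ℝ, 0 < r₀ ∧ ∀ t : ℝ, r₀ < t →
    sphereIntegral t (fun z => dtauNorm (pullback f Ω) z * areaDensity (pullback f Ω) z) ≤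
      C₁ * t * ballVolume (pullback f Ω) t) ∧
  ∀ C : ℝ, 0 < C → Filter.limsup (fun b : ℝ =>
    ((b / C - Real.log (∫ t in (0 : ℝ)..b, ballVolume (pullback f Ω) t) : ℝ) : EReal))
      Filter.atTop = ⊤

variable (E M) in
/-- `M`, of dimension `n ≥ 2`, is divisorially hyperbolic: no holomorphic map `ℂ^{n-1} → M` that is
non-degenerate at some point has subexponential growth (with respect to any Hermitian metric). -/
def DivisoriallyHyperbolic (n : ℕ) : Prop :=
  ∀ (Ω : M → E [⋀^Fin 2]→L[ℝ] ℂ) (f : EuclideanSpace ℂ (Fin (n - 1)) → M),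
    IsHermitianMetric Ω →
    MDifferentiable 𝓘(ℂ, EuclideanSpace ℂ (Fin (n - 1))) 𝓘(ℂ, E) f →
    (∃ z, Function.Injective (mfderiv 𝓘(ℂ, EuclideanSpace ℂ (Fin (n - 1))) 𝓘(ℂ, E) f z)) →
    ¬ HasSubexponentialGrowth Ω f

end Divisorial

end HermitianHyperbolicity

end

open scoped Manifold ContDiff Topology

set_option linter.unusedSectionVars false

noncomputable section

/-! The implications between conditions on forms are calculus. Since d = ∂ + ∂̄, a single bounded
primitive serves for both the ∂ and the ∂̄ term. For a Kähler metric Ω the two components of dΩ = 0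
have different types, so ∂̄Ω = 0 and Ω is pluriclosed. If π^*Ω = dβ, then β ∧ π^*Ω^p is a primitive
of π^*Ω^(p+1), bounded as a product of bounded forms. On a compact manifold every smooth form is
bounded, so a primitive on X pulls back to a bounded primitive on the cover.

The two analytic implications rest on one isoperimetric inequality, `exists_isoperimetric`. Let f be
holomorphic from a ball of ℂ^m to X and θ = f^*Ω. After lifting f to the universal cover, θ^m = ∂α +
∂̄β with α and β bounded with respect to θ. Stokes' theorem on B_t bounds W(t) = Vol(B_t) by a
multiple of the θ-area of S_t. The area density is |dτ|/(2t) times the volume density, so the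
Cauchy–Schwarz inequality gives W(t)² ≤ K (∫ |dτ| dσ) W'(t)/t. The form θ may degenerate; the
pointwise estimates come from diagonalizing θ in a unitary basis, where the density is a constant
times the product of the eigenvalues.

Gauduchon ⇒ divisorial: condition (i) bounds ∫ |dτ| dσ by C₁ t W(t), so W ≤ D W' for large t. Then W
grows at least like exp(t/D), against condition (ii) with C = D. The metric that measures growth is
arbitrary, but any two metrics on a compact X are comparable.

SKT ⇒ Kobayashi: for m = 1 the integral ∫ |dτ| dσ is at most a constant times t², whatever θ is.
Hence W² ≤ C t W', which integrates to W(r) log(T/r) ≤ C: a disc that extends far has little area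
near its centre. Brody's reparametrization turns a disc with large derivative into a disc of large
radius with speed one at the centre and at most two around it. Such a disc has area bounded below
near the centre, so its radius is bounded. Thus derivatives of holomorphic discs at the origin are
uniformly bounded, cut-off functions are Lipschitz for the Kobayashi pseudo-distance, and points are
separated.

Kobayashi ⇒ divisorial: the pseudo-distance vanishes along entire curves, so f is constant on
complex lines and its differential is nowhere injective. -/

namespace HermitianHyperbolicity

/-! ### Antisymmetrization of functions of several vectors -/

section Antisymmetrization

variable {E : Type*} {k l n : ℕ}

/-- The signed sum of `f` over all permutations of its arguments. -/
def antisum (f : (Fin n → E) → ℂ) (v : Fin n → E) : ℂ :=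
  ∑ σ : Equiv.Perm (Fin n), (Equiv.Perm.sign σ : ℤ) • f (v ∘ σ)

theorem antisum_of_comp_perm (f : (Fin n → E) → ℂ) (τ : Equiv.Perm (Fin n)) (v : Fin n → E) :
    antisum (fun w => f (w ∘ τ)) v = (Equiv.Perm.sign τ : ℤ) • antisum f v := by
  unfold antisum
  rw [Finset.smul_sum]
  refine Fintype.sum_equiv (Equiv.mulRight τ) _ _ fun σ => ?_
  have h : ((Equiv.Perm.sign τ : ℤ) * (Equiv.Perm.sign τ : ℤ)) = 1 := by
    rw [← Units.val_mul, Int.units_mul_self]; rfl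
  simp only [Equiv.coe_mulRight, Equiv.Perm.sign_mul, Units.val_mul, smul_smul]
  rw [mul_comm (Equiv.Perm.sign σ : ℤ), ← mul_assoc, h, one_mul]
  rfl

theorem antisum_alternating {E : Type*} [AddCommGroup E] [Module ℝ E]
    (α : E [⋀^Fin n]→ₗ[ℝ] ℂ) (v : Fin n → E) :
    antisum α v = (n.factorial : ℂ) * α v := by
  unfold antisum
  have : ∀ σ : Equiv.Perm (Fin n), (Equiv.Perm.sign σ : ℤ) • α (v ∘ σ) = α v := by
    intro σ
    rw [α.map_perm, Units.smul_def, smul_smul, ← Units.val_mul, Int.units_mul_self]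
    simp
  simp [this, Fintype.card_perm]

/-- Permutations of `Fin (n + 1)` are parametrized by the image of `0` and a permutation of the
remaining indices. -/
theorem bijective_cycleRange_mul : Function.Bijective
    (fun p : Fin (n + 1) × Equiv.Perm (Fin n) =>
      p.1.cycleRange.symm * Equiv.Perm.decomposeFin.symm (0, p.2)) := by
  rw [Fintype.bijective_iff_injective_and_card]
  constructor
  · rintro ⟨i, σ⟩ ⟨j, τ⟩ h
    have h0 := DFunLike.congr_fun h 0
    have hij : i = j := by simpa using h0
    subst hij
    have := mul_left_cancel h
    have := Equiv.Perm.decomposeFin.symm.injective this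
    simpa using this
  · simp [Fintype.card_perm, Nat.factorial_succ]

/-- The permutations are grouped by the argument `i` they bring to the front, and the cycle doing
this has sign (-1)^i. The right side has the shape of `alternatizeUncurryFin`, which is how wedge
products and exterior derivatives are compared below. -/
theorem antisum_succ (f : (Fin (n + 1) → E) → ℂ) (v : Fin (n + 1) → E) :
    antisum f v = ∑ i : Fin (n + 1), (-1 : ℤ) ^ (i : ℕ) •
      antisum (fun w => f (Fin.cons (v i) w)) (i.removeNth v) := by
  unfold antisum
  rw [← (Equiv.ofBijective _ (bijective_cycleRange_mul (n := n))).sum_comp, Fintype.sum_prod_type]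
  refine Finset.sum_congr rfl fun i _ => ?_
  rw [Finset.smul_sum]
  refine Finset.sum_congr rfl fun σ _ => ?_
  have hs : (Equiv.Perm.sign (i.cycleRange.symm * Equiv.Perm.decomposeFin.symm (0, σ)) : ℤ)
      = (-1) ^ (i : ℕ) * (Equiv.Perm.sign σ : ℤ) := by
    rw [Equiv.Perm.sign_mul, Equiv.Perm.sign_symm, Fin.sign_cycleRange]
    simp
  have hv : v ∘ (i.cycleRange.symm * Equiv.Perm.decomposeFin.symm (0, σ) : Equiv.Perm _) =
      Fin.cons (v i) (i.removeNth v ∘ σ) := by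
    funext j
    refine Fin.cases ?_ (fun j => ?_) j
    · simp
    · simp [Fin.removeNth]
  simp only [Equiv.ofBijective_apply]
  rw [hs, hv, smul_smul]

/-- Extend a permutation of the first `k` indices by the identity. -/
def permLeft (l : ℕ) (ρ : Equiv.Perm (Fin k)) : Equiv.Perm (Fin (k + l)) :=
  finSumFinEquiv.permCongr (Equiv.sumCongr ρ (Equiv.refl (Fin l)))

/-- Extend a permutation of the last `l` indices by the identity. -/
def permRight (k : ℕ) (ρ : Equiv.Perm (Fin l)) : Equiv.Perm (Fin (k + l)) :=
  finSumFinEquiv.permCongr (Equiv.sumCongr (Equiv.refl (Fin k)) ρ)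

theorem sign_permLeft (ρ : Equiv.Perm (Fin k)) :
    Equiv.Perm.sign (permLeft l ρ) = Equiv.Perm.sign ρ := by
  rw [permLeft, Equiv.Perm.sign_permCongr]
  simp

theorem sign_permRight (ρ : Equiv.Perm (Fin l)) :
    Equiv.Perm.sign (permRight k ρ) = Equiv.Perm.sign ρ := by
  rw [permRight, Equiv.Perm.sign_permCongr]
  simp

@[simp] theorem permLeft_castAdd (ρ : Equiv.Perm (Fin k)) (i : Fin k) :
    permLeft l ρ (Fin.castAdd l i) = Fin.castAdd l (ρ i) := by
  simp [permLeft, Equiv.permCongr_apply]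

@[simp] theorem permLeft_natAdd (ρ : Equiv.Perm (Fin k)) (i : Fin l) :
    permLeft l ρ (Fin.natAdd k i) = Fin.natAdd k i := by
  simp [permLeft, Equiv.permCongr_apply]

@[simp] theorem permRight_castAdd (ρ : Equiv.Perm (Fin l)) (i : Fin k) :
    permRight k ρ (Fin.castAdd l i) = Fin.castAdd l i := by
  simp [permRight, Equiv.permCongr_apply]

@[simp] theorem permRight_natAdd (ρ : Equiv.Perm (Fin l)) (i : Fin l) :
    permRight k ρ (Fin.natAdd k i) = Fin.natAdd k (ρ i) := by
  simp [permRight, Equiv.permCongr_apply]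

/-- The product of a function of the first `k` vectors and one of the last `l` vectors. -/
def tensorFun (f : (Fin k → E) → ℂ) (g : (Fin l → E) → ℂ) (v : Fin (k + l) → E) : ℂ :=
  f (fun i => v (Fin.castAdd l i)) * g (fun j => v (Fin.natAdd k j))

/-- A permutation of the first `k` slots extends to all slots with the same sign, so each of the k!
inner terms contributes the same outer sum. -/
theorem antisum_tensorFun_antisum_left (f : (Fin k → E) → ℂ) (g : (Fin l → E) → ℂ)
    (v : Fin (k + l) → E) :
    antisum (tensorFun (antisum f) g) v = (k.factorial : ℂ) * antisum (tensorFun f g) v := by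
  have h : tensorFun (antisum f) g = fun w => ∑ ρ : Equiv.Perm (Fin k),
      (Equiv.Perm.sign ρ : ℤ) • tensorFun f g (w ∘ permLeft l ρ) := by
    funext w
    simp only [tensorFun, antisum, Finset.sum_mul, smul_mul_assoc]
    simp [Function.comp_def]
  have h2 : antisum (tensorFun (antisum f) g) v = ∑ ρ : Equiv.Perm (Fin k),
      (Equiv.Perm.sign ρ : ℤ) • antisum (fun w => tensorFun f g (w ∘ permLeft l ρ)) v := by
    rw [h]
    simp only [antisum, Finset.smul_sum]
    rw [Finset.sum_comm]
    exact Finset.sum_congr rfl fun ρ _ => Finset.sum_congr rfl fun σ _ => smul_comm _ _ _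
  rw [h2]
  have h3 : ∀ ρ : Equiv.Perm (Fin k), (Equiv.Perm.sign ρ : ℤ) •
      antisum (fun w => tensorFun f g (w ∘ permLeft l ρ)) v = antisum (tensorFun f g) v := by
    intro ρ
    rw [antisum_of_comp_perm, sign_permLeft, smul_smul, ← Units.val_mul, Int.units_mul_self]
    simp
  simp [h3, Fintype.card_perm]

theorem antisum_tensorFun_antisum_right (f : (Fin k → E) → ℂ) (g : (Fin l → E) → ℂ)
    (v : Fin (k + l) → E) :
    antisum (tensorFun f (antisum g)) v = (l.factorial : ℂ) * antisum (tensorFun f g) v := by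
  have h : tensorFun f (antisum g) = fun w => ∑ ρ : Equiv.Perm (Fin l),
      (Equiv.Perm.sign ρ : ℤ) • tensorFun f g (w ∘ permRight k ρ) := by
    funext w
    simp only [tensorFun, antisum, Finset.mul_sum, mul_smul_comm]
    simp [Function.comp_def]
  have h2 : antisum (tensorFun f (antisum g)) v = ∑ ρ : Equiv.Perm (Fin l),
      (Equiv.Perm.sign ρ : ℤ) • antisum (fun w => tensorFun f g (w ∘ permRight k ρ)) v := by
    rw [h]
    simp only [antisum, Finset.smul_sum]
    rw [Finset.sum_comm]
    exact Finset.sum_congr rfl fun ρ _ => Finset.sum_congr rfl fun σ _ => smul_comm _ _ _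
  rw [h2]
  have h3 : ∀ ρ : Equiv.Perm (Fin l), (Equiv.Perm.sign ρ : ℤ) •
      antisum (fun w => tensorFun f g (w ∘ permRight k ρ)) v = antisum (tensorFun f g) v := by
    intro ρ
    rw [antisum_of_comp_perm, sign_permRight, smul_smul, ← Units.val_mul, Int.units_mul_self]
    simp
  simp [h3, Fintype.card_perm]

end Antisymmetrization

/-! ### The wedge product -/

section Wedge

variable {E : Type*} [NormedAddCommGroup E] [NormedSpace ℂ E]
  {F : Type*} [NormedAddCommGroup F] [NormedSpace ℂ F] {k l : ℕ}

theorem wedge_eq_antisum (α : E [⋀^Fin k]→L[ℝ] ℂ) (β : E [⋀^Fin l]→L[ℝ] ℂ)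
    (v : Fin (k + l) → E) :
    wedge α β v = ((k.factorial : ℂ) * l.factorial)⁻¹ * antisum (tensorFun α β) v := by
  have h : ∀ w : Fin (k + l) → E, tensorForm α β w = tensorFun α β w := fun w => rfl
  rw [wedge, ContinuousAlternatingMap.smul_apply,
    ContinuousMultilinearMap.alternatization_apply_apply]
  simp only [h, antisum, Complex.real_smul]
  push_cast
  rfl

theorem wedge_compContinuousLinearMap (α : F [⋀^Fin k]→L[ℝ] ℂ) (β : F [⋀^Fin l]→L[ℝ] ℂ)
    (g : E →L[ℝ] F) :
    (wedge α β).compContinuousLinearMap g =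
      wedge (α.compContinuousLinearMap g) (β.compContinuousLinearMap g) := by
  ext v
  rw [ContinuousAlternatingMap.compContinuousLinearMap_apply, wedge_eq_antisum, wedge_eq_antisum]
  rfl

theorem norm_wedge_apply_le (α : E [⋀^Fin k]→L[ℝ] ℂ) (β : E [⋀^Fin l]→L[ℝ] ℂ) {N : E → ℝ}
    {a b : ℝ} (hα : ∀ v, ‖α v‖ ≤ a * ∏ i, N (v i)) (hβ : ∀ v, ‖β v‖ ≤ b * ∏ i, N (v i))
    (v : Fin (k + l) → E) :
    ‖wedge α β v‖ ≤ (k + l).factorial * (a * b) * ∏ i, N (v i) := by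
  have hterm : ∀ σ : Equiv.Perm (Fin (k + l)),
      ‖(Equiv.Perm.sign σ : ℤ) • tensorFun α β (v ∘ σ)‖ ≤ a * b * ∏ i, N (v i) := by
    intro σ
    have h1 : ‖(Equiv.Perm.sign σ : ℤ) • tensorFun α β (v ∘ σ)‖ = ‖tensorFun α β (v ∘ σ)‖ := by
      rcases Int.units_eq_one_or (Equiv.Perm.sign σ) with h | h <;> simp [h]
    rw [h1, tensorFun, norm_mul]
    have h2 : ∏ i, N (v i) = (∏ i : Fin k, N (v (σ (Fin.castAdd l i)))) *
        ∏ j : Fin l, N (v (σ (Fin.natAdd k j))) := by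
      rw [← Fin.prod_univ_add (fun i => N (v (σ i)))]
      exact (Equiv.prod_comp σ (fun i => N (v i))).symm
    have hα' := hα (fun i => (v ∘ σ) (Fin.castAdd l i))
    have hβ' := hβ (fun i => (v ∘ σ) (Fin.natAdd k i))
    calc _ ≤ _ := mul_le_mul hα' hβ' (norm_nonneg _) ((norm_nonneg _).trans hα')
      _ = _ := by rw [h2]; simp only [Function.comp]; ring
  rw [wedge_eq_antisum, norm_mul]
  have h1 : ‖((k.factorial : ℂ) * l.factorial)⁻¹‖ ≤ 1 := by
    rw [norm_inv, norm_mul, Complex.norm_natCast, Complex.norm_natCast]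
    apply inv_le_one_of_one_le₀
    have := Nat.mul_pos (Nat.factorial_pos k) (Nat.factorial_pos l)
    exact_mod_cast this
  calc _ ≤ 1 * ‖antisum (tensorFun α β) v‖ := by gcongr
    _ ≤ ∑ σ : Equiv.Perm (Fin (k + l)), a * b * ∏ i, N (v i) := by
      rw [one_mul]
      exact (norm_sum_le _ _).trans (Finset.sum_le_sum fun σ _ => hterm σ)
    _ = _ := by simp [Fintype.card_perm, mul_assoc]

theorem norm_wedge_le (α : E [⋀^Fin k]→L[ℝ] ℂ) (β : E [⋀^Fin l]→L[ℝ] ℂ) :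
    ‖wedge α β‖ ≤ (k + l).factorial * ‖α‖ * ‖β‖ := by
  refine ContinuousAlternatingMap.opNorm_le_bound _ (by positivity) fun v => ?_
  have := norm_wedge_apply_le α β (N := fun x => ‖x‖) α.le_opNorm β.le_opNorm v
  simpa [mul_assoc] using this

variable (E k l) in
/-- The wedge product as a continuous bilinear map. -/
def wedgeCLM : (E [⋀^Fin k]→L[ℝ] ℂ) →L[ℝ] (E [⋀^Fin l]→L[ℝ] ℂ) →L[ℝ] (E [⋀^Fin (k + l)]→L[ℝ] ℂ) :=
  LinearMap.mkContinuous₂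
    (LinearMap.mk₂ ℝ wedge
      (fun α α' β => by
        ext v
        simp only [wedge_eq_antisum, ContinuousAlternatingMap.add_apply, antisum, tensorFun,
          add_mul, smul_add, Finset.sum_add_distrib, mul_add])
      (fun c α β => by
        ext v
        simp only [wedge_eq_antisum, ContinuousAlternatingMap.smul_apply, antisum, tensorFun,
          Complex.real_smul, mul_assoc]
        simp only [← mul_smul_comm, ← Finset.mul_sum]
        ring)
      (fun α β β' => by
        ext v
        simp only [wedge_eq_antisum, ContinuousAlternatingMap.add_apply, antisum, tensorFun,
          mul_add, smul_add, Finset.sum_add_distrib])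
      (fun c α β => by
        ext v
        simp only [wedge_eq_antisum, ContinuousAlternatingMap.smul_apply, antisum, tensorFun,
          Complex.real_smul, mul_left_comm _ (c : ℂ)]
        simp only [← mul_smul_comm, ← Finset.mul_sum]
        ring))
    ((k + l).factorial) (fun α β => norm_wedge_le α β)

theorem wedgeCLM_apply (α : E [⋀^Fin k]→L[ℝ] ℂ) (β : E [⋀^Fin l]→L[ℝ] ℂ) :
    wedgeCLM E k l α β = wedge α β := rfl

/-- This turns the Leibniz rule into an identity between iterated antisymmetrizations. -/
theorem alternatizeUncurryFin_eq_antisum (L : E →L[ℝ] E [⋀^Fin k]→L[ℝ] ℂ) (v : Fin (k + 1) → E) :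
    antisum (fun w : Fin (k + 1) → E => L (w 0) (Fin.tail w)) v =
      (k.factorial : ℂ) * ContinuousAlternatingMap.alternatizeUncurryFin L v := by
  rw [antisum_succ, ContinuousAlternatingMap.alternatizeUncurryFin_apply, Finset.mul_sum]
  refine Finset.sum_congr rfl fun i _ => ?_
  have := antisum_alternating (L (v i)).toAlternatingMap (i.removeNth v)
  simp only [Fin.cons_zero, Fin.tail_cons]
  rw [mul_smul_comm]
  congr 1

/-- The first half of the Leibniz rule. -/
theorem alternatizeUncurryFin_wedge_left (L : E →L[ℝ] E [⋀^Fin k]→L[ℝ] ℂ)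
    (θ : E [⋀^Fin 2]→L[ℝ] ℂ) :
    ContinuousAlternatingMap.alternatizeUncurryFin ((wedgeCLM E k 2).flip θ ∘L L) =
      (wedge (ContinuousAlternatingMap.alternatizeUncurryFin L) θ : E [⋀^Fin (k + 1 + 2)]→L[ℝ] ℂ) := by
  ext v
  have hk : (k.factorial : ℂ) ≠ 0 := by exact_mod_cast k.factorial_ne_zero
  have hk1 : ((k + 1).factorial : ℂ) ≠ 0 := by exact_mod_cast (k + 1).factorial_ne_zero
  -- Both sides equal (k! 2!)⁻¹ times the antisymmetrization of `T`: the left by expansion along the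
  -- first argument, the right by absorbing the inner antisymmetrization of `L`.
  set T : (Fin (k + 1 + 2) → E) → ℂ :=
    tensorFun (fun w : Fin (k + 1) → E => L (w 0) (Fin.tail w)) θ with hT
  have hl : ContinuousAlternatingMap.alternatizeUncurryFin ((wedgeCLM E k 2).flip θ ∘L L) v =
      ((k.factorial : ℂ) * (2).factorial)⁻¹ * antisum T v := by
    rw [ContinuousAlternatingMap.alternatizeUncurryFin_apply]
    have := antisum_succ (n := k + 2) T v
    rw [this, Finset.mul_sum]
    refine Finset.sum_congr rfl fun i _ => ?_
    rw [mul_smul_comm]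
    congr 1
    rw [ContinuousLinearMap.comp_apply, ContinuousLinearMap.flip_apply, wedgeCLM_apply,
      wedge_eq_antisum]
    congr 2
    funext w
    simp only [hT, tensorFun]
    congr 1
    · congr 1
      funext j
      have : Fin.natAdd (k + 1) j = (Fin.natAdd k j).succ := by ext; simp; omega
      rw [this]
      simp
  have hr : wedge (ContinuousAlternatingMap.alternatizeUncurryFin L) θ v =
      ((k.factorial : ℂ) * (2).factorial)⁻¹ * antisum T v := by
    rw [wedge_eq_antisum]
    have h1 := antisum_tensorFun_antisum_left (fun w : Fin (k + 1) → E => L (w 0) (Fin.tail w)) θ v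
    have h2 : tensorFun (antisum fun w : Fin (k + 1) → E => L (w 0) (Fin.tail w)) θ = fun w =>
        (k.factorial : ℂ) *
          tensorFun (ContinuousAlternatingMap.alternatizeUncurryFin L) θ w := by
      funext w
      simp only [tensorFun, alternatizeUncurryFin_eq_antisum, mul_assoc]
    have h3 : antisum (tensorFun (antisum fun w : Fin (k + 1) → E => L (w 0) (Fin.tail w)) θ) v =
        (k.factorial : ℂ) *
          antisum (tensorFun (ContinuousAlternatingMap.alternatizeUncurryFin L) θ) v := by
      rw [h2]
      simp only [antisum, mul_smul_comm, Finset.mul_sum]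
    rw [h3] at h1
    rw [← hT] at h1
    have h4 : antisum (tensorFun (ContinuousAlternatingMap.alternatizeUncurryFin L) θ) v =
      (k.factorial : ℂ)⁻¹ * ((k + 1).factorial * antisum T v) := by
      rw [← h1, inv_mul_cancel_left₀ hk]
    rw [h4]
    field_simp
  exact hl.trans hr.symm

/-- The second half of the Leibniz rule, for the wedge product with a closed `2`-form. -/
theorem alternatizeUncurryFin_wedge_right_eq_zero (α : E [⋀^Fin k]→L[ℝ] ℂ)
    (M : E →L[ℝ] E [⋀^Fin 2]→L[ℝ] ℂ)
    (hM : ContinuousAlternatingMap.alternatizeUncurryFin M = 0) :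
    ContinuousAlternatingMap.alternatizeUncurryFin (wedgeCLM E k 2 α ∘L M) = 0 := by
  ext v
  set G : (Fin 3 → E) → ℂ := fun w => M (w 0) (Fin.tail w) with hG
  have hG0 : antisum G = 0 := by
    funext w
    rw [hG, alternatizeUncurryFin_eq_antisum, hM]
    simp
  set T : (Fin (k + 3) → E) → ℂ := tensorFun α G with hT
  have hT0 : antisum T v = 0 := by
    have := antisum_tensorFun_antisum_right α G v
    rw [hG0, ← hT] at this
    have h0 : antisum (tensorFun α (0 : (Fin 3 → E) → ℂ)) v = 0 := by
      simp [antisum, tensorFun]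
    rw [h0] at this
    have h6 : ((3).factorial : ℂ) ≠ 0 := by exact_mod_cast (3).factorial_ne_zero
    exact (mul_eq_zero.mp this.symm).resolve_left h6
  rw [ContinuousAlternatingMap.alternatizeUncurryFin_apply]
  -- In `T` the differentiation slot of `M` stands at position `k`; the cycle `c` brings it to the
  -- front, where `antisum_succ` expands. The sign of `c` is irrelevant because the full
  -- antisymmetrization vanishes.
  set c : Equiv.Perm (Fin (k + 3)) := (⟨k, by omega⟩ : Fin (k + 3)).cycleRange with hc
  have hcz : c ⟨k, by omega⟩ = ⟨0, by omega⟩ := by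
    rw [hc, Fin.cycleRange_self]; rfl
  have h1 := antisum_succ (n := k + 2) (fun w => T (w ∘ c)) v
  rw [antisum_of_comp_perm, hT0, smul_zero] at h1
  have h2 : ∀ i : Fin (k + 2 + 1), (-1 : ℤ) ^ (i : ℕ) •
      antisum (fun w => T ((Fin.cons (v i) w : Fin (k + 2 + 1) → E) ∘ c)) (i.removeNth v) =
      ((k.factorial : ℂ) * (2).factorial) * ((-1 : ℤ) ^ (i : ℕ) •
        ((wedgeCLM E k 2 α ∘L M) (v i)) (i.removeNth v)) := by
    intro i
    rw [ContinuousLinearMap.comp_apply, wedgeCLM_apply, wedge_eq_antisum, mul_smul_comm]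
    congr 1
    rw [mul_inv_cancel_left₀ (mul_ne_zero (by exact_mod_cast k.factorial_ne_zero)
      (by exact_mod_cast (2).factorial_ne_zero))]
    congr 1
    funext w
    simp only [hT, hG, tensorFun]
    congr 1
    · congr 1
      funext j
      have : c (Fin.castAdd 3 j) = (Fin.castAdd 2 j).succ := by
        rw [hc, Fin.cycleRange_of_lt (by simp [Fin.lt_def])]
        ext
        rw [Fin.val_add_one_of_lt (by simp [Fin.lt_def]; omega)]
        simp
      simp only [Function.comp]
      rw [this]
      simp
    · have e0 : c (Fin.natAdd k (0 : Fin 3)) = 0 := hcz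
      have e1 : ∀ j : Fin 2, c (Fin.natAdd k j.succ) = (Fin.natAdd k j).succ := by
        intro j
        rw [hc, Fin.cycleRange_of_gt]
        · rfl
        · simp [Fin.lt_def]
      simp only [Function.comp, e0, Fin.cons_zero]
      congr 1
      funext j
      simp only [Fin.tail, e1]
      simp
  rw [Finset.sum_congr rfl fun i _ => h2 i, ← Finset.mul_sum] at h1
  have h3 := (mul_eq_zero.mp h1.symm).resolve_left
    (mul_ne_zero (by exact_mod_cast k.factorial_ne_zero) (by exact_mod_cast (2).factorial_ne_zero))
  exact h3

theorem wedge_one_left (θ : E [⋀^Fin 2]→L[ℝ] ℂ) :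
    (wedge (ContinuousAlternatingMap.constOfIsEmpty ℝ E (Fin 0) 1) θ : E [⋀^Fin 2]→L[ℝ] ℂ) = θ := by
  ext v
  have := wedge_eq_antisum (ContinuousAlternatingMap.constOfIsEmpty ℝ E (Fin 0) (1 : ℂ)) θ v
  have h2 : ∀ w : Fin 2 → E, tensorFun (ContinuousAlternatingMap.constOfIsEmpty ℝ E (Fin 0) (1 : ℂ)) θ w
      = θ w := by
    intro w
    simp only [tensorFun, ContinuousAlternatingMap.constOfIsEmpty_apply, one_mul]
    congr 1
    funext j
    congr 1
    ext; simp
  have h3 : antisum θ v = _ * θ v := antisum_alternating θ.toAlternatingMap v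
  rw [this]
  have h4 : antisum (tensorFun (ContinuousAlternatingMap.constOfIsEmpty ℝ E (Fin 0) (1 : ℂ)) θ) v
      = (2 : ℕ).factorial * θ v := by
    rw [← h3]
    congr 1
    funext w
    exact h2 w
  rw [h4]
  simp

theorem wedgePow_one (θ : E [⋀^Fin 2]→L[ℝ] ℂ) : wedgePow θ 1 = θ := wedge_one_left θ

theorem wedgePow_succ (θ : E [⋀^Fin 2]→L[ℝ] ℂ) (p : ℕ) :
    wedgePow θ (p + 1) = wedge (wedgePow θ p) θ := rfl

theorem wedgePow_compContinuousLinearMap (θ : F [⋀^Fin 2]→L[ℝ] ℂ) (g : E →L[ℝ] F) (p : ℕ) :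
    (wedgePow θ p).compContinuousLinearMap g = wedgePow (θ.compContinuousLinearMap g) p := by
  induction p with
  | zero => ext v; simp [wedgePow]
  | succ p ih =>
    rw [wedgePow_succ, wedgePow_succ, ← ih]
    exact wedge_compContinuousLinearMap _ _ _

theorem exists_norm_wedgePow_apply_le (p : ℕ) : ∃ K : ℝ, 0 ≤ K ∧
    ∀ (θ : E [⋀^Fin 2]→L[ℝ] ℂ) (N : E → ℝ), (∀ v, ‖θ v‖ ≤ ∏ i, N (v i)) →
      ∀ v, ‖wedgePow θ p v‖ ≤ K * ∏ i, N (v i) := by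
  induction p with
  | zero => exact ⟨1, zero_le_one, fun θ N _ v => by simp [wedgePow]⟩
  | succ p ih =>
    obtain ⟨K, hK, h⟩ := ih
    refine ⟨(2 * p + 2).factorial * (K * 1), by positivity, fun θ N hθ v => ?_⟩
    exact norm_wedge_apply_le _ _ (h θ N hθ) (fun v => by simpa using hθ v) v

end Wedge

/-! ### The top power of a symplectic form on a symplectic frame -/

section SymplecticFrame

/-- The matrix of the standard symplectic form in the basis `e₁, f₁, e₂, f₂, …`. -/
def symplecticEntry (a b : ℕ) : ℂ :=
  if a / 2 = b / 2 then (if a < b then 1 else if b < a then -1 else 0) else 0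

theorem eq_castAdd_or_eq_natAdd {k l : ℕ} (i : Fin (k + l)) :
    (∃ j : Fin k, i = Fin.castAdd l j) ∨ ∃ j : Fin l, i = Fin.natAdd k j :=
  Fin.addCases (fun j => Or.inl ⟨j, rfl⟩) (fun j => Or.inr ⟨j, rfl⟩) i

theorem exists_perm_eq_permLeft {k l : ℕ} (ρ : Equiv.Perm (Fin (k + l)))
    (h : ∀ i : Fin l, ρ (Fin.natAdd k i) = Fin.natAdd k i) :
    ∃ ρ' : Equiv.Perm (Fin k), ρ = permLeft l ρ' := by
  have hmaps : ∀ i : Fin k, ∃ j : Fin k, ρ (Fin.castAdd l i) = Fin.castAdd l j := by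
    intro i
    rcases eq_castAdd_or_eq_natAdd (ρ (Fin.castAdd l i)) with ⟨j, hj⟩ | ⟨j, hj⟩
    · exact ⟨j, hj⟩
    · have := ρ.injective (hj.trans (h j).symm)
      have h2 := congrArg Fin.val this
      simp at h2
      omega
  have hmem := Equiv.Perm.mem_sumCongrHom_range_of_perm_mapsTo_inl
    (σ := finSumFinEquiv.symm.permCongr ρ) (by
      rintro _ ⟨i, rfl⟩
      obtain ⟨j, hj⟩ := hmaps i
      refine ⟨j, ?_⟩
      simp [Equiv.permCongr_apply, hj])
  obtain ⟨⟨ρ₁, ρ₂⟩, hρ⟩ := hmem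
  refine ⟨ρ₁, ?_⟩
  have hρ' : ρ = finSumFinEquiv.permCongr (Equiv.sumCongr ρ₁ ρ₂) := by
    have := congrArg finSumFinEquiv.permCongr hρ
    ext i
    have h2 := DFunLike.congr_fun this i
    simp [Equiv.permCongr_apply, Equiv.Perm.sumCongrHom] at h2
    simp [Equiv.permCongr_apply, ← h2]
  ext i
  rcases eq_castAdd_or_eq_natAdd i with ⟨j, rfl⟩ | ⟨j, rfl⟩
  · rw [permLeft_castAdd, hρ']
    simp [Equiv.permCongr_apply]
  · rw [permLeft_natAdd, h]

variable {E : Type*} [NormedAddCommGroup E] [NormedSpace ℂ E]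

/-- The permutation that exchanges the pairs `(2j, 2j + 1)` and `(2p, 2p + 1)`. -/
def pairSwap {p : ℕ} (j : ℕ) (hj : j ≤ p) : Equiv.Perm (Fin (2 * p + 2)) :=
  Equiv.swap ⟨2 * j, by omega⟩ ⟨2 * p, by omega⟩ *
    Equiv.swap ⟨2 * j + 1, by omega⟩ ⟨2 * p + 1, by omega⟩

theorem pairSwap_val {p : ℕ} (j : ℕ) (hj : j ≤ p) (c : Fin (2 * p + 2)) :
    (pairSwap j hj c : ℕ) = if (c : ℕ) / 2 = j then 2 * p + c % 2 else
      if (c : ℕ) / 2 = p then 2 * j + c % 2 else c := by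
  have hc := c.2
  simp only [pairSwap, Equiv.Perm.mul_apply, Equiv.swap_apply_def, Fin.ext_iff]
  split_ifs <;> simp_all <;> omega

theorem sign_pairSwap {p : ℕ} (j : ℕ) (hj : j ≤ p) :
    Equiv.Perm.sign (pairSwap j hj) = 1 := by
  rw [pairSwap, Equiv.Perm.sign_mul]
  rcases hj.eq_or_lt with rfl | h
  · simp
  · rw [Equiv.Perm.sign_swap (by simp [Fin.ext_iff]; omega),
      Equiv.Perm.sign_swap (by simp [Fin.ext_iff]; omega)]
    rfl

theorem symplecticEntry_pairSwap {p : ℕ} (j : ℕ) (hj : j ≤ p) (c d : Fin (2 * p + 2)) :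
    symplecticEntry (pairSwap j hj c) (pairSwap j hj d) = symplecticEntry c d := by
  have hc := c.2
  have hd := d.2
  rw [pairSwap_val, pairSwap_val]
  unfold symplecticEntry
  by_cases h : (c : ℕ) / 2 = d / 2
  · have hiff : ∀ x y : ℕ, x / 2 = y / 2 → (x < y ↔ x % 2 < y % 2) := by intros; omega
    rw [← h]
    by_cases h1 : (c : ℕ) / 2 = j
    · simp only [h1, if_true]
      rw [if_pos (by omega)]
      congr 1
      · apply propext; omega
      · congr 1; apply propext; omega
    · simp only [h1, if_false]
      by_cases h2 : (c : ℕ) / 2 = p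
      · simp only [h2, if_true]
        rw [if_pos (by omega)]
        congr 1
        · apply propext; omega
        · congr 1; apply propext; omega
      · simp only [h2, if_false]
        simp [h]
  · rw [if_neg h, if_neg]
    split_ifs <;> omega

/-- Terms of the antisymmetrization whose last two indices form an oriented pair. -/
theorem sign_smul_tensorFun_pos {p : ℕ} {θ : E [⋀^Fin 2]→L[ℝ] ℂ}
    (ih : ∀ v : Fin (2 * p) → E,
      (∀ a b, θ ![v a, v b] = symplecticEntry a b) → ∃ r : ℝ, 0 < r ∧ wedgePow θ p v = r)
    (v : Fin (2 * p + 2) → E) (hv : ∀ a b, θ ![v a, v b] = symplecticEntry a b)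
    (σ : Equiv.Perm (Fin (2 * p + 2)))
    (h1 : (σ (Fin.natAdd (2 * p) 0) : ℕ) / 2 = (σ (Fin.natAdd (2 * p) 1) : ℕ) / 2)
    (h2 : (σ (Fin.natAdd (2 * p) 0) : ℕ) < (σ (Fin.natAdd (2 * p) 1) : ℕ)) :
    ∃ r : ℝ, 0 < r ∧
      (Equiv.Perm.sign σ : ℤ) • tensorFun (wedgePow θ p) θ (v ∘ σ) = r := by
  set a : ℕ := (σ (Fin.natAdd (2 * p) 0) : ℕ) with ha
  set b : ℕ := (σ (Fin.natAdd (2 * p) 1) : ℕ) with hb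
  have haT : a < 2 * p + 2 := (σ (Fin.natAdd (2 * p) 0)).2
  have hj : a / 2 ≤ p := by omega
  set τ := pairSwap (a / 2) hj with hτ
  -- Here `a` and `b` are 2j and 2j + 1, and the even permutation `τ` moves this pair to the end. So
  -- `τ * σ` fixes the last two indices and is a permutation of the others with the sign of `σ`.
  obtain ⟨ρ', hρ'⟩ := exists_perm_eq_permLeft (k := 2 * p) (l := 2) (τ * σ) (by
    intro i
    ext
    rw [Equiv.Perm.mul_apply, hτ, pairSwap_val]
    fin_cases i
    · simp only [Fin.zero_eta]
      rw [← ha]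
      simp only [if_true, Fin.val_natAdd]
      simp; omega
    · simp only [Fin.mk_one]
      rw [← hb, if_pos h1.symm]
      simp; omega)
  have hττ : τ * τ = 1 := by
    ext c
    have := c.2
    rw [Equiv.Perm.mul_apply, hτ, pairSwap_val, pairSwap_val]
    simp only [Equiv.Perm.one_apply]
    split_ifs <;> omega
  have hσ : σ = τ * permLeft 2 ρ' := by
    rw [← hρ', ← mul_assoc, hττ, one_mul]
  have hsign : Equiv.Perm.sign σ = Equiv.Perm.sign ρ' := by
    rw [hσ, Equiv.Perm.sign_mul, sign_permLeft, hτ, sign_pairSwap, one_mul]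
  obtain ⟨r, hr, hr'⟩ := ih (fun c => v (τ (Fin.castAdd 2 c))) (by
    intro c d
    rw [hv, hτ, symplecticEntry_pairSwap]
    rfl)
  refine ⟨r, hr, ?_⟩
  have e1 : (fun i => (v ∘ σ) (Fin.castAdd 2 i)) = (fun c => v (τ (Fin.castAdd 2 c))) ∘ ρ' := by
    funext i
    simp only [Function.comp, hσ, Equiv.Perm.mul_apply, permLeft_castAdd]
  have e2 : θ (fun j => (v ∘ σ) (Fin.natAdd (2 * p) j)) = 1 := by
    have : (fun j : Fin 2 => (v ∘ σ) (Fin.natAdd (2 * p) j)) =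
        ![v (σ (Fin.natAdd (2 * p) 0)), v (σ (Fin.natAdd (2 * p) 1))] := by
      funext j; fin_cases j <;> rfl
    rw [this, hv, symplecticEntry, if_pos h1, if_pos h2]
  have e3 := (wedgePow θ p).toAlternatingMap.map_perm (fun c => v (τ (Fin.castAdd 2 c))) ρ'
  have e4 : wedgePow θ p ((fun c => v (τ (Fin.castAdd 2 c))) ∘ ρ') =
      (Equiv.Perm.sign ρ' : ℤ) • wedgePow θ p (fun c => v (τ (Fin.castAdd 2 c))) := e3
  rw [tensorFun, e2, mul_one, e1, e4, hsign, smul_smul, ← Units.val_mul, Int.units_mul_self, hr']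
  simp

/-- By induction every term of the antisymmetrization is a nonnegative real. It vanishes unless the
last two indices form a pair; if that pair is reversed, swapping it changes the sign of the
permutation and of `θ` simultaneously. The identity permutation contributes a positive term. -/
theorem wedgePow_symplectic_pos (θ : E [⋀^Fin 2]→L[ℝ] ℂ) : ∀ (p : ℕ) (v : Fin (2 * p) → E),
    (∀ a b, θ ![v a, v b] = symplecticEntry a b) → ∃ r : ℝ, 0 < r ∧ wedgePow θ p v = r := by
  intro p
  induction p with
  | zero => intro v _; exact ⟨1, one_pos, by simp [wedgePow]⟩
  | succ p ih =>
    intro v hv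
    have key : ∀ σ : Equiv.Perm (Fin (2 * p + 2)), ∃ r : ℝ, 0 ≤ r ∧ (σ = 1 → 0 < r) ∧
        (Equiv.Perm.sign σ : ℤ) • tensorFun (wedgePow θ p) θ (v ∘ σ) = r := by
      intro σ
      set a := σ (Fin.natAdd (2 * p) 0) with ha
      set b := σ (Fin.natAdd (2 * p) 1) with hb
      by_cases h1 : (a : ℕ) / 2 = (b : ℕ) / 2
      · rcases lt_trichotomy (a : ℕ) (b : ℕ) with h2 | h2 | h2
        · obtain ⟨r, hr, h⟩ := sign_smul_tensorFun_pos ih v hv σ h1 h2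
          exact ⟨r, hr.le, fun _ => hr, h⟩
        · have := σ.injective (Fin.ext h2)
          simp [Fin.ext_iff] at this
        · set s : Equiv.Perm (Fin (2 * p + 2)) :=
            Equiv.swap (Fin.natAdd (2 * p) 0) (Fin.natAdd (2 * p) 1) with hs
          have hne : (Fin.natAdd (2 * p) (0 : Fin 2)) ≠ Fin.natAdd (2 * p) 1 := by
            simp [Fin.ext_iff]
          obtain ⟨r, hr, h⟩ := sign_smul_tensorFun_pos ih v hv (σ * s)
            (by simp [hs, Equiv.Perm.mul_apply, ← ha, ← hb, h1])
            (by simp only [hs, Equiv.Perm.mul_apply, Equiv.swap_apply_left,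
                  Equiv.swap_apply_right, ← ha, ← hb]; exact h2)
          refine ⟨r, hr.le, fun _ => hr, ?_⟩
          rw [← h, Equiv.Perm.sign_mul, hs, Equiv.Perm.sign_swap hne]
          have e1 : (fun i => (v ∘ (σ * s)) (Fin.castAdd 2 i)) =
              fun i => (v ∘ σ) (Fin.castAdd 2 i) := by
            funext i
            simp only [Function.comp, Equiv.Perm.mul_apply]
            rw [hs, Equiv.swap_apply_of_ne_of_ne]
            · simp [Fin.ext_iff]; omega
            · simp [Fin.ext_iff]; omega
          have e2 : θ (fun j => (v ∘ (σ * s)) (Fin.natAdd (2 * p) j)) =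
              - θ (fun j => (v ∘ σ) (Fin.natAdd (2 * p) j)) := by
            have := θ.toAlternatingMap.map_swap (fun j => (v ∘ σ) (Fin.natAdd (2 * p) j))
              (show (0 : Fin 2) ≠ 1 by simp)
            rw [← show _ = -θ (fun j => (v ∘ σ) (Fin.natAdd (2 * p) j)) from this]
            show θ _ = θ _
            congr 1
            funext j
            fin_cases j <;> simp [hs]
          simp only [tensorFun]
          rw [← hs, e1, e2]
          simp
      · refine ⟨0, le_rfl, ?_, ?_⟩
        · rintro rfl
          exfalso
          apply h1
          simp [ha, hb]
          omega
        · have : (fun j : Fin 2 => (v ∘ σ) (Fin.natAdd (2 * p) j)) = ![v a, v b] := by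
            funext j; fin_cases j <;> rfl
          rw [tensorFun, this, hv, symplecticEntry, if_neg h1]
          simp
    choose r hr0 hr1 hr using key
    have hpos : 0 < ∑ σ, r σ :=
      Finset.sum_pos' (fun σ _ => hr0 σ) ⟨1, Finset.mem_univ _, hr1 1 rfl⟩
    refine ⟨(((2 * p).factorial : ℝ) * (2).factorial)⁻¹ * ∑ σ, r σ, by positivity, ?_⟩
    have h := wedge_eq_antisum (wedgePow θ p) θ v
    rw [wedgePow_succ]
    refine h.trans ?_
    rw [antisum, Finset.sum_congr rfl fun σ _ => hr σ]
    push_cast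
    rfl

end SymplecticFrame

/-! ### Holomorphic functions of several variables are smooth -/

section Osgood

open Metric MeasureTheory

variable {E : Type*} [NormedAddCommGroup E] [NormedSpace ℂ E] [FiniteDimensional ℂ E]
  {F : Type*} [NormedAddCommGroup F] [NormedSpace ℂ F] [FiniteDimensional ℂ F]

/-- Cauchy's formula on the complex line through `x` in direction `v` writes the directional
derivative as a circle integral of `f`. This integral may be differentiated in `x` under the
integral sign, the Cauchy estimate for `fderiv ℂ f` providing the dominating bound. -/
theorem differentiableAt_fderiv_apply {U : Set E} (hU : IsOpen U) {f : E → F}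
    (hf : DifferentiableOn ℂ f U) (v : E) {x₀ : E} (hx₀ : x₀ ∈ U) :
    DifferentiableAt ℂ (fun x => fderiv ℂ f x v) x₀ := by
  have : ProperSpace E := FiniteDimensional.proper ℂ E
  have : ProperSpace F := FiniteDimensional.proper ℂ F
  have : CompleteSpace F := FiniteDimensional.complete ℂ F
  have : ProperSpace (E →L[ℂ] F) := FiniteDimensional.proper ℂ _
  borelize E
  borelize F
  borelize (E →L[ℂ] F)
  obtain ⟨ε, hε, hεU⟩ := Metric.isOpen_iff.1 hU x₀ hx₀
  -- The base point stays within ρ of `x₀`, the circles around it within 2ρ, and the balls used in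
  -- the Cauchy estimate at points of these circles within 3ρ < ε.
  set ρ := ε / 4 with hρ
  have hρ0 : 0 < ρ := by positivity
  have hball : closedBall x₀ (3 * ρ) ⊆ U :=
    (closedBall_subset_ball (by rw [hρ]; linarith)).trans hεU
  obtain ⟨M, hM⟩ := ((isCompact_closedBall x₀ (3 * ρ)).image_of_continuousOn
    (hf.continuousOn.mono hball)).isBounded.exists_norm_le
  have hMf : ∀ y ∈ closedBall x₀ (3 * ρ), ‖f y‖ ≤ M := fun y hy => hM _ ⟨y, hy, rfl⟩
  have hM0 : 0 ≤ M := (norm_nonneg _).trans (hMf x₀ (mem_closedBall_self (by positivity)))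
  have hderiv : ∀ y ∈ closedBall x₀ (2 * ρ), ‖fderiv ℂ f y‖ ≤ (2 * M + 1) / ρ := by
    intro y hy
    have hsub : ball y ρ ⊆ closedBall x₀ (3 * ρ) := by
      intro z hz
      rw [mem_closedBall] at hy ⊢
      rw [mem_ball] at hz
      linarith [dist_triangle z y x₀]
    refine Complex.norm_fderiv_le_div_of_mapsTo_ball (hf.mono (hsub.trans hball)) ?_ hρ0
    intro z hz
    rw [mem_closedBall, dist_eq_norm]
    have h1 := hMf z (hsub hz)
    have h2 := hMf y (hsub (mem_ball_self hρ0))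
    linarith [norm_sub_le (f z) (f y)]
  -- This choice gives r‖v‖ ≤ ρ, and the summand 1 covers `v = 0`.
  set r := ρ / (1 + ‖v‖) with hr
  have hr0 : 0 < r := by positivity
  have hrv : r * ‖v‖ ≤ ρ := by
    rw [hr, div_mul_eq_mul_div, div_le_iff₀ (by positivity)]
    nlinarith [norm_nonneg v]
  have hmem : ∀ x ∈ ball x₀ ρ, ∀ ζ : ℂ, ‖ζ‖ ≤ r → x + ζ • v ∈ closedBall x₀ (2 * ρ) := by
    intro x hx ζ hζ
    rw [mem_closedBall, dist_eq_norm]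
    rw [mem_ball, dist_eq_norm] at hx
    have h1 : x + ζ • v - x₀ = (x - x₀) + ζ • v := by abel
    rw [h1]
    have h2 : ‖ζ • v‖ ≤ ρ := by
      rw [norm_smul]
      exact (mul_le_mul_of_nonneg_right hζ (norm_nonneg _)).trans hrv
    linarith [norm_add_le (x - x₀) (ζ • v)]
  have h23 : closedBall x₀ (2 * ρ) ⊆ closedBall x₀ (3 * ρ) :=
    closedBall_subset_closedBall (by linarith)
  have hdiff : ∀ y ∈ closedBall x₀ (2 * ρ), DifferentiableAt ℂ f y := fun y hy =>
    hf.differentiableAt (hU.mem_nhds (hball (h23 hy)))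
  -- the circle integral representation of the derivative
  set c : ℝ → ℂ := fun t => deriv (circleMap 0 r) t * (1 / (circleMap 0 r t - 0) ^ 2) with hc
  have hcirc : ∀ t, ‖circleMap 0 r t‖ = r := fun t => by
    rw [norm_circleMap_zero, abs_of_pos hr0]
  have hne : ∀ t, circleMap 0 r t ≠ 0 := fun t h => by
    have := hcirc t; rw [h, norm_zero] at this; exact hr0.ne this
  have hccont : Continuous c := by
    have : c = fun t => (circleMap 0 r t * Complex.I) * (1 / (circleMap 0 r t - 0) ^ 2) := by
      funext t; rw [hc]; simp only [deriv_circleMap]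
    rw [this]
    refine ((continuous_circleMap 0 r).mul continuous_const).mul
      (continuous_const.div (by fun_prop) fun t => ?_)
    simpa using hne t
  set J : E → F := fun x => ∫ t in (0 : ℝ)..2 * Real.pi, c t • f (x + circleMap 0 r t • v) with hJ
  have hrep : ∀ x ∈ ball x₀ ρ, fderiv ℂ f x v = (2 * Real.pi * Complex.I : ℂ)⁻¹ • J x := by
    intro x hx
    have hline : DifferentiableOn ℂ (fun ζ : ℂ => f (x + ζ • v)) (closedBall 0 r) := by
      intro ζ hζ
      rw [mem_closedBall_zero_iff] at hζ
      refine DifferentiableAt.differentiableWithinAt ?_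
      exact (hdiff _ (hmem x hx ζ hζ)).comp ζ (by fun_prop)
    have h1 := hline.deriv_eq_smul_circleIntegral hr0
    have h2 : deriv (fun ζ : ℂ => f (x + ζ • v)) 0 = fderiv ℂ f x v := by
      have hx' : DifferentiableAt ℂ f (x + (0 : ℂ) • v) := hdiff _ (hmem x hx 0 (by simpa using hr0.le))
      have h3 : HasDerivAt (fun ζ : ℂ => x + ζ • v) v 0 := by
        simpa using ((hasDerivAt_id (0 : ℂ)).smul_const v).const_add x
      have h4 := hx'.hasFDerivAt.comp_hasDerivAt (0 : ℂ) h3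
      simp only [zero_smul, add_zero] at h4
      exact h4.deriv
    rw [h2] at h1
    rw [eq_inv_smul_iff₀ (by simp [Real.pi_ne_zero]), ← h1, hJ, circleIntegral]
    simp only [hc, mul_smul]
  have hmap : Continuous fun t : ℝ => (circleMap 0 r t • v : E) :=
    (continuous_circleMap 0 r).smul continuous_const
  have hfcont : ∀ x ∈ ball x₀ ρ, Continuous fun t : ℝ => f (x + circleMap 0 r t • v) := by
    intro x hx
    rw [continuous_iff_continuousAt]
    intro t
    exact ContinuousAt.comp (f := fun t : ℝ => x + circleMap 0 r t • v)
      (hdiff _ (hmem x hx _ (hcirc t).le)).continuousAt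
      (continuous_const.add hmap).continuousAt
  have hJdiff : HasFDerivAt J (∫ t in (0 : ℝ)..2 * Real.pi,
      c t • fderiv ℂ f (x₀ + circleMap 0 r t • v)) x₀ := by
    refine intervalIntegral.hasFDerivAt_integral_of_dominated_of_fderiv_le
      (F := fun x t => c t • f (x + circleMap 0 r t • v))
      (F' := fun x t => c t • fderiv ℂ f (x + circleMap 0 r t • v))
      (bound := fun t => ‖c t‖ * ((2 * M + 1) / ρ))
      (ball_mem_nhds x₀ hρ0) ?_ ?_ ?_ ?_ ?_ ?_
    · filter_upwards [ball_mem_nhds x₀ hρ0] with x hx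
      exact (hccont.smul (hfcont x hx)).aestronglyMeasurable
    · exact (hccont.smul (hfcont x₀ (mem_ball_self hρ0))).intervalIntegrable _ _
    -- Continuity of the derivative is not yet available at this stage; measurability of `fderiv` is
    -- enough.
    · refine AEStronglyMeasurable.smul hccont.aestronglyMeasurable ?_
      refine Measurable.aestronglyMeasurable ?_
      exact (measurable_fderiv ℂ f).comp (continuous_const.add hmap).measurable
    · refine Filter.Eventually.of_forall fun t _ x hx => ?_
      rw [norm_smul]
      exact mul_le_mul_of_nonneg_left (hderiv _ (hmem x hx _ (hcirc t).le)) (norm_nonneg _)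
    · exact (hccont.norm.mul continuous_const).intervalIntegrable _ _
    · refine Filter.Eventually.of_forall fun t _ x hx => ?_
      refine HasFDerivAt.const_smul ?_ (c t)
      have h1 := (hdiff _ (hmem x hx _ (hcirc t).le)).hasFDerivAt
      have h2 : HasFDerivAt (fun x : E => x + circleMap 0 r t • v) (ContinuousLinearMap.id ℂ E) x :=
        (hasFDerivAt_id x).add_const _
      exact h1.comp x h2
  refine DifferentiableAt.congr_of_eventuallyEq
    (f := fun x => (2 * Real.pi * Complex.I : ℂ)⁻¹ • J x) ?_ ?_
  · exact hJdiff.differentiableAt.const_smul _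
  · filter_upwards [ball_mem_nhds x₀ hρ0] with x hx using hrep x hx

/-- A function of several complex variables that is complex differentiable on an open set is
infinitely often differentiable there. -/
theorem contDiffOn_of_differentiableOn_complex {U : Set E} (hU : IsOpen U) {f : E → F}
    (hf : DifferentiableOn ℂ f U) : ContDiffOn ℂ ∞ f U := by
  have key : ∀ (m : ℕ) (f : E → F), DifferentiableOn ℂ f U → ContDiffOn ℂ m f U := by
    intro m
    induction m with
    | zero => exact fun f hf => contDiffOn_zero.2 hf.continuousOn
    | succ m ih =>
      intro f hf
      have := (contDiffOn_succ_iff_fderiv_of_isOpen (𝕜 := ℂ) (n := m) (f := f) hU).2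
        ⟨hf, by simp, contDiffOn_clm_apply.2 fun v => ih _ fun x hx =>
          (differentiableAt_fderiv_apply hU hf v hx).differentiableWithinAt⟩
      exact_mod_cast this
  exact contDiffOn_infty.2 fun m => key m f hf

theorem contDiffAt_real_of_eventually_differentiableAt {f : E → F} {x : E}
    (hf : ∀ᶠ y in 𝓝 x, DifferentiableAt ℂ f y) : ContDiffAt ℝ ∞ f x := by
  obtain ⟨U, hUf, hU, hx⟩ := _root_.eventually_nhds_iff.1 hf
  have h : DifferentiableOn ℂ f U := fun y hy => (hUf y hy).differentiableWithinAt
  exact ((contDiffOn_of_differentiableOn_complex hU h).contDiffAt (hU.mem_nhds hx)).restrict_scalars ℝ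

end Osgood

/-! ### Smoothness of form-valued functions -/

section FormValued

/-- The pullback operator is a continuous multilinear function of the `k` linear maps inserted,
hence smooth in them, and it acts linearly on the form. -/
theorem ContDiffAt.compContinuousLinearMap_form_apply {E F G H : Type*} [NormedAddCommGroup E] [NormedSpace ℝ E]
    [NormedAddCommGroup F] [NormedSpace ℝ F] [NormedAddCommGroup G] [NormedSpace ℝ G]
    [NormedAddCommGroup H] [NormedSpace ℝ H] {k : ℕ} {n : WithTop ℕ∞}
    {ψ : G → F [⋀^Fin k]→L[ℝ] H} {A : G → E →L[ℝ] F} {x : G}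
    (hψ : ContDiffAt ℝ n ψ x) (hA : ContDiffAt ℝ n A x) (v : Fin k → E) :
    ContDiffAt ℝ n (fun y => (ψ y).compContinuousLinearMap (A y) v) x := by
  let Φ := ContinuousMultilinearMap.compContinuousLinearMapContinuousMultilinear ℝ
    (fun _ : Fin k => E) (fun _ : Fin k => F) H
  have hΦ : ContDiff ℝ n Φ := ContinuousMultilinearMap.contDiff (𝕜 := ℝ) Φ
  have h1 : ContDiffAt ℝ n (fun y => Φ (fun _ => A y)) x :=
    ContDiff.comp_contDiffAt (f := fun y (_ : Fin k) => A y) x hΦ (contDiffAt_pi.2 fun _ => hA)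
  have hT : ContDiff ℝ n (ContinuousAlternatingMap.toContinuousMultilinearMapCLM (𝕜 := ℝ)
      (E := F) (F := H) (ι := Fin k) ℝ) := ContinuousLinearMap.contDiff _
  have h2 : ContDiffAt ℝ n (fun y => (ψ y).toContinuousMultilinearMap) x :=
    hT.comp_contDiffAt x hψ
  have h3 := h1.clm_apply h2
  exact (ContinuousMultilinearMap.apply ℝ (fun _ : Fin k => E) H v).contDiff.contDiffAt.comp x h3

variable {E : Type*} [NormedAddCommGroup E] [NormedSpace ℂ E] [FiniteDimensional ℂ E]
  {F : Type*} [NormedAddCommGroup F] [NormedSpace ℂ F]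
  {G : Type*} [NormedAddCommGroup G] [NormedSpace ℝ G] {k : ℕ}

/-- A form is determined by its values on tuples of basis vectors, and the injective evaluation map
has a linear left inverse. Smoothness of a form-valued function thereby reduces to smoothness of its
values on fixed vectors. -/
theorem exists_linear_reconstruction (E : Type*) [NormedAddCommGroup E] [NormedSpace ℂ E]
    [FiniteDimensional ℂ E] (k : ℕ) :
    ∃ (ι : Type) (_ : Fintype ι) (b : ι → Fin k → E)
      (r : (ι → ℂ) →L[ℝ] (E [⋀^Fin k]→L[ℝ] ℂ)), ∀ α, r (fun i => α (b i)) = α := by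
  have : FiniteDimensional ℝ E := FiniteDimensional.complexToReal E
  let b := Module.finBasis ℝ E
  let ev : (E [⋀^Fin k]→L[ℝ] ℂ) →ₗ[ℝ] ((Fin k → Fin (Module.finrank ℝ E)) → ℂ) :=
    { toFun := fun α i => α (fun j => b (i j))
      map_add' := fun _ _ => rfl
      map_smul' := fun _ _ => rfl }
  have hinj : Function.Injective ev := by
    intro α β h
    apply ContinuousAlternatingMap.toContinuousMultilinearMap_injective
    apply ContinuousMultilinearMap.toMultilinearMap_injective
    exact Module.Basis.ext_multilinear (fun _ => b) fun i => congrFun h i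
  obtain ⟨r, hr⟩ := LinearMap.exists_leftInverse_of_injective ev (LinearMap.ker_eq_bot.2 hinj)
  exact ⟨Fin k → Fin (Module.finrank ℝ E), inferInstance, fun i j => b (i j), LinearMap.toContinuousLinearMap r,
    fun α => DFunLike.congr_fun hr α⟩

theorem contDiffAt_form {f : G → E [⋀^Fin k]→L[ℝ] ℂ} {x : G} {n : WithTop ℕ∞}
    (h : ∀ v, ContDiffAt ℝ n (fun y => f y v) x) : ContDiffAt ℝ n f x := by
  obtain ⟨ι, _, b, r, hr⟩ := exists_linear_reconstruction E k
  have : f = fun y => r (fun i => f y (b i)) := funext fun y => (hr _).symm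
  rw [this]
  exact r.contDiff.contDiffAt.comp x (contDiffAt_pi.2 fun i => h (b i))

theorem ContDiffAt.compContinuousLinearMap_form {ψ : G → F [⋀^Fin k]→L[ℝ] ℂ} {A : G → E →L[ℝ] F}
    {x : G} {n : WithTop ℕ∞} (hψ : ContDiffAt ℝ n ψ x) (hA : ContDiffAt ℝ n A x) :
    ContDiffAt ℝ n (fun y => (ψ y).compContinuousLinearMap (A y)) x :=
  contDiffAt_form fun v => ContDiffAt.compContinuousLinearMap_form_apply hψ hA v

end FormValued

/-! ### Pullbacks of forms under holomorphic maps -/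

section PullbackForms

variable {E : Type*} [NormedAddCommGroup E] [NormedSpace ℂ E]
  {F : Type*} [NormedAddCommGroup F] [NormedSpace ℂ F]
  {G : Type*} [NormedAddCommGroup G] [NormedSpace ℂ G]
  {M : Type*} [TopologicalSpace M] [ChartedSpace E M]
  {N : Type*} [TopologicalSpace N] [ChartedSpace F N]
  {P : Type*} [TopologicalSpace P] [ChartedSpace G P] {k : ℕ}

variable (E F) in
/-- The map `f` is complex differentiable at all points near `x`. -/
def IsHolomorphicAt (f : M → N) (x : M) : Prop :=
  ∀ᶠ y in 𝓝 x, MDifferentiableAt 𝓘(ℂ, E) 𝓘(ℂ, F) f y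

theorem IsHolomorphicAt.mdifferentiableAt {f : M → N} {x : M} (h : IsHolomorphicAt E F f x) :
    MDifferentiableAt 𝓘(ℂ, E) 𝓘(ℂ, F) f x := h.self_of_nhds

theorem _root_.MDifferentiable.isHolomorphicAt {f : M → N}
    (h : MDifferentiable 𝓘(ℂ, E) 𝓘(ℂ, F) f) (x : M) : IsHolomorphicAt E F f x :=
  Filter.Eventually.of_forall h

theorem _root_.MDifferentiableOn.isHolomorphicAt {f : M → N} {s : Set M}
    (h : MDifferentiableOn 𝓘(ℂ, E) 𝓘(ℂ, F) f s) (hs : IsOpen s) {x : M} (hx : x ∈ s) :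
    IsHolomorphicAt E F f x := by
  filter_upwards [hs.mem_nhds hx] with y hy
  exact h.mdifferentiableAt (hs.mem_nhds hy)

theorem IsHolomorphicAt.comp {g : N → P} {f : M → N} {x : M}
    (hg : IsHolomorphicAt F G g (f x)) (hf : IsHolomorphicAt E F f x) :
    IsHolomorphicAt E G (g ∘ f) x := by
  filter_upwards [hf, hf.mdifferentiableAt.continuousAt.eventually hg] with y h1 h2
  exact h2.comp y h1

theorem complexDeriv_comp {g : N → P} {f : M → N} {x : M}
    (hg : MDifferentiableAt 𝓘(ℂ, F) 𝓘(ℂ, G) g (f x))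
    (hf : MDifferentiableAt 𝓘(ℂ, E) 𝓘(ℂ, F) f x) :
    (complexDeriv (g ∘ f) x : E →L[ℂ] G) =
      (complexDeriv g (f x) : F →L[ℂ] G).comp (complexDeriv f x : E →L[ℂ] F) :=
  mfderiv_comp x hg hf

theorem complexDeriv_congr {f g : M → N} {x : M} (h : f =ᶠ[𝓝 x] g) :
    (complexDeriv f x : E →L[ℂ] F) = complexDeriv g x :=
  h.mfderiv_eq

theorem complexDeriv_eq_fderiv (f : E → F) (x : E) :
    (complexDeriv f x : E →L[ℂ] F) = fderiv ℂ f x :=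
  mfderiv_eq_fderiv

theorem pullback_comp {g : N → P} {f : M → N} {x : M} (φ : P → G [⋀^Fin k]→L[ℝ] ℂ)
    (hg : MDifferentiableAt 𝓘(ℂ, F) 𝓘(ℂ, G) g (f x))
    (hf : MDifferentiableAt 𝓘(ℂ, E) 𝓘(ℂ, F) f x) :
    (pullback (g ∘ f) φ x : E [⋀^Fin k]→L[ℝ] ℂ) =
      pullback f (pullback g φ : N → F [⋀^Fin k]→L[ℝ] ℂ) x := by
  ext v
  simp only [pullback, realDeriv]
  rw [complexDeriv_comp hg hf]
  rfl

theorem pullback_congr {f g : M → N} {x : M} (φ : N → F [⋀^Fin k]→L[ℝ] ℂ) (h : f =ᶠ[𝓝 x] g) :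
    (pullback f φ x : E [⋀^Fin k]→L[ℝ] ℂ) = pullback g φ x := by
  simp only [pullback, realDeriv]
  rw [complexDeriv_congr h, h.self_of_nhds]

theorem pullback_wedge {l : ℕ} (f : M → N) (φ : N → F [⋀^Fin k]→L[ℝ] ℂ)
    (ψ : N → F [⋀^Fin l]→L[ℝ] ℂ) (x : M) :
    (pullback f (fun y => wedge (φ y) (ψ y)) x : E [⋀^Fin (k + l)]→L[ℝ] ℂ) =
      wedge (pullback f φ x) (pullback f ψ x) :=
  wedge_compContinuousLinearMap _ _ _

theorem pullback_powForm (f : M → N) (θ : N → F [⋀^Fin 2]→L[ℝ] ℂ) (p : ℕ) (x : M) :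
    (pullback f (powForm θ p) x : E [⋀^Fin (2 * p)]→L[ℝ] ℂ) = powForm (pullback f θ) p x :=
  wedgePow_compContinuousLinearMap _ _ _

theorem vecNorm_pullback (f : M → N) (θ : N → F [⋀^Fin 2]→L[ℝ] ℂ) (x : M) (v : E) :
    vecNorm (pullback f θ x) v = vecNorm (θ (f x)) (complexDeriv f x v : F) := by
  have : (fun i => realDeriv (E := E) (F := F) f x (![v, Complex.I • v] i)) =
      ![complexDeriv f x v, Complex.I • complexDeriv f x v] := by
    funext i
    fin_cases i <;> simp [realDeriv]
  simp only [vecNorm, pullback, ContinuousAlternatingMap.compContinuousLinearMap_apply]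
  rw [← this]
  rfl

theorem inChart_self (φ : E → E [⋀^Fin k]→L[ℝ] ℂ) (c : E) : inChart c φ = φ := by
  funext x
  ext v
  have h : (complexDeriv (chartAt E c).symm x : E →L[ℂ] E) = ContinuousLinearMap.id ℂ E := by
    simp only [chartAt_self_eq]
    exact mfderiv_id
  simp only [inChart, pullback, realDeriv, h]
  rfl

variable [IsManifold 𝓘(ℂ, E) ω M] [IsManifold 𝓘(ℂ, F) ω N]

theorem isHolomorphicAt_chart_symm (c : M) {e : E} (he : e ∈ (chartAt E c).target) :
    IsHolomorphicAt E E (chartAt E c).symm e := by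
  filter_upwards [(chartAt E c).open_target.mem_nhds he] with y hy
  exact mdifferentiableAt_atlas_symm (chart_mem_atlas E c) hy

theorem isHolomorphicAt_chart (c : M) {x : M} (hx : x ∈ (chartAt E c).source) :
    IsHolomorphicAt E E (chartAt E c) x := by
  filter_upwards [(chartAt E c).open_source.mem_nhds hx] with y hy
  exact mdifferentiableAt_atlas (chart_mem_atlas E c) hy

/-- A holomorphic map in coordinates. -/
theorem eventually_differentiableAt_coordinates {g : M → N} {c : M} {e : E}
    (he : e ∈ (chartAt E c).target) (hg : IsHolomorphicAt E F g ((chartAt E c).symm e)) {q : N}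
    (hq : g ((chartAt E c).symm e) ∈ (chartAt F q).source) :
    ∀ᶠ y in 𝓝 e, DifferentiableAt ℂ (chartAt F q ∘ g ∘ (chartAt E c).symm) y := by
  have h := (isHolomorphicAt_chart (E := F) q hq).comp (E := E) (f := g ∘ (chartAt E c).symm) (x := e)
    (hg.comp (isHolomorphicAt_chart_symm c he))
  exact h.mono fun y hy => mdifferentiableAt_iff_differentiableAt.1 hy

/-- The pullback of a form under a holomorphic map in coordinates. -/
theorem inChart_pullback_eventuallyEq {g : M → N} (φ : N → F [⋀^Fin k]→L[ℝ] ℂ) {c : M} {e : E}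
    (he : e ∈ (chartAt E c).target) (hg : IsHolomorphicAt E F g ((chartAt E c).symm e)) {q : N}
    (hq : g ((chartAt E c).symm e) ∈ (chartAt F q).source) :
    inChart c (pullback g φ) =ᶠ[𝓝 e] fun y =>
      (inChart q φ ((chartAt F q ∘ g ∘ (chartAt E c).symm) y)).compContinuousLinearMap
        (fderiv ℝ (chartAt F q ∘ g ∘ (chartAt E c).symm) y) := by
  have hgs := hg.comp (isHolomorphicAt_chart_symm c he)
  have hcont : ContinuousAt (g ∘ (chartAt E c).symm) e := hgs.mdifferentiableAt.continuousAt
  have hsrc := (hcont.eventually ((chartAt F q).open_source.mem_nhds hq)).eventually_nhds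
  have hs := isHolomorphicAt_chart_symm c he
  have hgc := ((chartAt E c).continuousAt_symm he).eventually hg
  filter_upwards [eventually_differentiableAt_coordinates he hg hq, hsrc, hs, hgc, hgs]
    with y hy hys hy2 hy3 hy4
  have h1 : inChart c (pullback g φ : M → E [⋀^Fin k]→L[ℝ] ℂ) y =
      pullback (g ∘ (chartAt E c).symm) φ y := (pullback_comp φ hy3 hy2).symm
  have hys' : (g ∘ (chartAt E c).symm) y ∈ (chartAt F q).source := hys.self_of_nhds
  have hG : MDifferentiableAt 𝓘(ℂ, E) 𝓘(ℂ, F) (chartAt F q ∘ g ∘ (chartAt E c).symm) y :=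
    mdifferentiableAt_iff_differentiableAt.2 hy
  have h2 : (pullback ((chartAt F q).symm ∘ (chartAt F q ∘ g ∘ (chartAt E c).symm)) φ y :
      E [⋀^Fin k]→L[ℝ] ℂ) =
      pullback (chartAt F q ∘ g ∘ (chartAt E c).symm) (inChart q φ) y := by
    refine pullback_comp φ ?_ hG
    exact (isHolomorphicAt_chart_symm q ((chartAt F q).map_source hys')).mdifferentiableAt
  have h3 : (chartAt F q).symm ∘ (chartAt F q ∘ g ∘ (chartAt E c).symm) =ᶠ[𝓝 y]
      g ∘ (chartAt E c).symm := by
    filter_upwards [hys] with z hz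
    exact (chartAt F q).left_inv hz
  rw [h1, ← pullback_congr φ h3, h2]
  simp only [pullback, realDeriv]
  rw [complexDeriv_eq_fderiv, hy.fderiv_restrictScalars ℝ]

variable [FiniteDimensional ℂ E] [FiniteDimensional ℂ F]

theorem contDiffAt_inChart_pullback {g : M → N} {φ : N → F [⋀^Fin k]→L[ℝ] ℂ}
    (hφ : IsSmoothForm φ) {c : M} {e : E} (he : e ∈ (chartAt E c).target)
    (hg : IsHolomorphicAt E F g ((chartAt E c).symm e)) :
    ContDiffAt ℝ ∞ (inChart c (pullback g φ)) e := by
  have hq := mem_chart_source F (g ((chartAt E c).symm e))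
  refine ContDiffAt.congr_of_eventuallyEq ?_ (inChart_pullback_eventuallyEq φ he hg hq)
  have hG := contDiffAt_real_of_eventually_differentiableAt
    (eventually_differentiableAt_coordinates he hg hq)
  refine ContDiffAt.compContinuousLinearMap_form ?_ (hG.fderiv_right (m := ∞) (by simp))
  refine ContDiffAt.comp e ?_ hG
  exact (hφ _).contDiffAt ((chartAt F _).open_target.mem_nhds ((chartAt F _).map_source hq))

theorem IsSmoothForm.pullback {g : M → N} {φ : N → F [⋀^Fin k]→L[ℝ] ℂ}
    (hφ : IsSmoothForm φ) (hg : MDifferentiable 𝓘(ℂ, E) 𝓘(ℂ, F) g) :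
    IsSmoothForm (pullback g φ : M → E [⋀^Fin k]→L[ℝ] ℂ) := fun _ _ he =>
  (contDiffAt_inChart_pullback hφ he (hg.isHolomorphicAt _)).contDiffWithinAt

end PullbackForms

/-! ### Naturality of `d`, `∂` and `∂̄` -/

section NaturalityLinear

open ContinuousAlternatingMap

variable {E : Type*} [NormedAddCommGroup E] [NormedSpace ℂ E]
  {F : Type*} [NormedAddCommGroup F] [NormedSpace ℂ F] {k : ℕ}

variable (E) in
/-- Multiplication by `i` as a real-linear map. -/
def mulI : E →L[ℝ] E := (Complex.I • ContinuousLinearMap.id ℂ E : E →L[ℂ] E).restrictScalars ℝ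

@[simp] theorem mulI_apply (v : E) : mulI E v = Complex.I • v := rfl

theorem alternatizeUncurryFin_linPart (L : E →L[ℝ] (E [⋀^Fin k]→L[ℝ] ℂ)) :
    alternatizeUncurryFin (linPart L) =
      (1 / 2 : ℂ) • (alternatizeUncurryFin L - Complex.I • alternatizeUncurryFin (L ∘L mulI E)) := by
  rw [linPart, alternatizeUncurryFin_smul]
  have : alternatizeUncurryFin (L - Complex.I • L ∘L mulI E) = alternatizeUncurryFin L -
      Complex.I • alternatizeUncurryFin (L ∘L mulI E) := by
    rw [← alternatizeUncurryFin_smul]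
    exact map_sub (alternatizeUncurryFinCLM ℝ E ℂ) _ _
  exact congrArg _ this

theorem alternatizeUncurryFin_antilinPart (L : E →L[ℝ] (E [⋀^Fin k]→L[ℝ] ℂ)) :
    alternatizeUncurryFin (antilinPart L) =
      (1 / 2 : ℂ) • (alternatizeUncurryFin L + Complex.I • alternatizeUncurryFin (L ∘L mulI E)) := by
  rw [antilinPart, alternatizeUncurryFin_smul]
  have : alternatizeUncurryFin (L + Complex.I • L ∘L mulI E) = alternatizeUncurryFin L +
      Complex.I • alternatizeUncurryFin (L ∘L mulI E) := by
    rw [← alternatizeUncurryFin_smul, alternatizeUncurryFin_add]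
  exact congrArg _ this

theorem alternatizeUncurryFin_comp (L : F →L[ℝ] (F [⋀^Fin k]→L[ℝ] ℂ)) (A : E →L[ℝ] F) :
    alternatizeUncurryFin (compContinuousLinearMapCLM A ∘L (L ∘L A)) =
      (alternatizeUncurryFin L).compContinuousLinearMap A := by
  ext v
  simp +unfoldPartialApp [alternatizeUncurryFin_apply, Fin.removeNth, Function.comp_def]

variable [FiniteDimensional ℂ E] [FiniteDimensional ℂ F]

/-- Differentiating the pullback produces a term with the second derivative of `g`, which
alternation kills by symmetry. The operators ∂ and ∂̄ also need the derivative precomposed with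
multiplication by i. Since `g` is holomorphic, D²g is complex-bilinear, so D²g(iv, w) is still
symmetric in v and w and the same cancellation occurs. -/
theorem alternatizeUncurryFin_fderiv_pullback {ψ : F → F [⋀^Fin k]→L[ℝ] ℂ} {g : E → F} {e : E}
    (hψ : DifferentiableAt ℝ ψ (g e)) (hg : ∀ᶠ y in 𝓝 e, DifferentiableAt ℂ g y) :
    alternatizeUncurryFin
        (fderiv ℝ (fun y => (ψ (g y)).compContinuousLinearMap (fderiv ℝ g y)) e) =
      (alternatizeUncurryFin (fderiv ℝ ψ (g e))).compContinuousLinearMap (fderiv ℝ g e) ∧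
    alternatizeUncurryFin
        (fderiv ℝ (fun y => (ψ (g y)).compContinuousLinearMap (fderiv ℝ g y)) e ∘L mulI E) =
      (alternatizeUncurryFin (fderiv ℝ ψ (g e) ∘L mulI F)).compContinuousLinearMap
        (fderiv ℝ g e) := by
  have hgs := contDiffAt_real_of_eventually_differentiableAt hg
  have hgd : DifferentiableAt ℝ g e := hgs.differentiableAt (by simp)
  have hg2 : DifferentiableAt ℝ (fderiv ℝ g) e :=
    (hgs.fderiv_right (m := 1) (by exact (mod_cast le_top : ((2 : ℕ∞) : WithTop ℕ∞) ≤ ∞))).differentiableAt (by simp)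
  have hsymm : IsSymmSndFDerivAt ℝ g e :=
    hgs.isSymmSndFDerivAt (by simp only [minSmoothness_of_isRCLikeNormedField]; exact (mod_cast le_top : ((2 : ℕ∞) : WithTop ℕ∞) ≤ ∞))
  have hI : ∀ᶠ y in 𝓝 e, ∀ w, fderiv ℝ g y (Complex.I • w) = Complex.I • fderiv ℝ g y w := by
    filter_upwards [hg] with y hy w
    rw [hy.fderiv_restrictScalars ℝ]
    simp
  have hI2 : ∀ v w, fderiv ℝ (fderiv ℝ g) e v (Complex.I • w) =
      Complex.I • fderiv ℝ (fderiv ℝ g) e v w := by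
    intro v w
    have h1 : HasFDerivAt (fun y => fderiv ℝ g y (Complex.I • w))
        ((fderiv ℝ (fderiv ℝ g) e).flip (Complex.I • w)) e := by
      simpa using! hg2.hasFDerivAt.clm_apply (hasFDerivAt_const (Complex.I • w) e)
    have h2 : HasFDerivAt (fun y => fderiv ℝ g y w)
        ((fderiv ℝ (fderiv ℝ g) e).flip w) e := by
      simpa using! hg2.hasFDerivAt.clm_apply (hasFDerivAt_const w e)
    have h3 := h2.const_smul Complex.I
    have h4 := h1.congr_of_eventuallyEq (f₁ := fun y => Complex.I • fderiv ℝ g y w)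
      (hI.mono fun y hy => (hy w).symm)
    exact DFunLike.congr_fun (h4.unique h3) v
  have hcomm : fderiv ℝ g e ∘L mulI E = mulI F ∘L fderiv ℝ g e := by
    ext w
    exact hI.self_of_nhds w
  have key := fderiv_continuousAlternatingMapCompContinuousLinearMap
    (f := fun y => ψ (g y)) (g := fderiv ℝ g) (x := e) (hψ.comp e hgd) hg2
  have hchain : fderiv ℝ (fun y => ψ (g y)) e = fderiv ℝ ψ (g e) ∘L fderiv ℝ g e :=
    fderiv_comp e hψ hgd
  rw [hchain] at key
  rw [key]
  constructor
  · rw [alternatizeUncurryFin_add, alternatizeUncurryFin_comp,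
      alternatizeUncurryFin_fderivCompContinuousLinearMap_eq_zero _ _ hsymm, add_zero]
  · rw [ContinuousLinearMap.add_comp, alternatizeUncurryFin_add]
    have h1 : ((compContinuousLinearMapCLM (fderiv ℝ g e) ∘L
        (fderiv ℝ ψ (g e) ∘L fderiv ℝ g e)) ∘L mulI E :
        E →L[ℝ] (E [⋀^Fin k]→L[ℝ] ℂ)) = compContinuousLinearMapCLM (fderiv ℝ g e) ∘L
        ((fderiv ℝ ψ (g e) ∘L mulI F) ∘L fderiv ℝ g e) := by
      rw [ContinuousLinearMap.comp_assoc, ContinuousLinearMap.comp_assoc, hcomm,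
        ContinuousLinearMap.comp_assoc]
    rw [h1, alternatizeUncurryFin_comp, ContinuousLinearMap.comp_assoc,
      alternatizeUncurryFin_fderivCompContinuousLinearMap_eq_zero, add_zero]
    intro v w
    simp only [ContinuousLinearMap.comp_apply, mulI_apply]
    rw [hsymm (Complex.I • v) w, hsymm (Complex.I • w) v, hI2, hI2, hsymm v w]

end NaturalityLinear

/-! ### Naturality, d² = 0 and the Leibniz rule on manifolds -/

section Naturality

variable {E : Type*} [NormedAddCommGroup E] [NormedSpace ℂ E] [FiniteDimensional ℂ E]
  {F : Type*} [NormedAddCommGroup F] [NormedSpace ℂ F] [FiniteDimensional ℂ F]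
  {M : Type*} [TopologicalSpace M] [ChartedSpace E M] [IsManifold 𝓘(ℂ, E) ω M]
  {N : Type*} [TopologicalSpace N] [ChartedSpace F N] [IsManifold 𝓘(ℂ, F) ω N] {k : ℕ}

theorem IsSmoothForm.differentiableAt {φ : M → E [⋀^Fin k]→L[ℝ] ℂ} (hφ : IsSmoothForm φ) {c : M}
    {e : E} (he : e ∈ (chartAt E c).target) : DifferentiableAt ℝ (inChart c φ) e :=
  ((hφ c).contDiffAt ((chartAt E c).open_target.mem_nhds he)).differentiableAt (by simp)

theorem realDeriv_eq_fderiv_coordinates {g : M → N} {x : M} (hg : IsHolomorphicAt E F g x) :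
    (realDeriv g x : E →L[ℝ] F) =
      fderiv ℝ (chartAt F (g x) ∘ g ∘ (chartAt E x).symm) (chartAt E x x) := by
  have hx := mem_chart_source E x
  have hs := (chartAt E x).left_inv hx
  have h1 := (eventually_differentiableAt_coordinates (g := g) (c := x) (e := chartAt E x x)
    (q := g x) ((chartAt E x).map_source hx) (by rwa [hs])
    (by rw [hs]; exact mem_chart_source F (g x))).self_of_nhds
  rw [h1.fderiv_restrictScalars ℝ, realDeriv]
  congr 1
  simp only [complexDeriv, hg.mdifferentiableAt.mfderiv]
  simp [writtenInExtChartAt, extChartAt, fderivWithin_univ]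

theorem fderiv_inChart_pullback {g : M → N} {φ : N → F [⋀^Fin k]→L[ℝ] ℂ} (hφ : IsSmoothForm φ)
    {x : M} (hg : IsHolomorphicAt E F g x) :
    ContinuousAlternatingMap.alternatizeUncurryFin
        (fderiv ℝ (inChart x (pullback g φ)) (chartAt E x x)) =
      (ContinuousAlternatingMap.alternatizeUncurryFin
        (fderiv ℝ (inChart (g x) φ) (chartAt F (g x) (g x)))).compContinuousLinearMap
          (realDeriv g x) ∧
    ContinuousAlternatingMap.alternatizeUncurryFin
        (fderiv ℝ (inChart x (pullback g φ)) (chartAt E x x) ∘L mulI E) =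
      (ContinuousAlternatingMap.alternatizeUncurryFin
        (fderiv ℝ (inChart (g x) φ) (chartAt F (g x) (g x)) ∘L mulI F)).compContinuousLinearMap
          (realDeriv g x) := by
  have hx := mem_chart_source E x
  have hs := (chartAt E x).left_inv hx
  have hgx := mem_chart_source F (g x)
  have he := (chartAt E x).map_source hx
  have hg' : IsHolomorphicAt E F g ((chartAt E x).symm (chartAt E x x)) := by rwa [hs]
  have hq : g ((chartAt E x).symm (chartAt E x x)) ∈ (chartAt F (g x)).source := by rwa [hs]
  have h1 := eventually_differentiableAt_coordinates he hg' hq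
  have h2 := inChart_pullback_eventuallyEq φ he hg' hq
  have hGe : (chartAt F (g x) ∘ g ∘ (chartAt E x).symm) (chartAt E x x) = chartAt F (g x) (g x) := by
    simp [hs]
  have h3 := alternatizeUncurryFin_fderiv_pullback (ψ := inChart (g x) φ) (e := chartAt E x x)
    (g := chartAt F (g x) ∘ g ∘ (chartAt E x).symm)
    (hφ.differentiableAt (by rw [hGe]; exact (chartAt F (g x)).map_source hgx)) h1
  rw [h2.fderiv_eq, realDeriv_eq_fderiv_coordinates hg, ← hGe]
  exact h3

theorem dForm_pullback {g : M → N} {φ : N → F [⋀^Fin k]→L[ℝ] ℂ} (hφ : IsSmoothForm φ)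
    {x : M} (hg : IsHolomorphicAt E F g x) :
    (dForm (pullback g φ) x : E [⋀^Fin (k + 1)]→L[ℝ] ℂ) = pullback g (dForm φ) x :=
  (fderiv_inChart_pullback hφ hg).1

theorem delForm_pullback {g : M → N} {φ : N → F [⋀^Fin k]→L[ℝ] ℂ} (hφ : IsSmoothForm φ)
    {x : M} (hg : IsHolomorphicAt E F g x) :
    (delForm (pullback g φ) x : E [⋀^Fin (k + 1)]→L[ℝ] ℂ) = pullback g (delForm φ) x := by
  obtain ⟨h1, h2⟩ := fderiv_inChart_pullback hφ hg
  simp only [delForm, pullback, alternatizeUncurryFin_linPart] at h1 h2 ⊢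
  change _ = _ at h1
  erw [h1, h2]
  rfl

theorem delbarForm_pullback {g : M → N} {φ : N → F [⋀^Fin k]→L[ℝ] ℂ} (hφ : IsSmoothForm φ)
    {x : M} (hg : IsHolomorphicAt E F g x) :
    (delbarForm (pullback g φ) x : E [⋀^Fin (k + 1)]→L[ℝ] ℂ) = pullback g (delbarForm φ) x := by
  obtain ⟨h1, h2⟩ := fderiv_inChart_pullback hφ hg
  simp only [delbarForm, pullback, alternatizeUncurryFin_antilinPart] at h1 h2 ⊢
  erw [h1, h2]
  rfl

theorem dForm_vectorSpace (φ : E → E [⋀^Fin k]→L[ℝ] ℂ) (x : E) : dForm φ x = extDeriv φ x := by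
  simp only [dForm, inChart_self]
  rfl

theorem delForm_vectorSpace (φ : E → E [⋀^Fin k]→L[ℝ] ℂ) (x : E) :
    delForm φ x = .alternatizeUncurryFin (linPart (fderiv ℝ φ x)) := by
  simp only [delForm, inChart_self]
  rfl

theorem delbarForm_vectorSpace (φ : E → E [⋀^Fin k]→L[ℝ] ℂ) (x : E) :
    delbarForm φ x = .alternatizeUncurryFin (antilinPart (fderiv ℝ φ x)) := by
  simp only [delbarForm, inChart_self]
  rfl

theorem inChart_dForm {φ : M → E [⋀^Fin k]→L[ℝ] ℂ} (hφ : IsSmoothForm φ) {c : M} {e : E}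
    (he : e ∈ (chartAt E c).target) : inChart c (dForm φ) e = extDeriv (inChart c φ) e := by
  rw [← dForm_vectorSpace]
  exact (dForm_pullback hφ (isHolomorphicAt_chart_symm c he)).symm

theorem dForm_dForm {φ : M → E [⋀^Fin k]→L[ℝ] ℂ} (hφ : IsSmoothForm φ) (x : M) :
    dForm (dForm φ) x = 0 := by
  have he := (chartAt E x).map_source (mem_chart_source E x)
  have hnhds := (chartAt E x).open_target.mem_nhds he
  have h : inChart x (dForm φ) =ᶠ[𝓝 (chartAt E x x)] extDeriv (inChart x φ) := by
    filter_upwards [hnhds] with e he using inChart_dForm hφ he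
  rw [dForm, h.extDeriv_eq]
  exact extDeriv_extDeriv_apply ((hφ x).contDiffAt hnhds)
    (by simp only [minSmoothness_of_isRCLikeNormedField]; exact (mod_cast le_top : ((2 : ℕ∞) : WithTop ℕ∞) ≤ ∞))

theorem IsSmoothForm.wedge {l : ℕ} {φ : M → E [⋀^Fin k]→L[ℝ] ℂ} {ψ : M → E [⋀^Fin l]→L[ℝ] ℂ}
    (hφ : IsSmoothForm φ) (hψ : IsSmoothForm ψ) :
    IsSmoothForm (fun x => wedge (φ x) (ψ x)) := by
  intro c
  have : inChart c (fun x => HermitianHyperbolicity.wedge (φ x) (ψ x)) =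
      fun e => wedgeCLM E k l (inChart c φ e) (inChart c ψ e) := by
    funext e
    exact pullback_wedge _ _ _ _
  rw [this]
  exact ((wedgeCLM E k l).contDiff.comp_contDiffOn (hφ c)).clm_apply (hψ c)

theorem IsSmoothForm.powForm {θ : M → E [⋀^Fin 2]→L[ℝ] ℂ} (hθ : IsSmoothForm θ) (p : ℕ) :
    IsSmoothForm (powForm θ p) := by
  induction p with
  | zero =>
    intro c
    have : inChart c (HermitianHyperbolicity.powForm θ 0) = fun _ =>
        (ContinuousAlternatingMap.constOfIsEmpty ℝ E (Fin 0) 1 : E [⋀^Fin 0]→L[ℝ] ℂ) := by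
      funext e
      ext v
      rfl
    rw [this]
    exact contDiffOn_const
  | succ p ih => exact ih.wedge hθ

theorem hasFDerivAt_wedge {l : ℕ} {f : E → E [⋀^Fin k]→L[ℝ] ℂ} {g : E → E [⋀^Fin l]→L[ℝ] ℂ}
    {f' : E →L[ℝ] E [⋀^Fin k]→L[ℝ] ℂ} {g' : E →L[ℝ] E [⋀^Fin l]→L[ℝ] ℂ} {x : E}
    (hf : HasFDerivAt f f' x) (hg : HasFDerivAt g g' x) :
    HasFDerivAt (fun e => wedgeCLM E k l (f e) (g e))
      (wedgeCLM E k l (f x) ∘L g' + (wedgeCLM E k l).flip (g x) ∘L f') x := by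
  refine ((wedgeCLM E k l).hasFDerivAt_of_bilinear hf hg).congr_fderiv ?_
  refine ContinuousLinearMap.ext fun v => ?_
  rfl

/-- The Leibniz rule for the product with a closed `2`-form. -/
theorem dForm_wedge_of_closed {φ : M → E [⋀^Fin k]→L[ℝ] ℂ} {θ : M → E [⋀^Fin 2]→L[ℝ] ℂ}
    (hφ : IsSmoothForm φ) (hθ : IsSmoothForm θ) {x : M} (hd : dForm θ x = 0) :
    (dForm (fun y => wedge (φ y) (θ y)) x : E [⋀^Fin (k + 1 + 2)]→L[ℝ] ℂ) =
      wedge (dForm φ x) (θ x) := by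
  have hx := mem_chart_source E x
  have he := (chartAt E x).map_source hx
  have h1 := (hφ.differentiableAt he).hasFDerivAt
  have h2 := (hθ.differentiableAt he).hasFDerivAt
  have h0 : inChart x (fun y => wedge (φ y) (θ y)) =
      fun e => wedgeCLM E k 2 (inChart x φ e) (inChart x θ e) := by
    funext e
    exact pullback_wedge _ _ _ _
  -- The tangent space at `x` is identified with `E` through the preferred chart at `x`, so that
  -- chart has derivative the identity there.
  have hid : ∀ {j : ℕ} (α : M → E [⋀^Fin j]→L[ℝ] ℂ), inChart x α (chartAt E x x) = α x := by
    intro j α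
    have h4 : (chartAt E x).symm (chartAt E x x) = x := (chartAt E x).left_inv hx
    have h3 : (realDeriv (chartAt E x).symm (chartAt E x x) : E →L[ℝ] E) =
        ContinuousLinearMap.id ℝ E := by
      rw [realDeriv_eq_fderiv_coordinates (isHolomorphicAt_chart_symm x he)]
      have : (chartAt E ((chartAt E x).symm (chartAt E x x)) ∘ (chartAt E x).symm ∘
          (chartAt E (chartAt E x x)).symm) =ᶠ[𝓝 (chartAt E (chartAt E x x) (chartAt E x x))] id := by
        rw [h4]
        filter_upwards [(chartAt E x).open_target.mem_nhds he] with y hy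
        exact (chartAt E x).right_inv hy
      rw [this.fderiv_eq]
      exact fderiv_id
    ext v
    simp only [inChart, pullback, h3, h4]
    rfl
  have h3 := hasFDerivAt_wedge h1 h2
  rw [dForm, extDeriv, h0, h3.fderiv, ContinuousAlternatingMap.alternatizeUncurryFin_add,
    alternatizeUncurryFin_wedge_right_eq_zero _ _ hd, zero_add, hid]
  exact alternatizeUncurryFin_wedge_left _ _

theorem dForm_powForm_of_closed {θ : M → E [⋀^Fin 2]→L[ℝ] ℂ} (hθ : IsSmoothForm θ)
    (hd : ∀ x, dForm θ x = 0) (p : ℕ) (x : M) : dForm (powForm θ p) x = 0 := by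
  induction p with
  | zero =>
    have : inChart x (HermitianHyperbolicity.powForm θ 0) = fun _ =>
        (ContinuousAlternatingMap.constOfIsEmpty ℝ E (Fin 0) 1 : E [⋀^Fin 0]→L[ℝ] ℂ) := by
      funext e
      ext v
      rfl
    rw [dForm, this, extDeriv_constOfIsEmpty]
    ext v
    simp
  | succ p ih =>
    have h : dForm (powForm θ (p + 1)) x = wedge (dForm (powForm θ p) x) (θ x) :=
      dForm_wedge_of_closed (hθ.powForm p) hθ (hd x)
    rw [h, ih, ← wedgeCLM_apply]
    simp

end Naturality

/-! ### Metrics in coordinates -/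

section Coordinates

variable {E : Type*} [NormedAddCommGroup E] [NormedSpace ℂ E]
  {M : Type*} [TopologicalSpace M] [ChartedSpace E M] [IsManifold 𝓘(ℂ, E) ω M] {k : ℕ}

theorem eq_pullback_chart (c : M) (φ : M → E [⋀^Fin k]→L[ℝ] ℂ) {x : M}
    (hx : x ∈ (chartAt E c).source) : φ x = pullback (chartAt E c) (inChart c φ) x := by
  have h1 := pullback_comp (E := E) (F := E) (G := E) (f := chartAt E c) (x := x)
    (g := (chartAt E c).symm) φ
    (isHolomorphicAt_chart_symm c ((chartAt E c).map_source hx)).mdifferentiableAt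
    (isHolomorphicAt_chart c hx).mdifferentiableAt
  have h2 : (chartAt E c).symm ∘ chartAt E c =ᶠ[𝓝 x] id := by
    filter_upwards [(chartAt E c).open_source.mem_nhds hx] with y hy
    exact (chartAt E c).left_inv hy
  have h3 : (complexDeriv (id : M → M) x : E →L[ℂ] E) = ContinuousLinearMap.id ℂ E := mfderiv_id
  rw [inChart, ← h1, pullback_congr φ h2]
  ext v
  simp only [pullback, realDeriv, h3]
  rfl

theorem complexDeriv_chart_symm_injective (c : M) {e : E} (he : e ∈ (chartAt E c).target) :
    Function.Injective (complexDeriv (chartAt E c).symm e : E →L[ℂ] E) := by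
  have h1 := complexDeriv_comp (E := E) (F := E) (G := E) (g := chartAt E c)
    (f := (chartAt E c).symm) (x := e)
    (isHolomorphicAt_chart c ((chartAt E c).map_target he)).mdifferentiableAt
    (isHolomorphicAt_chart_symm c he).mdifferentiableAt
  have h2 : chartAt E c ∘ (chartAt E c).symm =ᶠ[𝓝 e] id := by
    filter_upwards [(chartAt E c).open_target.mem_nhds he] with y hy
    exact (chartAt E c).right_inv hy
  have h3 : (complexDeriv (id : E → E) e : E →L[ℂ] E) = ContinuousLinearMap.id ℂ E := mfderiv_id
  rw [complexDeriv_congr h2, h3] at h1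
  intro v w hvw
  have h4 : (ContinuousLinearMap.id ℂ E) v = (ContinuousLinearMap.id ℂ E) w := by
    rw [h1, ContinuousLinearMap.comp_apply, ContinuousLinearMap.comp_apply, hvw]
  exact h4

theorem vecNorm_nonneg (θ : E [⋀^Fin 2]→L[ℝ] ℂ) (v : E) : 0 ≤ vecNorm θ v := Real.sqrt_nonneg _

theorem smul_pair (θ : E [⋀^Fin 2]→L[ℝ] ℂ) (t : ℝ) (v w : E) :
    θ ![t • v, t • w] = t ^ 2 • θ ![v, w] := by
  have : ![t • v, t • w] = fun i : Fin 2 => (fun _ : Fin 2 => t) i • ![v, w] i := by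
    funext i; fin_cases i <;> rfl
  rw [this, ContinuousAlternatingMap.map_smul_univ]
  simp

theorem vecNorm_smul (θ : E [⋀^Fin 2]→L[ℝ] ℂ) (t : ℝ) (v : E) :
    vecNorm θ (t • v) = |t| * vecNorm θ v := by
  rw [vecNorm, smul_comm Complex.I t v, smul_pair, Complex.smul_re, smul_eq_mul,
    Real.sqrt_mul (sq_nonneg t), Real.sqrt_sq_eq_abs]
  rfl

theorem continuousOn_apply_pair {S : Type*} [TopologicalSpace S] {s : Set S}
    {θ : S → E [⋀^Fin 2]→L[ℝ] ℂ} {f g : S → E} (hθ : ContinuousOn θ s) (hf : ContinuousOn f s)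
    (hg : ContinuousOn g s) : ContinuousOn (fun x => θ x ![f x, g x]) s := by
  have h : ContinuousOn (fun x => (![f x, g x] : Fin 2 → E)) s := by
    refine continuousOn_pi.2 fun i => ?_
    fin_cases i
    · exact hf
    · exact hg
  exact hθ.eval h

variable [FiniteDimensional ℂ E]

theorem IsHermitianMetric.inChart_pos {Ω : M → E [⋀^Fin 2]→L[ℝ] ℂ} (hΩ : IsHermitianMetric Ω)
    (c : M) {e : E} (he : e ∈ (chartAt E c).target) {v : E} (hv : v ≠ 0) :
    0 < (inChart c Ω e ![v, Complex.I • v]).re := by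
  have h := hΩ.pos ((chartAt E c).symm e) (complexDeriv (chartAt E c).symm e v : E) (fun h => hv
    (complexDeriv_chart_symm_injective c he (h.trans (map_zero _).symm)))
  have : (fun i => realDeriv (E := E) (F := E) (chartAt E c).symm e (![v, Complex.I • v] i)) =
      ![complexDeriv (chartAt E c).symm e v, Complex.I • complexDeriv (chartAt E c).symm e v] := by
    funext i
    fin_cases i <;> simp [realDeriv]
  rw [← this] at h
  exact h

/-- On a compact subset of a chart, the norm defined by a Hermitian metric dominates the norm of
the model space. -/
theorem IsHermitianMetric.exists_mul_norm_le {Ω : M → E [⋀^Fin 2]→L[ℝ] ℂ}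
    (hΩ : IsHermitianMetric Ω) (c : M) {K : Set E} (hK : IsCompact K)
    (hKt : K ⊆ (chartAt E c).target) :
    ∃ δ : ℝ, 0 < δ ∧ ∀ e ∈ K, ∀ v : E, δ * ‖v‖ ≤ vecNorm (inChart c Ω e) v := by
  have : ProperSpace E := FiniteDimensional.proper ℂ E
  have hS : IsCompact (K ×ˢ Metric.sphere (0 : E) 1) := hK.prod (isCompact_sphere _ _)
  have hcont : ContinuousOn (fun p : E × E => (inChart c Ω p.1 ![p.2, Complex.I • p.2]).re)
      (K ×ˢ Metric.sphere (0 : E) 1) := by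
    refine Complex.continuous_re.comp_continuousOn (continuousOn_apply_pair ?_ ?_ ?_)
    · exact (hΩ.smooth c).continuousOn.comp continuousOn_fst fun p hp => hKt hp.1
    · exact continuousOn_snd
    · exact continuousOn_snd.const_smul _
  have hpos : ∀ p ∈ K ×ˢ Metric.sphere (0 : E) 1,
      0 < (inChart c Ω p.1 ![p.2, Complex.I • p.2]).re := by
    rintro ⟨e, v⟩ ⟨he, hv⟩
    refine hΩ.inChart_pos c (hKt he) ?_
    rintro h
    simp only at h hv
    simp [h] at hv
  obtain ⟨δ, hδ, hle⟩ : ∃ δ : ℝ, 0 < δ ∧ ∀ p ∈ K ×ˢ Metric.sphere (0 : E) 1,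
      δ ≤ (inChart c Ω p.1 ![p.2, Complex.I • p.2]).re := by
    rcases (K ×ˢ Metric.sphere (0 : E) 1).eq_empty_or_nonempty with h | h
    · exact ⟨1, one_pos, by simp [h]⟩
    · obtain ⟨p, hp, hmin⟩ := hS.exists_isMinOn h hcont
      exact ⟨_, hpos p hp, fun q hq => hmin hq⟩
  refine ⟨Real.sqrt δ, Real.sqrt_pos.2 hδ, fun e he v => ?_⟩
  rcases eq_or_ne v 0 with rfl | hv
  · simp [vecNorm_nonneg]
  · have hv' : 0 < ‖v‖ := norm_pos_iff.2 hv
    have h1 := hle (e, (‖v‖⁻¹ : ℝ) • v) ⟨he, by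
      rw [mem_sphere_zero_iff_norm, norm_smul, norm_inv, norm_norm, inv_mul_cancel₀ hv'.ne']⟩
    have h2 : Real.sqrt δ ≤ vecNorm (inChart c Ω e) ((‖v‖⁻¹ : ℝ) • v) := Real.sqrt_le_sqrt h1
    rw [vecNorm_smul, abs_of_pos (inv_pos.2 hv'), ← div_eq_inv_mul, le_div_iff₀ hv'] at h2
    exact h2

theorem vecNorm_eq_vecNorm_inChart (Ω : M → E [⋀^Fin 2]→L[ℝ] ℂ) (c : M) {x : M}
    (hx : x ∈ (chartAt E c).source) (v : E) :
    vecNorm (Ω x) v =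
      vecNorm (inChart c Ω (chartAt E c x)) (complexDeriv (chartAt E c) x v : E) := by
  rw [eq_pullback_chart c Ω hx, vecNorm_pullback]

/-- On a compact manifold, smooth forms are bounded with respect to any Hermitian metric. -/
theorem IsSmoothForm.isBoundedForm [CompactSpace M] {Ω : M → E [⋀^Fin 2]→L[ℝ] ℂ}
    (hΩ : IsHermitianMetric Ω) {φ : M → E [⋀^Fin k]→L[ℝ] ℂ} (hφ : IsSmoothForm φ) :
    IsBoundedForm Ω φ := by
  have : ProperSpace E := FiniteDimensional.proper ℂ E
  have hloc : ∀ p : M, ∃ U ∈ 𝓝 p, ∃ C : ℝ, 0 ≤ C ∧ ∀ x ∈ U, ∀ v : Fin k → E,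
      ‖φ x v‖ ≤ C * ∏ i, vecNorm (Ω x) (v i) := by
    intro p
    have hp := mem_chart_source E p
    obtain ⟨r, hr, hrt⟩ := Metric.nhds_basis_closedBall.mem_iff.1
      ((chartAt E p).open_target.mem_nhds ((chartAt E p).map_source hp))
    have hK := isCompact_closedBall (chartAt E p p) r
    obtain ⟨δ, hδ, hle⟩ := hΩ.exists_mul_norm_le p hK hrt
    obtain ⟨C, hC⟩ := (hK.image_of_continuousOn
      ((hφ p).continuousOn.mono hrt)).isBounded.exists_norm_le
    have hU : (chartAt E p).source ∩ chartAt E p ⁻¹' Metric.closedBall (chartAt E p p) r ∈ 𝓝 p :=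
      Filter.inter_mem ((chartAt E p).open_source.mem_nhds hp)
        (((chartAt E p).continuousAt hp) (Metric.closedBall_mem_nhds _ hr))
    -- `C` bounds the coordinate expression of the form on the compact ball; each of the `k`
    -- arguments costs a factor δ⁻¹ for passing from the norm of `E` to that of the metric.
    refine ⟨_, hU, |C| * (δ⁻¹) ^ k, by positivity, fun x hx v => ?_⟩
    have h1 := eq_pullback_chart p φ hx.1
    rw [h1]
    set A : E →L[ℂ] E := complexDeriv (chartAt E p) x with hA
    have h2 : ‖(inChart p φ (chartAt E p x)) (fun i => A (v i))‖ ≤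
        |C| * ∏ i, ‖A (v i)‖ := by
      refine (ContinuousAlternatingMap.le_opNorm _ _).trans ?_
      gcongr
      exact (hC _ ⟨_, hx.2, rfl⟩).trans (le_abs_self C)
    have h3 : ∏ i, ‖A (v i)‖ ≤ ∏ i, (δ⁻¹ * vecNorm (Ω x) (v i)) := by
      refine Finset.prod_le_prod (fun _ _ => norm_nonneg _) fun i _ => ?_
      rw [vecNorm_eq_vecNorm_inChart Ω p hx.1, ← div_eq_inv_mul, le_div_iff₀ hδ, mul_comm]
      exact hle _ hx.2 _
    rw [Finset.prod_mul_distrib] at h3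
    calc _ ≤ |C| * ∏ i, ‖A (v i)‖ := h2
      _ ≤ |C| * _ := mul_le_mul_of_nonneg_left h3 (abs_nonneg C)
      _ = _ := by simp [mul_assoc]
  choose U hU C hC h using hloc
  obtain ⟨t, ht⟩ := CompactSpace.elim_nhds_subcover U hU
  refine ⟨∑ p ∈ t, C p, fun x v => ?_⟩
  have hx : x ∈ ⋃ p ∈ t, U p := by rw [ht]; trivial
  obtain ⟨p, hp, hxp⟩ := Set.mem_iUnion₂.1 hx
  refine (h p x hxp v).trans ?_
  have := Finset.single_le_sum (fun q _ => hC q) hp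
  exact mul_le_mul_of_nonneg_right this (Finset.prod_nonneg fun i _ => vecNorm_nonneg _ _)

end Coordinates

/-! ### Bounded forms under pullback and wedge product -/

section Bounded

variable {E : Type*} [NormedAddCommGroup E] [NormedSpace ℂ E]
  {F : Type*} [NormedAddCommGroup F] [NormedSpace ℂ F]
  {M : Type*} [TopologicalSpace M] [ChartedSpace E M]
  {N : Type*} [TopologicalSpace N] [ChartedSpace F N] {k l : ℕ}

theorem IsBoundedForm.pullback {Ω : N → F [⋀^Fin 2]→L[ℝ] ℂ} {φ : N → F [⋀^Fin k]→L[ℝ] ℂ}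
    (h : IsBoundedForm Ω φ) (f : M → N) :
    IsBoundedForm (pullback f Ω : M → E [⋀^Fin 2]→L[ℝ] ℂ) (pullback f φ) := by
  obtain ⟨C, hC⟩ := h
  refine ⟨C, fun x v => ?_⟩
  simp only [vecNorm_pullback]
  exact hC (f x) fun i => complexDeriv f x (v i)

theorem IsBoundedForm.wedge {Ω : M → E [⋀^Fin 2]→L[ℝ] ℂ} {φ : M → E [⋀^Fin k]→L[ℝ] ℂ}
    {ψ : M → E [⋀^Fin l]→L[ℝ] ℂ} (hφ : IsBoundedForm Ω φ) (hψ : IsBoundedForm Ω ψ) :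
    IsBoundedForm Ω (fun x => wedge (φ x) (ψ x)) := by
  obtain ⟨a, ha⟩ := hφ
  obtain ⟨b, hb⟩ := hψ
  exact ⟨_, fun x v => norm_wedge_apply_le _ _ (ha x) (hb x) v⟩

end Bounded

/-! ### Implications that follow from calculus of forms -/

section Implications

variable {E : Type*} [NormedAddCommGroup E] [NormedSpace ℂ E] [FiniteDimensional ℂ E]
  {M : Type*} [TopologicalSpace M] [ChartedSpace E M] [IsManifold 𝓘(ℂ, E) ω M]
  {M' : Type*} [TopologicalSpace M'] [ChartedSpace E M'] [IsManifold 𝓘(ℂ, E) ω M'] {k : ℕ}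
  {π : M' → M}

theorem IsTildeDBounded.isTildeDelDelbarBounded {Ω : M → E [⋀^Fin 2]→L[ℝ] ℂ}
    {φ : M → E [⋀^Fin k]→L[ℝ] ℂ} (h : IsTildeDBounded π Ω φ) :
    IsTildeDelDelbarBounded π Ω φ := by
  obtain ⟨j, hj, β, h1, h2, h3⟩ := h
  refine ⟨j, hj, β, β, h1, h1, h2, h2, fun x => ?_⟩
  rw [h3, dForm_eq_delForm_add_delbarForm]

theorem BalancedHyperbolic.gauduchonHyperbolic {n : ℕ} (h : BalancedHyperbolic (E := E) n π) :
    GauduchonHyperbolic (E := E) n π := by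
  obtain ⟨Ω, h1, h2⟩ := h
  exact ⟨Ω, h1.1, h2.isTildeDelDelbarBounded⟩

/-- `∂` maps forms of type `(1,1)` to forms of type `(2,1)`, on which multiplication of the
arguments by `i` acts as `i`. -/
theorem alternatizeUncurryFin_linPart_smul_I {D : E →L[ℝ] (E [⋀^Fin 2]→L[ℝ] ℂ)}
    (hD : ∀ u v w, D u ![Complex.I • v, Complex.I • w] = D u ![v, w]) (v : Fin 3 → E) :
    ContinuousAlternatingMap.alternatizeUncurryFin (linPart D) (fun i => Complex.I • v i) =
      Complex.I * ContinuousAlternatingMap.alternatizeUncurryFin (linPart D) v := by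
  have hD' : ∀ u (w : Fin 2 → E), D u (fun i => Complex.I • w i) = D u w := by
    intro u w
    have h1 : w = ![w 0, w 1] := by funext i; fin_cases i <;> rfl
    have h2 : (fun i => Complex.I • w i) = ![Complex.I • w 0, Complex.I • w 1] := by
      funext i; fin_cases i <;> rfl
    rw [h2, hD]
    exact congrArg _ h1.symm
  have hneg : ∀ u, D (-u) = - D u := fun u => map_neg D u
  rw [ContinuousAlternatingMap.alternatizeUncurryFin_apply,
    ContinuousAlternatingMap.alternatizeUncurryFin_apply, Finset.mul_sum]
  refine Finset.sum_congr rfl fun i _ => ?_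
  rw [mul_smul_comm]
  congr 1
  have h3 : i.removeNth (fun i => Complex.I • v i) = fun j => Complex.I • i.removeNth v j := rfl
  rw [h3]
  simp only [linPart, smul_apply, sub_apply,
    ContinuousLinearMap.comp_apply, ContinuousLinearMap.coe_restrictScalars',
    ContinuousLinearMap.id_apply, ContinuousAlternatingMap.smul_apply,
    ContinuousAlternatingMap.sub_apply, smul_eq_mul, hD', smul_smul, Complex.I_mul_I, neg_smul,
    one_smul, hneg, ContinuousAlternatingMap.neg_apply]
  linear_combination (1 / 2 : ℂ) * D (Complex.I • v i) (i.removeNth v) * Complex.I_mul_I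

theorem alternatizeUncurryFin_antilinPart_smul_I {D : E →L[ℝ] (E [⋀^Fin 2]→L[ℝ] ℂ)}
    (hD : ∀ u v w, D u ![Complex.I • v, Complex.I • w] = D u ![v, w]) (v : Fin 3 → E) :
    ContinuousAlternatingMap.alternatizeUncurryFin (antilinPart D) (fun i => Complex.I • v i) =
      -Complex.I * ContinuousAlternatingMap.alternatizeUncurryFin (antilinPart D) v := by
  have hD' : ∀ u (w : Fin 2 → E), D u (fun i => Complex.I • w i) = D u w := by
    intro u w
    have h1 : w = ![w 0, w 1] := by funext i; fin_cases i <;> rfl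
    have h2 : (fun i => Complex.I • w i) = ![Complex.I • w 0, Complex.I • w 1] := by
      funext i; fin_cases i <;> rfl
    rw [h2, hD]
    exact congrArg _ h1.symm
  have hneg : ∀ u, D (-u) = - D u := fun u => map_neg D u
  rw [ContinuousAlternatingMap.alternatizeUncurryFin_apply,
    ContinuousAlternatingMap.alternatizeUncurryFin_apply, Finset.mul_sum]
  refine Finset.sum_congr rfl fun i _ => ?_
  rw [mul_smul_comm]
  congr 1
  have h3 : i.removeNth (fun i => Complex.I • v i) = fun j => Complex.I • i.removeNth v j := rfl
  rw [h3]
  simp only [antilinPart, smul_apply, add_apply,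
    ContinuousLinearMap.comp_apply, ContinuousLinearMap.coe_restrictScalars',
    ContinuousLinearMap.id_apply, ContinuousAlternatingMap.smul_apply,
    ContinuousAlternatingMap.add_apply, smul_eq_mul, hD', smul_smul, Complex.I_mul_I, neg_smul,
    one_smul, hneg, ContinuousAlternatingMap.neg_apply]
  linear_combination (1 / 2 : ℂ) * D (Complex.I • v i) (i.removeNth v) * Complex.I_mul_I

/-- Multiplying all arguments by i acts on ∂Ω, of type (2,1), as i and on ∂̄Ω, of type (1,2), as -i.
Their sum dΩ is zero, so both vanish. -/
theorem IsKahler.delbarForm_eq_zero {Ω : M → E [⋀^Fin 2]→L[ℝ] ℂ} (h : IsKahler Ω) (x : M) :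
    delbarForm Ω x = 0 := by
  have he := (chartAt E x).map_source (mem_chart_source E x)
  set D := fderiv ℝ (inChart x Ω) (chartAt E x x) with hDdef
  have hdiff := (h.1.smooth.differentiableAt he).hasFDerivAt
  -- The charts are holomorphic, so the coordinate expression is of type (1,1) everywhere in the
  -- chart and its derivative inherits this invariance.
  have hD : ∀ u v w, D u ![Complex.I • v, Complex.I • w] = D u ![v, w] := by
    intro u v w
    have h1 := hdiff.continuousAlternatingMap_apply_const ![Complex.I • v, Complex.I • w]
    have h2 := hdiff.continuousAlternatingMap_apply_const ![v, w]
    have h3 : (fun e => inChart x Ω e ![Complex.I • v, Complex.I • w]) =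
        fun e => inChart x Ω e ![v, w] := by
      funext e
      have h4 : ∀ a b : E, (fun i => realDeriv (E := E) (F := E) (chartAt E x).symm e (![a, b] i)) =
          ![complexDeriv (chartAt E x).symm e a, complexDeriv (chartAt E x).symm e b] := by
        intro a b
        funext i
        fin_cases i <;> simp [realDeriv]
      have h5 := h.1.type_one_one ((chartAt E x).symm e) (complexDeriv (chartAt E x).symm e v : E)
        (complexDeriv (chartAt E x).symm e w : E)
      have h6 : ∀ a b : E, inChart x Ω e ![a, b] = Ω ((chartAt E x).symm e)
          ![complexDeriv (chartAt E x).symm e a, complexDeriv (chartAt E x).symm e b] := by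
        intro a b
        rw [← h4]
        rfl
      rw [h6, h6, ← h5]
      simp
    rw [h3] at h1
    exact DFunLike.congr_fun (h1.unique h2) u
  ext v
  have h0 : ∀ v, delForm Ω x v + delbarForm Ω x v = 0 := fun v => by
    rw [← ContinuousAlternatingMap.add_apply, ← dForm_eq_delForm_add_delbarForm, h.2]; rfl
  have h1 : delForm Ω x (fun i => Complex.I • v i) = Complex.I * delForm Ω x v :=
    alternatizeUncurryFin_linPart_smul_I hD v
  have h2 : delbarForm Ω x (fun i => Complex.I • v i) = -Complex.I * delbarForm Ω x v :=
    alternatizeUncurryFin_antilinPart_smul_I hD v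
  have h3 := h0 (fun i => Complex.I • v i)
  rw [h1, h2] at h3
  have h4 : (2 * Complex.I) * delbarForm Ω x v = 0 := by
    linear_combination Complex.I * h0 v - h3
  simpa using h4

theorem KahlerHyperbolic.sktHyperbolic (h : KahlerHyperbolic (E := E) π) :
    SKTHyperbolic (E := E) π := by
  obtain ⟨Ω, h1, h2⟩ := h
  refine ⟨Ω, ⟨h1.1, fun x => ?_⟩, h2.isTildeDelDelbarBounded⟩
  have h0 : delbarForm Ω = fun _ => 0 := funext h1.delbarForm_eq_zero
  have h3 : inChart x (delbarForm Ω) = fun _ => 0 := by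
    rw [h0]
    funext e
    ext v
    rfl
  rw [delForm, h3, alternatizeUncurryFin_linPart]
  ext v
  simp [ContinuousAlternatingMap.alternatizeUncurryFin_apply]

/-- If dβ = π^*φ, then d(β ∧ π^*Ω) = π^*(φ ∧ Ω), because Ω is closed; this is the inductive step
from one power of Ω to the next. -/
theorem IsTildeDBounded.wedge {Ω : M → E [⋀^Fin 2]→L[ℝ] ℂ} (hΩ : IsKahler Ω)
    (hb : IsBoundedForm Ω Ω) (hπ : MDifferentiable 𝓘(ℂ, E) 𝓘(ℂ, E) π)
    {φ : M → E [⋀^Fin k]→L[ℝ] ℂ} (h : IsTildeDBounded π Ω φ) :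
    IsTildeDBounded π Ω (fun x => wedge (φ x) (Ω x)) := by
  obtain ⟨j, rfl, β, h1, h2, h3⟩ := h
  have hs : IsSmoothForm (pullback π Ω : M' → E [⋀^Fin 2]→L[ℝ] ℂ) := hΩ.1.smooth.pullback hπ
  refine ⟨j + 2, rfl, fun x => HermitianHyperbolicity.wedge (β x) (pullback π Ω x),
    h1.wedge hs, h2.wedge (hb.pullback π), fun x => ?_⟩
  have h4 : dForm (pullback π Ω : M' → E [⋀^Fin 2]→L[ℝ] ℂ) x = 0 := by
    rw [dForm_pullback hΩ.1.smooth (hπ.isHolomorphicAt x), pullback, hΩ.2]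
    rfl
  have h5 := dForm_wedge_of_closed h1 hs h4
  rw [pullback_wedge, h3]
  exact h5.symm

theorem KahlerHyperbolic.balancedHyperbolic [CompactSpace M] {n : ℕ} (hn : 2 ≤ n)
    (hπ : MDifferentiable 𝓘(ℂ, E) 𝓘(ℂ, E) π) (h : KahlerHyperbolic (E := E) π) :
    BalancedHyperbolic (E := E) n π := by
  obtain ⟨Ω, h1, h2⟩ := h
  refine ⟨Ω, ⟨h1.1, dForm_powForm_of_closed h1.1.smooth h1.2 _⟩, ?_⟩
  obtain ⟨p, rfl⟩ : ∃ p, n = p + 2 := ⟨n - 2, by omega⟩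
  -- The induction starts at the first power, since a form of degree 0 has no primitive.
  have key : ∀ p, IsTildeDBounded π Ω (powForm Ω (p + 1)) := by
    intro p
    induction p with
    | zero =>
      have : powForm Ω 1 = Ω := funext fun x => wedgePow_one (Ω x)
      rw [zero_add, this]
      exact h2
    | succ p ih => exact ih.wedge h1 (h1.1.smooth.isBoundedForm h1.1) hπ
  exact key p

theorem DegenerateBalanced.balancedHyperbolic [CompactSpace M] {n : ℕ}
    (hπ : MDifferentiable 𝓘(ℂ, E) 𝓘(ℂ, E) π) (h : DegenerateBalanced E M n) :
    BalancedHyperbolic (E := E) n π := by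
  obtain ⟨Ω, hΩ, j, hj, Γ, hΓ, hΓd⟩ := h
  -- The degree 2(n - 1) is replaced by a variable `l`, so that the transport along the equality of
  -- degrees can be eliminated.
  have hcast : ∀ (l : ℕ) (hl : j + 1 = l) (φ : M → E [⋀^Fin l]→L[ℝ] ℂ),
      (∀ x, φ x = castDegree hl (dForm Γ x)) →
      (∀ x, dForm φ x = 0) ∧ IsTildeDBounded π Ω φ := by
    rintro l rfl φ hφ
    have hφ' : φ = dForm Γ := funext hφ
    refine ⟨fun x => by rw [hφ', dForm_dForm hΓ], j, rfl, pullback π Γ, hΓ.pullback hπ,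
      (hΓ.isBoundedForm hΩ).pullback π, fun x => ?_⟩
    rw [hφ', ← dForm_pullback hΓ (hπ.isHolomorphicAt x)]
    rfl
  have := hcast _ hj _ hΓd
  exact ⟨Ω, ⟨hΩ, this.1⟩, this.2⟩

end Implications

/-! ### Polar coordinates and the divergence theorem on balls -/

section Divergence

open MeasureTheory Metric Set

variable {V : Type*} [NormedAddCommGroup V] [NormedSpace ℝ V] [FiniteDimensional ℝ V]
  [Nontrivial V] [MeasurableSpace V] [BorelSpace V] (μ : Measure V) [μ.IsAddHaarMeasure]

theorem integral_polar {f : V → ℝ} (hf : Integrable f μ) :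
    ∫ x, f x ∂μ = ∫ r in Ioi (0 : ℝ), r ^ (Module.finrank ℝ V - 1) *
      ∫ u : sphere (0 : V) 1, f (r • (u : V)) ∂μ.toSphere := by
  set g : sphere (0 : V) 1 × Ioi (0 : ℝ) → ℝ := fun p => f ((p.2 : ℝ) • (p.1 : V)) with hg
  have hmp := μ.measurePreserving_homeomorphUnitSphereProd
  have hcomp : ∀ x : ({(0)}ᶜ : Set V), g (homeomorphUnitSphereProd V x) = f x := by
    intro x
    have h0 : ‖(x : V)‖ ≠ 0 := norm_ne_zero_iff.2 x.2
    simp [hg, smul_smul, mul_inv_cancel₀ h0]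
  have hgi : Integrable g (μ.toSphere.prod (.volumeIoiPow (Module.finrank ℝ V - 1))) := by
    rw [← hmp.integrable_comp_emb (Homeomorph.measurableEmbedding _)]
    have : g ∘ homeomorphUnitSphereProd V = f ∘ Subtype.val := funext hcomp
    rw [this, ← integrableOn_iff_comap_subtypeVal (measurableSet_singleton _).compl]
    exact hf.integrableOn
  calc
    ∫ x, f x ∂μ = ∫ x : ({(0)}ᶜ : Set V), f x.1 ∂(μ.comap (↑)) := by
      rw [integral_subtype_comap (measurableSet_singleton _).compl f, restrict_compl_singleton]
    _ = ∫ p, g p ∂μ.toSphere.prod (.volumeIoiPow (Module.finrank ℝ V - 1)) := by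
      rw [← hmp.integral_comp (Homeomorph.measurableEmbedding _)]
      exact integral_congr_ae (.of_forall fun x => (hcomp x).symm)
    _ = ∫ y : Ioi (0 : ℝ), ∫ u : sphere (0 : V) 1, f ((y : ℝ) • (u : V)) ∂μ.toSphere
          ∂.volumeIoiPow (Module.finrank ℝ V - 1) := integral_prod_symm g hgi
    _ = _ := by
      simp only [Measure.volumeIoiPow, ENNReal.ofReal]
      rw [integral_withDensity_eq_integral_smul,
        integral_subtype_comap measurableSet_Ioi fun a => Real.toNNReal (a ^ (Module.finrank ℝ V - 1)) •
          ∫ u : sphere (0 : V) 1, f (a • (u : V)) ∂μ.toSphere,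
        setIntegral_congr_fun measurableSet_Ioi fun x hx ↦ ?_]
      · rw [NNReal.smul_def, Real.coe_toNNReal _ (pow_nonneg (le_of_lt hx) _), smul_eq_mul]
      · exact (measurable_subtype_coe.pow_const _).real_toNNReal

/-- The integral over a sphere of radius `t`. -/
def sphereMean (f : V → ℝ) (t : ℝ) : ℝ :=
  t ^ (Module.finrank ℝ V - 1) * ∫ u : sphere (0 : V) 1, f (t • (u : V)) ∂μ.toSphere

theorem setIntegral_ball_polar {f : V → ℝ} {t : ℝ} (ht : 0 ≤ t) (hf : IntegrableOn f (ball 0 t) μ) :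
    ∫ x in ball 0 t, f x ∂μ = ∫ r in (0 : ℝ)..t, sphereMean μ f r := by
  rw [← integral_indicator measurableSet_ball,
    integral_polar μ ((integrable_indicator_iff measurableSet_ball).2 hf),
    intervalIntegral.integral_of_le ht, ← integral_Ioc_eq_integral_Ioo.symm]
  rw [← integral_indicator measurableSet_Ioi, ← integral_indicator measurableSet_Ioo]
  congr 1
  ext r
  by_cases hr : 0 < r
  · by_cases hrt : r < t
    · rw [indicator_of_mem (show r ∈ Ioi 0 from hr), indicator_of_mem (show r ∈ Ioo 0 t from ⟨hr, hrt⟩),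
        sphereMean]
      congr 2
      ext u
      rw [indicator_of_mem]
      simp [norm_smul, abs_of_pos hr, hrt]
    · rw [indicator_of_mem (show r ∈ Ioi 0 from hr),
        indicator_of_notMem (show r ∉ Ioo 0 t from fun h => hrt h.2)]
      have : ∀ u : sphere (0 : V) 1, (ball 0 t).indicator f (r • (u : V)) = 0 := by
        intro u
        rw [indicator_of_notMem]
        simpa [norm_smul, abs_of_pos hr] using hrt
      simp [this]
  · rw [indicator_of_notMem (show r ∉ Ioi 0 from hr),
      indicator_of_notMem (show r ∉ Ioo 0 t from fun h => hr h.1)]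

theorem continuousOn_sphereMean {f : V → ℝ} {s : Set ℝ}
    (hf : ContinuousOn f {x | ∃ t ∈ s, ‖x‖ = |t|}) : ContinuousOn (sphereMean μ f) s := by
  unfold sphereMean
  refine (continuousOn_id.pow _).mul ?_
  have h2 : ContinuousOn (Function.uncurry fun (t : ℝ) (u : sphere (0 : V) 1) => f (t • (u : V)))
      (s ×ˢ univ) := by
    refine hf.comp (f := fun p : ℝ × sphere (0 : V) 1 => p.1 • (p.2 : V)) (by fun_prop) ?_
    rintro ⟨t, u⟩ ⟨ht, -⟩
    exact ⟨t, ht, by simp [norm_smul]⟩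
  simpa using continuousOn_integral_of_compact_support (μ := μ.toSphere) (k := univ) isCompact_univ
    h2 (fun p x hp hx => (hx (mem_univ _)).elim)

theorem continuous_sphereMean {f : V → ℝ} (hf : Continuous f) : Continuous (sphereMean μ f) :=
  continuousOn_univ.1 (continuousOn_sphereMean μ hf.continuousOn)

theorem sphereMean_mul_norm (f : V → ℝ) (ρ : ℝ → ℝ) {t : ℝ} (ht : 0 ≤ t) :
    sphereMean μ (fun z => ρ ‖z‖ * f z) t = ρ t * sphereMean μ f t := by
  unfold sphereMean
  have : ∀ u : sphere (0 : V) 1, ρ ‖t • (u : V)‖ * f (t • (u : V)) = ρ t * f (t • (u : V)) := by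
    intro u
    simp [norm_smul, abs_of_nonneg ht]
  simp only [this, integral_const_mul]
  ring

/-- At the origin the norm is not differentiable, but `k` has zero derivative there, so k(‖z‖) -
k(0) = o(‖z‖). Elsewhere the norm is differentiated as the square root of ‖z‖². -/
theorem hasFDerivAt_comp_norm (hτ : ContDiff ℝ ∞ (fun x : V => ‖x‖ ^ 2)) {k ρ : ℝ → ℝ}
    (hk : ∀ x, HasDerivAt k (ρ x) x) (h0 : ρ 0 = 0) (z : V) :
    HasFDerivAt (fun z => k ‖z‖)
      ((ρ ‖z‖ / (2 * ‖z‖)) • fderiv ℝ (fun x : V => ‖x‖ ^ 2) z) z := by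
  by_cases hz : z = 0
  · subst hz
    have h1 := (hasDerivAt_iff_isLittleO.1 (hk 0))
    rw [hasFDerivAt_iff_isLittleO]
    have h2 : Filter.Tendsto (fun z : V => ‖z‖) (𝓝 0) (𝓝 0) := by
      simpa using (continuous_norm (E := V)).tendsto 0
    have h3 := h1.comp_tendsto h2
    simpa [h0] using Asymptotics.isLittleO_norm_right.1 (by simpa [Function.comp_def, h0] using h3)
  · have hn : ‖z‖ ≠ 0 := norm_ne_zero_iff.2 hz
    have h1 : HasFDerivAt (fun x : V => ‖x‖ ^ 2) (fderiv ℝ (fun x : V => ‖x‖ ^ 2) z) z :=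
      (hτ.differentiable (by simp) z).hasFDerivAt
    have h2 := h1.sqrt (by positivity)
    have h3 : (fun x : V => Real.sqrt (‖x‖ ^ 2)) = fun x => ‖x‖ := by
      ext x
      exact Real.sqrt_sq (norm_nonneg x)
    rw [h3, Real.sqrt_sq (norm_nonneg z)] at h2
    refine ((hk ‖z‖).comp_hasFDerivAt z h2).congr_fderiv ?_
    rw [smul_smul]
    congr 1
    ring

/-- Both sides are continuous in the radius on (0, T), so it suffices to test them against smooth
`ρ` supported there. With `k` a primitive of `ρ`, integration by parts on the whole space moves the
derivative from `Y` to k(‖z‖), whose derivative is ρ(‖z‖) dτ/(2‖z‖). Polar coordinates reduce both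
integrals to the radius, where a second integration by parts turns `k` back into `ρ`. The norm
enters only through the smoothness of its square. -/
theorem setIntegral_ball_fderiv_of_hasCompactSupport (hτ : ContDiff ℝ ∞ (fun x : V => ‖x‖ ^ 2))
    {Y : V → ℝ} (hY : ContDiff ℝ 1 Y) (hYc : HasCompactSupport Y) (b : V) {t : ℝ} (ht : 0 < t) :
    ∫ z in ball 0 t, fderiv ℝ Y z b ∂μ =
      sphereMean μ (fun z => fderiv ℝ (fun x : V => ‖x‖ ^ 2) z b / (2 * ‖z‖) * Y z) t := by
  set D : V → ℝ := fun z => fderiv ℝ Y z b with hD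
  set G : V → ℝ := fun z => fderiv ℝ (fun x : V => ‖x‖ ^ 2) z b / (2 * ‖z‖) * Y z with hG
  have hτ' : Continuous fun z : V => fderiv ℝ (fun x : V => ‖x‖ ^ 2) z b :=
    (hτ.continuous_fderiv (by simp)).clm_apply continuous_const
  have hDc : Continuous D := (hY.continuous_fderiv (by simp)).clm_apply continuous_const
  have hDs : HasCompactSupport D := hYc.fderiv_apply (𝕜 := ℝ) b
  set a : ℝ → ℝ := fun x => ∫ r in (0 : ℝ)..x, sphereMean μ D r with ha
  have hSD := continuous_sphereMean μ hDc
  have had : ∀ x, HasDerivAt a (sphereMean μ D x) x := fun x =>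
    (hSD.integral_hasStrictDerivAt 0 x).hasDerivAt
  have hac : Continuous a := continuous_iff_continuousAt.2 fun x => (had x).continuousAt
  have hGc : ContinuousOn (sphereMean μ G) (Ioi 0) := by
    refine continuousOn_sphereMean μ ?_
    refine ((hτ'.continuousOn).div (by fun_prop) ?_).mul hY.continuous.continuousOn
    rintro x ⟨t, ht, hx⟩
    have : (0 : ℝ) < t := ht
    rw [hx]
    positivity
  obtain ⟨T, htT, hT⟩ : ∃ T, t < T ∧ tsupport Y ⊆ ball 0 T := by
    obtain ⟨R, hR⟩ := hYc.isCompact.isBounded.subset_ball (0 : V)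
    exact ⟨max R t + 1, by linarith [le_max_right R t],
      hR.trans (ball_subset_ball (by linarith [le_max_left R t]))⟩
  have hT0 : 0 < T := ht.trans htT
  have key : ∀ ρ : ℝ → ℝ, ContDiff ℝ ∞ ρ → HasCompactSupport ρ → tsupport ρ ⊆ Ioo 0 T →
      ∫ x, ρ x • (a x - sphereMean μ G x) = 0 := by
    intro ρ hρ _ hρs
    have hρc := hρ.continuous
    have hρ0 : ∀ x, x ∉ Ioo 0 T → ρ x = 0 := fun x hx => image_eq_zero_of_notMem_tsupport
      fun h => hx (hρs h)
    -- The normalization k(T) = 0, together with a(0) = 0, removes the boundary terms of the radial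
    -- integration by parts.
    set k : ℝ → ℝ := fun x => (∫ r in (0 : ℝ)..x, ρ r) - ∫ r in (0 : ℝ)..T, ρ r with hk
    have hkd : ∀ x, HasDerivAt k (ρ x) x := fun x =>
      ((hρc.integral_hasStrictDerivAt 0 x).hasDerivAt).sub_const _
    have hkc : Continuous k := continuous_iff_continuousAt.2 fun x => (hkd x).continuousAt
    have hχ := hasFDerivAt_comp_norm hτ hkd (hρ0 0 (by simp))
    have hqc : Continuous fun x => ρ x / (2 * x) := by
      rw [continuous_iff_continuousAt]
      intro x
      by_cases hx : x = 0
      · subst hx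
        have h0 : (0 : ℝ) ∉ tsupport ρ := fun h => lt_irrefl _ (hρs h).1
        have : (fun x => ρ x / (2 * x)) =ᶠ[𝓝 0] fun _ => 0 := by
          filter_upwards [notMem_tsupport_iff_eventuallyEq.1 h0] with x hx
          simp [hx]
        exact continuousAt_const.congr this.symm
      · exact hρc.continuousAt.div (by fun_prop) (by simpa using hx)
    have hparts : ∫ z, k ‖z‖ * D z ∂μ = - ∫ z, ρ ‖z‖ * G z ∂μ := by
      have hfd : ∀ z, fderiv ℝ (fun z => k ‖z‖) z b * Y z = ρ ‖z‖ * G z := by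
        intro z
        rw [(hχ z).fderiv]
        simp [hG]
        ring
      have hfd' : ∀ z, fderiv ℝ (fun z => k ‖z‖) z b * Y z =
          (ρ ‖z‖ / (2 * ‖z‖)) * fderiv ℝ (fun x : V => ‖x‖ ^ 2) z b * Y z := by
        intro z
        rw [(hχ z).fderiv]
        simp
      have := integral_mul_fderiv_eq_neg_fderiv_mul_of_integrable (μ := μ)
        (f := fun z : V => k ‖z‖) (g := Y) (v := b)
        ?_ ?_ ?_ (fun x _ => (hχ x).differentiableAt)
        (fun x _ => hY.differentiable (by simp) x)
      · rw [this]
        congr 1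
        exact integral_congr_ae (.of_forall hfd)
      · simp only [hfd']
        exact Continuous.integrable_of_hasCompactSupport
          (((hqc.comp continuous_norm).mul hτ').mul hY.continuous) hYc.mul_left
      · exact Continuous.integrable_of_hasCompactSupport
          ((hkc.comp continuous_norm).mul hDc) hDs.mul_left
      · exact Continuous.integrable_of_hasCompactSupport
          ((hkc.comp continuous_norm).mul hY.continuous) hYc.mul_left
    have hsupp : ∀ f : V → ℝ, (∀ z, z ∉ tsupport Y → f z = 0) →
        ∫ z, f z ∂μ = ∫ z in ball 0 T, f z ∂μ := by
      intro f hf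
      rw [setIntegral_eq_integral_of_forall_compl_eq_zero]
      intro z hz
      exact hf z fun h => hz (hT h)
    have hL : ∫ z, k ‖z‖ * D z ∂μ = - ∫ r in (0 : ℝ)..T, ρ r * a r := by
      rw [hsupp, setIntegral_ball_polar μ hT0.le]
      · have h1 : ∫ r in (0 : ℝ)..T, sphereMean μ (fun z => k ‖z‖ * D z) r =
            ∫ r in (0 : ℝ)..T, k r * sphereMean μ D r := by
          refine intervalIntegral.integral_congr fun r hr => ?_
          rw [uIcc_of_le hT0.le] at hr
          exact sphereMean_mul_norm μ D k hr.1
        rw [h1, intervalIntegral.integral_mul_deriv_eq_deriv_mul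
          (fun x _ => hkd x) (fun x _ => had x)
          (hρc.intervalIntegrable _ _) (hSD.intervalIntegrable _ _)]
        simp [hk, ha]
      · exact (Continuous.integrable_of_hasCompactSupport
          ((hkc.comp continuous_norm).mul hDc) hDs.mul_left).integrableOn
      · intro z hz
        have : D z = 0 := by
          rw [hD]
          simp [fderiv_of_notMem_tsupport ℝ hz]
        simp [this]
    have hR : ∫ z, ρ ‖z‖ * G z ∂μ = ∫ r in (0 : ℝ)..T, ρ r * sphereMean μ G r := by
      rw [hsupp, setIntegral_ball_polar μ hT0.le]
      · refine intervalIntegral.integral_congr fun r hr => ?_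
        rw [uIcc_of_le hT0.le] at hr
        exact sphereMean_mul_norm μ G ρ hr.1
      · have : (fun z => ρ ‖z‖ * G z) = fun z => (ρ ‖z‖ / (2 * ‖z‖)) *
            fderiv ℝ (fun x : V => ‖x‖ ^ 2) z b * Y z := by
          ext z
          simp only [hG]
          ring
        rw [this]
        exact (Continuous.integrable_of_hasCompactSupport
          (((hqc.comp continuous_norm).mul hτ').mul hY.continuous) hYc.mul_left).integrableOn
      · intro z hz
        simp [hG, image_eq_zero_of_notMem_tsupport hz]
    rw [hL, hR, neg_inj] at hparts
    have hi : ∀ f : ℝ → ℝ, (∫ x, ρ x * f x) = ∫ x in (0 : ℝ)..T, ρ x * f x := by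
      intro f
      rw [intervalIntegral.integral_of_le hT0.le, integral_Ioc_eq_integral_Ioo,
        setIntegral_eq_integral_of_forall_compl_eq_zero]
      intro x hx
      simp [hρ0 x hx]
    have hci : ∀ f : ℝ → ℝ, ContinuousOn f (Ioi 0) → Integrable fun x => ρ x * f x := by
      intro f hf
      have hcs : HasCompactSupport ρ := by assumption
      refine Continuous.integrable_of_hasCompactSupport ?_ hcs.mul_right
      rw [continuous_iff_continuousAt]
      intro x
      by_cases hx : x ∈ tsupport ρ
      · exact hρc.continuousAt.mul (hf.continuousAt (Ioi_mem_nhds (hρs hx).1))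
      · have : (fun x => ρ x * f x) =ᶠ[𝓝 x] fun _ => 0 := by
          filter_upwards [notMem_tsupport_iff_eventuallyEq.1 hx] with x hx
          simp [hx]
        exact continuousAt_const.congr this.symm
    simp only [smul_eq_mul, mul_sub]
    rw [integral_sub (hci a hac.continuousOn) (hci _ hGc), hi, hi, hparts, sub_self]
  have hcont : ContinuousOn (fun x => a x - sphereMean μ G x) (Ioo 0 T) :=
    hac.continuousOn.sub (hGc.mono Ioo_subset_Ioi_self)
  have hae := isOpen_Ioo.ae_eq_zero_of_integral_contDiff_smul_eq_zero
    (hcont.locallyIntegrableOn measurableSet_Ioo) key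
  have heq := Measure.eqOn_open_of_ae_eq (μ := volume) (g := fun _ => (0 : ℝ))
    ((ae_restrict_iff' measurableSet_Ioo).2 hae) isOpen_Ioo hcont continuousOn_const
  have := heq (show t ∈ Ioo 0 T from ⟨ht, htT⟩)
  rw [setIntegral_ball_polar μ ht.le (hDc.integrable_of_hasCompactSupport hDs).integrableOn]
  simpa [sub_eq_zero] using this

/-- The divergence theorem on a ball for the constant-direction field `Y b`. -/
theorem setIntegral_ball_fderiv (hτ : ContDiff ℝ ∞ (fun x : V => ‖x‖ ^ 2))
    {Y : V → ℝ} {R : ℝ} (hY : ContDiffOn ℝ 1 Y (ball 0 R)) (b : V) {t : ℝ} (ht : 0 < t)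
    (htR : t < R) :
    ∫ z in ball 0 t, fderiv ℝ Y z b ∂μ =
      sphereMean μ (fun z => fderiv ℝ (fun x : V => ‖x‖ ^ 2) z b / (2 * ‖z‖) * Y z) t := by
  have h1 : t < (t + R) / 2 := by linarith
  have h2 : (t + R) / 2 < R := by linarith
  -- The inner radius exceeds `t` and the outer one is less than `R`: multiplication by `φ` changes
  -- nothing near the closed ball of radius `t` and makes `Y` compactly supported.
  let φ : ContDiffBump (0 : V) := ⟨(t + R) / 2, (t + 3 * R) / 4, by linarith, by linarith⟩
  have hφ1 : ∀ z ∈ ball (0 : V) ((t + R) / 2), φ z = 1 := fun z hz =>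
    φ.one_of_mem_closedBall (ball_subset_closedBall hz)
  have hts : tsupport φ ⊆ ball 0 R := by
    rw [φ.tsupport_eq]
    exact closedBall_subset_ball (by change (t + 3 * R) / 4 < R; linarith)
  have hc : ContDiff ℝ 1 (fun z => φ z * Y z) := by
    rw [contDiff_iff_contDiffAt]
    intro z
    by_cases hz : z ∈ tsupport φ
    · exact φ.contDiffAt.mul (hY.contDiffAt (isOpen_ball.mem_nhds (hts hz)))
    · have : (fun x => φ x * Y x) =ᶠ[𝓝 z] fun _ => 0 := by
        filter_upwards [notMem_tsupport_iff_eventuallyEq.1 hz] with x hx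
        simp [hx]
      exact contDiffAt_const.congr_of_eventuallyEq this
  have hcs : HasCompactSupport (fun z => φ z * Y z) := φ.hasCompactSupport.mul_right
  have hmain := setIntegral_ball_fderiv_of_hasCompactSupport μ hτ hc hcs b ht
  have hl : ∫ z in ball 0 t, fderiv ℝ (fun z => φ z * Y z) z b ∂μ =
      ∫ z in ball 0 t, fderiv ℝ Y z b ∂μ := by
    refine setIntegral_congr_fun measurableSet_ball fun z hz => ?_
    have : (fun x => φ x * Y x) =ᶠ[𝓝 z] Y := by
      filter_upwards [isOpen_ball.mem_nhds (ball_subset_ball h1.le hz)] with x hx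
      simp [hφ1 x hx]
    simp only [this.fderiv_eq]
  rw [← hl, hmain]
  unfold sphereMean
  congr 2
  ext u
  dsimp only
  rw [hφ1, one_mul]
  simpa [norm_smul, abs_of_pos ht] using h1

end Divergence

/-! ### Pointwise Hermitian algebra on `ℂ^m` -/

section WedgePowFrame

variable {E : Type*} [NormedAddCommGroup E] [NormedSpace ℂ E]
  {F : Type*} [NormedAddCommGroup F] [NormedSpace ℂ F]

/-- By induction on the antisymmetrization formula, θ^p on given vectors is a polynomial in the
pairings of these vectors. The two forms may even live on different spaces. -/
theorem wedgePow_apply_congr {θ : E [⋀^Fin 2]→L[ℝ] ℂ} {η : F [⋀^Fin 2]→L[ℝ] ℂ} :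
    ∀ (p : ℕ) (v : Fin (2 * p) → E) (w : Fin (2 * p) → F),
      (∀ a b, θ ![v a, v b] = η ![w a, w b]) → wedgePow θ p v = wedgePow η p w := by
  intro p
  induction p with
  | zero => intro v w _; simp [wedgePow]
  | succ p ih =>
    intro v w h
    have h1 := wedge_eq_antisum (wedgePow θ p) θ v
    have h2 := wedge_eq_antisum (wedgePow η p) η w
    rw [wedgePow_succ, wedgePow_succ]
    refine h1.trans (Eq.trans ?_ h2.symm)
    congr 1
    unfold antisum
    refine Finset.sum_congr rfl fun σ _ => ?_
    congr 1
    unfold tensorFun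
    congr 1
    · exact ih _ _ fun a b => h _ _
    · have e1 : (fun j : Fin 2 => (v ∘ σ) (Fin.natAdd (2 * p) j)) =
          ![v (σ (Fin.natAdd (2 * p) 0)), v (σ (Fin.natAdd (2 * p) 1))] := by
        funext j; fin_cases j <;> rfl
      have e2 : (fun j : Fin 2 => (w ∘ σ) (Fin.natAdd (2 * p) j)) =
          ![w (σ (Fin.natAdd (2 * p) 0)), w (σ (Fin.natAdd (2 * p) 1))] := by
        funext j; fin_cases j <;> rfl
      rw [e1, e2]
      exact h _ _

theorem prod_fin_two_mul (p : ℕ) (g : ℕ → ℝ) :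
    ∏ a : Fin (2 * p), g ((a : ℕ) / 2) = ∏ j : Fin p, g j ^ 2 := by
  rw [Fin.prod_univ_eq_prod_range (fun a => g (a / 2)), Fin.prod_univ_eq_prod_range (fun a => g a ^ 2)]
  induction p with
  | zero => simp
  | succ p ih =>
    rw [show 2 * (p + 1) = 2 * p + 1 + 1 by ring, Finset.prod_range_succ, Finset.prod_range_succ,
      Finset.prod_range_succ, ih, show (2 * p + 1) / 2 = p by omega, show (2 * p) / 2 = p by omega]
    ring

theorem map_smul_pair (θ : E [⋀^Fin 2]→L[ℝ] ℂ) (s t : ℝ) (v w : E) :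
    θ ![s • v, t • w] = ((s * t : ℝ) : ℂ) * θ ![v, w] := by
  have := θ.toAlternatingMap.toMultilinearMap.map_smul_univ ![s, t] ![v, w]
  have e : (fun i => (![s, t] : Fin 2 → ℝ) i • (![v, w] : Fin 2 → E) i) = ![s • v, t • w] := by
    funext i; fin_cases i <;> rfl
  rw [e] at this
  refine Eq.trans this ?_
  simp [Fin.prod_univ_two]

/-- If all `μ j` are positive, dividing the vectors by √μ gives a symplectic frame, on which the
value depends on `p` only. If some `μ j` is zero, the vector of index 2j pairs trivially with all
others and may be replaced by 0, so both sides vanish. -/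
theorem exists_wedgePow_frame_eq (E : Type*) [NormedAddCommGroup E] [NormedSpace ℂ E] (p : ℕ) :
    ∃ r : ℝ, 0 < r ∧ ∀ (θ : E [⋀^Fin 2]→L[ℝ] ℂ) (v : Fin (2 * p) → E) (μ : ℕ → ℝ),
      (∀ j, 0 ≤ μ j) → (∀ a b, θ ![v a, v b] = μ ((a : ℕ) / 2) * symplecticEntry a b) →
      wedgePow θ p v = ((r * ∏ j : Fin p, μ j : ℝ) : ℂ) := by
  have huniv : ∃ r : ℝ, 0 < r ∧ ∀ (θ : E [⋀^Fin 2]→L[ℝ] ℂ) (v : Fin (2 * p) → E),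
      (∀ a b, θ ![v a, v b] = symplecticEntry a b) → wedgePow θ p v = r := by
    by_cases h : ∃ (θ : E [⋀^Fin 2]→L[ℝ] ℂ) (v : Fin (2 * p) → E),
      ∀ a b, θ ![v a, v b] = symplecticEntry a b
    · obtain ⟨θ, v, h⟩ := h
      obtain ⟨r, hr, hr'⟩ := wedgePow_symplectic_pos θ p v h
      refine ⟨r, hr, fun η w hw => ?_⟩
      rw [← hr']
      exact wedgePow_apply_congr p w v fun a b => (hw a b).trans (h a b).symm
    · exact ⟨1, one_pos, fun θ v hv => (h ⟨θ, v, hv⟩).elim⟩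
  obtain ⟨r, hr, huniv⟩ := huniv
  refine ⟨r, hr, fun θ v μ hμ hv => ?_⟩
  by_cases hpos : ∀ j : Fin p, 0 < μ j
  · have hpos' : ∀ a : Fin (2 * p), 0 < √(μ ((a : ℕ) / 2)) := fun a =>
      Real.sqrt_pos.2 (hpos ⟨a / 2, by omega⟩)
    have h1 := huniv θ (fun a : Fin (2 * p) => (√(μ ((a : ℕ) / 2)))⁻¹ • v a) (by
      intro a b
      rw [map_smul_pair, hv]
      by_cases hab : (a : ℕ) / 2 = b / 2
      · rw [← hab, ← mul_inv, Real.mul_self_sqrt (hμ _), ← mul_assoc, ← Complex.ofReal_mul,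
          inv_mul_cancel₀ (hpos ⟨a / 2, by omega⟩).ne']
        simp
      · simp [symplecticEntry, hab])
    have h2 : v = fun a : Fin (2 * p) => √(μ ((a : ℕ) / 2)) • ((√(μ ((a : ℕ) / 2)))⁻¹ • v a) := by
      funext a
      rw [smul_smul, mul_inv_cancel₀ (hpos' a).ne', one_smul]
    have h3 := (wedgePow θ p).toAlternatingMap.toMultilinearMap.map_smul_univ
      (fun a : Fin (2 * p) => √(μ ((a : ℕ) / 2))) (fun a : Fin (2 * p) => (√(μ ((a : ℕ) / 2)))⁻¹ • v a)
    rw [← h2] at h3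
    refine Eq.trans h3 ?_
    rw [show ((wedgePow θ p).toMultilinearMap fun a : Fin (2 * p) => (√(μ ((a : ℕ) / 2)))⁻¹ • v a) = r from h1,
      prod_fin_two_mul p fun j => √(μ j), Complex.real_smul, mul_comm, ← Complex.ofReal_mul]
    congr 3
    funext j
    exact Real.sq_sqrt (hμ j)
  · push Not at hpos
    obtain ⟨j, hj⟩ := hpos
    have hj0 : μ j = 0 := le_antisymm hj (hμ j)
    rw [Finset.prod_eq_zero (Finset.mem_univ j) hj0, mul_zero, Complex.ofReal_zero]
    have hjp := j.2
    set a₀ : Fin (2 * p) := ⟨2 * j, by omega⟩ with ha₀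
    have hz0 : ∀ w : E, θ ![0, w] = 0 := fun w =>
      θ.toAlternatingMap.map_coord_zero (m := ![0, w]) 0 rfl
    have hz1 : ∀ w : E, θ ![w, 0] = 0 := fun w =>
      θ.toAlternatingMap.map_coord_zero (m := ![w, 0]) 1 rfl
    have := wedgePow_apply_congr (θ := θ) (η := θ) p v (Function.update v a₀ 0) (by
      intro a b
      by_cases ha : a = a₀
      · subst ha
        rw [Function.update_self, hz0, hv]
        simp [ha₀, hj0]
      · by_cases hb : b = a₀
        · subst hb
          rw [Function.update_self, hz1, hv]
          by_cases hab : (a : ℕ) / 2 = a₀ / 2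
          · rw [hab]
            simp [ha₀, hj0]
          · simp [symplecticEntry, hab]
        · rw [Function.update_of_ne ha, Function.update_of_ne hb])
    rw [this]
    exact (wedgePow θ p).toAlternatingMap.map_coord_zero a₀ (Function.update_self _ _ _)

end WedgePowFrame

/-! ### Semipositive (1,1)-covectors and their Hermitian forms -/

section Semipositive

variable {E : Type*} [NormedAddCommGroup E] [NormedSpace ℂ E]

/-- Real semipositive `(1,1)`-covectors. -/
structure IsSemipositive (θ : E [⋀^Fin 2]→L[ℝ] ℂ) : Prop where
  real : ∀ v w : E, (θ ![v, w]).im = 0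
  type_one_one : ∀ v w : E, θ ![Complex.I • v, Complex.I • w] = θ ![v, w]
  nonneg : ∀ v : E, 0 ≤ (θ ![v, Complex.I • v]).re

theorem pair_add_right (θ : E [⋀^Fin 2]→L[ℝ] ℂ) (v w w' : E) :
    θ ![v, w + w'] = θ ![v, w] + θ ![v, w'] := by
  have := θ.toAlternatingMap.map_update_add ![v, w] 1 w w'
  have e : ∀ x : E, Function.update ![v, w] 1 x = ![v, x] := by
    intro x; funext i; fin_cases i <;> simp
  rw [e, e, e] at this
  exact this

theorem pair_smul_right (θ : E [⋀^Fin 2]→L[ℝ] ℂ) (t : ℝ) (v w : E) :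
    θ ![v, t • w] = t * θ ![v, w] := by
  have := map_smul_pair θ 1 t v w
  simpa using this

theorem pair_swap (θ : E [⋀^Fin 2]→L[ℝ] ℂ) (v w : E) : θ ![w, v] = - θ ![v, w] := by
  have := θ.toAlternatingMap.map_swap ![v, w] (show (0 : Fin 2) ≠ 1 by simp)
  have e : (![v, w] ∘ Equiv.swap (0 : Fin 2) 1) = ![w, v] := by
    funext i; fin_cases i <;> simp
  rw [e] at this
  exact this

theorem vecNorm_sq_le_norm_mul (θ : E [⋀^Fin 2]→L[ℝ] ℂ) (v : E) :
    vecNorm θ v ^ 2 ≤ ‖θ‖ * ‖v‖ ^ 2 := by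
  rw [vecNorm]
  by_cases h : 0 ≤ (θ ![v, Complex.I • v]).re
  · rw [Real.sq_sqrt h]
    refine (Complex.re_le_norm _).trans ((θ.le_opNorm _).trans (le_of_eq ?_))
    simp [Fin.prod_univ_two, norm_smul, sq]
  · rw [Real.sqrt_eq_zero_of_nonpos (le_of_not_ge h), zero_pow two_ne_zero]
    positivity

theorem pair_smul_I_left {θ : E [⋀^Fin 2]→L[ℝ] ℂ} (h : IsSemipositive θ) (v w : E) :
    θ ![Complex.I • v, w] = - θ ![v, Complex.I • w] := by
  have h1 := h.type_one_one (Complex.I • v) w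
  rw [smul_smul, Complex.I_mul_I] at h1
  rw [← h1]
  have h2 := map_smul_pair θ (-1) 1 v (Complex.I • w)
  simpa using h2

/-- The Hermitian form `h(v, w) = θ(v, iw) + i θ(v, w)`, as a linear form in `w`. -/
def hermitianForm (θ : E [⋀^Fin 2]→L[ℝ] ℂ) (v : E) : E →ₗ[ℂ] ℂ where
  toFun w := θ ![v, Complex.I • w] + Complex.I * θ ![v, w]
  map_add' w w' := by
    rw [smul_add, pair_add_right, pair_add_right]
    ring
  map_smul' c w := by
    have h1 : Complex.I • c • w = c.re • (Complex.I • w) + (-c.im) • w := by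
      rw [← Complex.coe_smul, ← Complex.coe_smul, smul_smul, smul_smul, ← add_smul]
      congr 1
      apply Complex.ext <;> simp
    have h2 : c • w = c.re • w + c.im • (Complex.I • w) := by
      rw [← Complex.coe_smul, ← Complex.coe_smul, smul_smul, ← add_smul, Complex.re_add_im]
    rw [h1, h2, pair_add_right, pair_add_right, pair_smul_right, pair_smul_right, pair_smul_right,
      pair_smul_right, RingHom.id_apply, smul_eq_mul]
    conv_rhs => rw [← Complex.re_add_im c]
    push_cast
    linear_combination (c.im : ℂ) * (-1) * (θ ![v, w]) * Complex.I_mul_I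

theorem hermitianForm_apply (θ : E [⋀^Fin 2]→L[ℝ] ℂ) (v w : E) :
    hermitianForm θ v w = θ ![v, Complex.I • w] + Complex.I * θ ![v, w] := rfl

theorem IsSemipositive.hermitianForm_symm {θ : E [⋀^Fin 2]→L[ℝ] ℂ} (h : IsSemipositive θ)
    (v w : E) : (starRingEnd ℂ) (hermitianForm θ v w) = hermitianForm θ w v := by
  rw [hermitianForm_apply, hermitianForm_apply, pair_swap θ (Complex.I • v) w,
    pair_smul_I_left h, pair_swap θ v w]
  have h1 := h.real v w
  have h2 := h.real v (Complex.I • w)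
  apply Complex.ext <;> simp [h1, h2]

theorem IsSemipositive.eq_im {θ : E [⋀^Fin 2]→L[ℝ] ℂ} (h : IsSemipositive θ)
    (v w : E) : θ ![v, w] = ((hermitianForm θ v w).im : ℂ) := by
  have h1 := h.real v w
  have h2 := h.real v (Complex.I • w)
  apply Complex.ext <;> simp [hermitianForm_apply, h1, h2]

end Semipositive

/-! ### Diagonalization in a unitary basis -/

section Diagonalization

variable {m : ℕ}

/-- The space `ℂ^m` with its Euclidean structure. -/
abbrev CSpace (m : ℕ) : Type := EuclideanSpace ℂ (Fin m)

/-- The endomorphism representing the Hermitian form of `θ`. -/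
def hermitianEnd (θ : CSpace m [⋀^Fin 2]→L[ℝ] ℂ) : CSpace m →ₗ[ℂ] CSpace m where
  toFun w := WithLp.toLp 2 fun j => hermitianForm θ (EuclideanSpace.single j 1) w
  map_add' w w' := by ext j; simp
  map_smul' c w := by ext j; simp

theorem IsSemipositive.inner_hermitianEnd {θ : CSpace m [⋀^Fin 2]→L[ℝ] ℂ} (h : IsSemipositive θ)
    (v w : CSpace m) : inner ℂ v (hermitianEnd θ w) = hermitianForm θ v w := by
  rw [← h.hermitianForm_symm]
  have hv : v = ∑ j, v j • EuclideanSpace.single j (1 : ℂ) := by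
    ext i
    simp [Finset.sum_apply, Pi.single_apply]
  conv_rhs => rw [hv]
  rw [map_sum, map_sum, PiLp.inner_apply]
  refine Finset.sum_congr rfl fun j _ => ?_
  rw [map_smul, smul_eq_mul, map_mul, h.hermitianForm_symm]
  simp [hermitianEnd, mul_comm]

/-- This is the spectral theorem for the symmetric endomorphism representing the Hermitian form;
evaluating on an eigenvector shows its eigenvalue to be nonnegative. -/
theorem IsSemipositive.exists_diagonalization {θ : CSpace m [⋀^Fin 2]→L[ℝ] ℂ} (h : IsSemipositive θ) :
    ∃ (u : OrthonormalBasis (Fin m) ℂ (CSpace m)) (μ : Fin m → ℝ), (∀ j, 0 ≤ μ j) ∧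
      ∀ v w, hermitianForm θ v w = ∑ j, (μ j : ℂ) * (inner ℂ v (u j) * inner ℂ (u j) w) := by
  have hT : (hermitianEnd θ).IsSymmetric := by
    intro v w
    rw [h.inner_hermitianEnd, ← inner_conj_symm, h.inner_hermitianEnd, h.hermitianForm_symm]
  have hn : Module.finrank ℂ (CSpace m) = m := by simp
  have key : ∀ v w, hermitianForm θ v w = ∑ j, (hT.eigenvalues hn j : ℂ) *
      (inner ℂ v (hT.eigenvectorBasis hn j) * inner ℂ (hT.eigenvectorBasis hn j) w) := by
    intro v w
    rw [← h.inner_hermitianEnd, ← (hT.eigenvectorBasis hn).sum_inner_mul_inner]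
    refine Finset.sum_congr rfl fun j _ => ?_
    rw [← hT, hT.apply_eigenvectorBasis hn, inner_smul_left]
    simp
    ring
  refine ⟨hT.eigenvectorBasis hn, hT.eigenvalues hn, fun j => ?_, key⟩
  have h1 := key (hT.eigenvectorBasis hn j) (hT.eigenvectorBasis hn j)
  have h2 := h.nonneg (hT.eigenvectorBasis hn j)
  rw [Finset.sum_eq_single j] at h1
  · rw [(hT.eigenvectorBasis hn).inner_eq_one] at h1
    have h3 := congrArg Complex.re h1
    rw [hermitianForm_apply] at h3
    have h4 := h.real (hT.eigenvectorBasis hn j) (hT.eigenvectorBasis hn j)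
    simp [h4] at h3
    linarith
  · intro i _ hij
    rw [(hT.eigenvectorBasis hn).inner_eq_zero hij]
    simp
  · simp

/-- The real frame `u₁, iu₁, …, u_m, iu_m` of a unitary frame `u`. -/
def unitaryFrame (u : Fin m → CSpace m) (a : Fin (2 * m)) : CSpace m :=
  (if (a : ℕ) % 2 = 0 then (1 : ℂ) else Complex.I) • u ⟨a / 2, by omega⟩

/-- The real determinant of a complex-linear map is the squared modulus of its complex determinant,
which is 1 for a unitary map. The real and imaginary parts of `ψ` are separately multiples of the
determinant. -/
theorem apply_unitaryFrame (ψ : CSpace m [⋀^Fin (2 * m)]→L[ℝ] ℂ) (u : OrthonormalBasis (Fin m) ℂ (CSpace m)) :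
    ψ (unitaryFrame u) = ψ (stdFrame m) := by
  set L : CSpace m →ₗ[ℂ] CSpace m := u.repr.symm.toLinearIsometry.toLinearMap with hL
  have hLf : unitaryFrame u = (L.restrictScalars ℝ) ∘ stdFrame m := by
    funext a
    have : stdFrame m a = (if (a : ℕ) % 2 = 0 then (1 : ℂ) else Complex.I) •
        EuclideanSpace.single ⟨a / 2, by omega⟩ (1 : ℂ) := by
      rw [stdFrame]
      generalize (if (a : ℕ) % 2 = 0 then (1 : ℂ) else Complex.I) = c
      ext i
      simp
    rw [Function.comp_apply, this, LinearMap.coe_restrictScalars, map_smul]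
    simp [unitaryFrame, hL]
  have hdet : LinearMap.det (L.restrictScalars ℝ) = 1 := by
    have h1 : ‖LinearMap.det L‖ = 1 := by
      rw [← LinearMap.normDet_eq_norm_det]
      exact u.repr.symm.toLinearIsometry.normDet_eq_one
    rw [LinearMap.det_restrictScalars, Algebra.norm_complex_apply, Complex.normSq_eq_norm_sq, h1,
      one_pow]
  have hfin : Module.finrank ℝ (CSpace m) = 2 * m := by
    rw [← Module.finrank_mul_finrank ℝ ℂ (CSpace m)]
    simp
  let e := Module.finBasisOfFinrankEq ℝ (CSpace m) hfin
  have key : ∀ p : CSpace m [⋀^Fin (2 * m)]→ₗ[ℝ] ℝ, p (unitaryFrame u) = p (stdFrame m) := by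
    intro p
    rw [p.eq_smul_basis_det e, hLf]
    simp only [AlternatingMap.smul_apply]
    rw [Module.Basis.det_comp, hdet, one_mul]
  have hre := key (Complex.reLm.compAlternatingMap ψ.toAlternatingMap)
  have him := key (Complex.imLm.compAlternatingMap ψ.toAlternatingMap)
  exact Complex.ext hre him

end Diagonalization

/-! ### Volume densities and dual norms of semipositive forms -/

section Density

variable {m : ℕ}

/-- `θ^m / m!` evaluated on the standard frame. -/
def topDensity (θ : CSpace m [⋀^Fin 2]→L[ℝ] ℂ) : ℝ :=
  ((m.factorial : ℝ)⁻¹ • wedgePow θ m (stdFrame m)).re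

theorem volDensity_eq (θ : CSpace m → CSpace m [⋀^Fin 2]→L[ℝ] ℂ) (z : CSpace m) :
    volDensity θ z = topDensity (θ z) := rfl

/-- The norm of a real linear form dual to the one defined by `θ`. -/
def dualNorm (θ : CSpace m [⋀^Fin 2]→L[ℝ] ℂ) (l : CSpace m →L[ℝ] ℝ) : ℝ :=
  sSup {s | ∃ v : CSpace m, vecNorm θ v ≤ 1 ∧ s = |l v|}

theorem dtauNorm_eq (θ : CSpace m → CSpace m [⋀^Fin 2]→L[ℝ] ℂ) (z : CSpace m) :
    dtauNorm θ z = dualNorm (θ z) (fderiv ℝ (fun u : CSpace m => ‖u‖ ^ 2) z) := rfl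

theorem dualNorm_nonneg (θ : CSpace m [⋀^Fin 2]→L[ℝ] ℂ) (l : CSpace m →L[ℝ] ℝ) : 0 ≤ dualNorm θ l := by
  refine Real.sSup_nonneg ?_
  rintro s ⟨v, -, rfl⟩
  exact abs_nonneg _

/-- Diagonalization of a semipositive form by a unitary basis. -/
structure IsDiagonalization (θ : CSpace m [⋀^Fin 2]→L[ℝ] ℂ) (u : OrthonormalBasis (Fin m) ℂ (CSpace m))
    (μ : Fin m → ℝ) : Prop where
  semipositive : IsSemipositive θ
  nonneg : ∀ j, 0 ≤ μ j
  apply : ∀ v w, hermitianForm θ v w = ∑ j, (μ j : ℂ) * (inner ℂ v (u j) * inner ℂ (u j) w)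

variable {θ : CSpace m [⋀^Fin 2]→L[ℝ] ℂ} {u : OrthonormalBasis (Fin m) ℂ (CSpace m)} {μ : Fin m → ℝ}

theorem IsDiagonalization.vecNorm_sq (h : IsDiagonalization θ u μ) (v : CSpace m) :
    vecNorm θ v ^ 2 = ∑ j, μ j * ‖inner ℂ (u j) v‖ ^ 2 := by
  rw [vecNorm, Real.sq_sqrt (h.semipositive.nonneg v)]
  have h1 := congrArg Complex.re (h.apply v v)
  rw [hermitianForm_apply] at h1
  have h2 := h.semipositive.real v v
  rw [Complex.add_re, Complex.I_mul_re, h2, neg_zero, add_zero, Complex.re_sum] at h1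
  rw [h1]
  refine Finset.sum_congr rfl fun j _ => ?_
  rw [← inner_conj_symm, ← Complex.normSq_eq_conj_mul_self, ← Complex.ofReal_mul,
    Complex.ofReal_re, Complex.normSq_eq_norm_sq]

theorem IsDiagonalization.apply_frame (h : IsDiagonalization θ u μ) (a b : Fin (2 * m)) :
    θ ![unitaryFrame u a, unitaryFrame u b] =
      μ ⟨a / 2, by omega⟩ * symplecticEntry a b := by
  rw [h.semipositive.eq_im, h.apply, Finset.sum_eq_single ⟨a / 2, by omega⟩]
  · unfold unitaryFrame symplecticEntry
    rw [inner_smul_left, inner_smul_right, u.inner_eq_one]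
    by_cases hab : (a : ℕ) / 2 = b / 2
    · have : (⟨(b : ℕ) / 2, by omega⟩ : Fin m) = ⟨(a : ℕ) / 2, by omega⟩ := Fin.ext hab.symm
      rw [this, u.inner_eq_one, if_pos hab]
      rcases Nat.mod_two_eq_zero_or_one a with ha | ha <;>
        rcases Nat.mod_two_eq_zero_or_one b with hb | hb
      · rw [if_pos ha, if_pos hb, if_neg (by omega), if_neg (by omega)]; simp
      · rw [if_pos ha, if_neg (by omega), if_pos (by omega)]; simp
      · rw [if_neg (by omega), if_pos hb, if_neg (by omega), if_pos (by omega)]; simp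
      · rw [if_neg (by omega), if_neg (by omega), if_neg (by omega), if_neg (by omega)]; simp
    · rw [u.inner_eq_zero (by simpa [Fin.ext_iff] using hab), if_neg hab]
      simp
  · intro j _ hj
    unfold unitaryFrame
    rw [inner_smul_left, u.inner_eq_zero (Ne.symm hj)]
    simp
  · simp

theorem IsDiagonalization.vecNorm_frame (h : IsDiagonalization θ u μ) (a : Fin (2 * m)) :
    vecNorm θ (unitaryFrame u a) = √(μ ⟨a / 2, by omega⟩) := by
  rw [← Real.sqrt_sq (vecNorm_nonneg θ (unitaryFrame u a)), h.vecNorm_sq,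
    Finset.sum_eq_single ⟨a / 2, by omega⟩]
  · rw [unitaryFrame, inner_smul_right, u.inner_eq_one]
    congr 1
    split_ifs <;> simp
  · intro j _ hj
    rw [unitaryFrame, inner_smul_right, u.inner_eq_zero hj]
    simp
  · simp

variable (m) in
-- The constant comes from the common value of θ^m on symplectic frames; only its positivity and its
-- independence of `θ` are used.
theorem exists_topDensity_eq : ∃ c : ℝ, 0 < c ∧
    ∀ (θ : CSpace m [⋀^Fin 2]→L[ℝ] ℂ) (u : OrthonormalBasis (Fin m) ℂ (CSpace m)) (μ : Fin m → ℝ),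
      IsDiagonalization θ u μ → topDensity θ = c * ∏ j, μ j := by
  obtain ⟨r, hr, hr'⟩ := exists_wedgePow_frame_eq (CSpace m) m
  refine ⟨(m.factorial : ℝ)⁻¹ * r, by positivity, fun θ u μ h => ?_⟩
  rw [topDensity, ← apply_unitaryFrame _ u, hr' θ (unitaryFrame u)
    (fun j => if hj : j < m then μ ⟨j, hj⟩ else 0)]
  · rw [Complex.smul_re, Complex.ofReal_re, smul_eq_mul, mul_assoc]
    simp
  · intro j
    split_ifs with hj
    · exact h.nonneg _
    · rfl
  · intro a b
    rw [h.apply_frame, dif_pos]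

theorem IsSemipositive.isDiagonalization {θ : CSpace m [⋀^Fin 2]→L[ℝ] ℂ} (h : IsSemipositive θ) :
    ∃ (u : OrthonormalBasis (Fin m) ℂ (CSpace m)) (μ : Fin m → ℝ), IsDiagonalization θ u μ := by
  obtain ⟨u, μ, h1, h2⟩ := h.exists_diagonalization
  exact ⟨u, μ, h, h1, h2⟩

theorem IsDiagonalization.prod_vecNorm_frame (h : IsDiagonalization θ u μ) :
    ∏ a : Fin (2 * m), vecNorm θ (unitaryFrame u a) = ∏ j, μ j := by
  have := prod_fin_two_mul m (fun j => if hj : j < m then √(μ ⟨j, hj⟩) else 0)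
  have h1 : ∀ a : Fin (2 * m), vecNorm θ (unitaryFrame u a) =
      (fun j => if hj : j < m then √(μ ⟨j, hj⟩) else 0) ((a : ℕ) / 2) := by
    intro a
    rw [h.vecNorm_frame]
    dsimp only
    rw [dif_pos]
  rw [Finset.prod_congr rfl fun a _ => h1 a, this]
  refine Finset.prod_congr rfl fun j _ => ?_
  simp [Real.sq_sqrt (h.nonneg j)]

variable (m) in
-- In the diagonalizing frame the vectors u_j and iu_j both have norm √μ_j, so the assumed bound
-- becomes K ∏ μ_j, a multiple of the density. Degenerate `θ` are included.
theorem exists_norm_apply_stdFrame_le : ∃ K₀ : ℝ, 0 < K₀ ∧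
    ∀ (θ : CSpace m [⋀^Fin 2]→L[ℝ] ℂ) (ψ : CSpace m [⋀^Fin (2 * m)]→L[ℝ] ℂ) (K : ℝ), IsSemipositive θ →
      (∀ v, ‖ψ v‖ ≤ K * ∏ i, vecNorm θ (v i)) → ‖ψ (stdFrame m)‖ ≤ K₀ * K * topDensity θ := by
  obtain ⟨c, hc, hc'⟩ := exists_topDensity_eq m
  refine ⟨c⁻¹, by positivity, fun θ ψ K h hψ => ?_⟩
  obtain ⟨u, μ, hd⟩ := h.isDiagonalization
  rw [← apply_unitaryFrame ψ u, hc' θ u μ hd]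
  refine (hψ _).trans (le_of_eq ?_)
  rw [hd.prod_vecNorm_frame]
  field_simp

theorem IsSemipositive.topDensity_nonneg (h : IsSemipositive θ) : 0 ≤ topDensity θ := by
  obtain ⟨c, hc, hc'⟩ := exists_topDensity_eq m
  obtain ⟨u, μ, hd⟩ := h.isDiagonalization
  rw [hc' θ u μ hd]
  exact mul_nonneg hc.le (Finset.prod_nonneg fun j _ => hd.nonneg j)

/-- Every eigenvalue is at most `L`, so ∏ μ ≤ L^(m-1) μ_j for each j. Weighting with |⟨u_j, v⟩|² and
summing over j gives the estimate, which controls how fast the norm of `θ` may degenerate in terms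
of its density. -/
theorem IsDiagonalization.norm_sq_mul_prod_le (h : IsDiagonalization θ u μ) {L : ℝ}
    (hL : ∀ v, vecNorm θ v ^ 2 ≤ L * ‖v‖ ^ 2) (v : CSpace m) :
    ‖v‖ ^ 2 * ∏ j, μ j ≤ L ^ (m - 1) * vecNorm θ v ^ 2 := by
  have hμL : ∀ j, μ j ≤ L := by
    intro j
    have h1 := hL (u j)
    rw [h.vecNorm_sq, u.norm_eq_one, Finset.sum_eq_single j] at h1
    · simpa using h1
    · intro i _ hij
      rw [u.inner_eq_zero hij]
      simp
    · simp
  rw [h.vecNorm_sq, ← u.sum_sq_norm_inner_right v, Finset.sum_mul, Finset.mul_sum]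
  refine Finset.sum_le_sum fun j _ => ?_
  rw [← Finset.mul_prod_erase _ _ (Finset.mem_univ j)]
  have h2 : ∏ i ∈ Finset.univ.erase j, μ i ≤ L ^ (m - 1) := by
    refine (Finset.prod_le_prod (fun i _ => h.nonneg i) fun i _ => hμL i).trans (le_of_eq ?_)
    simp
  have h3 : 0 ≤ ‖inner ℂ (u j) v‖ ^ 2 * μ j := mul_nonneg (sq_nonneg _) (h.nonneg j)
  nlinarith [mul_le_mul_of_nonneg_left h2 h3]

theorem IsSemipositive.exists_norm_le_of_topDensity_pos (h : IsSemipositive θ)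
    (hpos : 0 < topDensity θ) : ∃ C : ℝ, 0 ≤ C ∧ ∀ v, ‖v‖ ≤ C * vecNorm θ v := by
  obtain ⟨c, hc, hc'⟩ := exists_topDensity_eq m
  obtain ⟨u, μ, hd⟩ := h.isDiagonalization
  rw [hc' θ u μ hd] at hpos
  have hp : 0 < ∏ j, μ j := pos_of_mul_pos_right hpos hc.le
  refine ⟨√(‖θ‖ ^ (m - 1) / ∏ j, μ j), Real.sqrt_nonneg _, fun v => ?_⟩
  have h1 := hd.norm_sq_mul_prod_le (vecNorm_sq_le_norm_mul θ) v
  refine le_of_sq_le_sq ?_ (mul_nonneg (Real.sqrt_nonneg _) (vecNorm_nonneg _ _))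
  rw [mul_pow, Real.sq_sqrt (by positivity), div_mul_eq_mul_div, le_div_iff₀ hp]
  exact h1

/-- Boundedness is needed for the real supremum in `dualNorm` to be meaningful; on an unbounded set
it takes the default value 0. -/
theorem IsSemipositive.bddAbove_of_topDensity_pos (h : IsSemipositive θ)
    (hpos : 0 < topDensity θ) (l : CSpace m →L[ℝ] ℝ) :
    BddAbove {s | ∃ v : CSpace m, vecNorm θ v ≤ 1 ∧ s = |l v|} := by
  obtain ⟨C, hC, hC'⟩ := h.exists_norm_le_of_topDensity_pos hpos
  refine ⟨‖l‖ * C, ?_⟩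
  rintro s ⟨v, hv, rfl⟩
  refine (l.le_opNorm v).trans (mul_le_mul_of_nonneg_left ((hC' v).trans ?_) (norm_nonneg _))
  exact mul_le_of_le_one_right hC hv

theorem IsSemipositive.abs_le_dualNorm_mul (h : IsSemipositive θ)
    (hpos : 0 < topDensity θ) (l : CSpace m →L[ℝ] ℝ) (v : CSpace m) : |l v| ≤ dualNorm θ l * vecNorm θ v := by
  by_cases hv : vecNorm θ v = 0
  · obtain ⟨C, hC, hC'⟩ := h.exists_norm_le_of_topDensity_pos hpos
    have := hC' v
    rw [hv, mul_zero] at this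
    rw [norm_le_zero_iff.1 this]
    simpa using mul_nonneg (dualNorm_nonneg θ l) (vecNorm_nonneg θ 0)
  · have hv' : 0 < vecNorm θ v := lt_of_le_of_ne (vecNorm_nonneg _ _) (Ne.symm hv)
    have h1 : |l ((vecNorm θ v)⁻¹ • v)| ≤ dualNorm θ l := by
      refine le_csSup (h.bddAbove_of_topDensity_pos hpos l) ⟨_, ?_, rfl⟩
      rw [vecNorm_smul, abs_of_pos (inv_pos.2 hv'), inv_mul_cancel₀ hv]
    rw [map_smul, smul_eq_mul, abs_mul, abs_of_pos (inv_pos.2 hv'), inv_mul_le_iff₀ hv'] at h1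
    linarith

variable (m) in
-- The squared dual norm blows up at most like the inverse of the product of the eigenvalues, which
-- the density compensates. This makes the integral of |dτ|² against the volume density finite. For
-- m = 1 the factor ‖θ‖^(m-1) disappears, and the bound does not depend on `θ` at all.
theorem exists_dualNorm_sq_mul_topDensity_le : ∃ c : ℝ, 0 < c ∧
    ∀ (θ : CSpace m [⋀^Fin 2]→L[ℝ] ℂ) (l : CSpace m →L[ℝ] ℝ), IsSemipositive θ →
      dualNorm θ l ^ 2 * topDensity θ ≤ c * ‖l‖ ^ 2 * ‖θ‖ ^ (m - 1) := by
  obtain ⟨c, hc, hc'⟩ := exists_topDensity_eq m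
  refine ⟨c, hc, fun θ l h => ?_⟩
  obtain ⟨u, μ, hd⟩ := h.isDiagonalization
  rw [hc' θ u μ hd]
  have hp0 : 0 ≤ ∏ j, μ j := Finset.prod_nonneg fun j _ => hd.nonneg j
  rcases hp0.eq_or_lt with hp | hp
  · rw [← hp, mul_zero, mul_zero]
    positivity
  · have h1 : dualNorm θ l ≤ √(‖l‖ ^ 2 * ‖θ‖ ^ (m - 1) / ∏ j, μ j) := by
      refine Real.sSup_le ?_ (Real.sqrt_nonneg _)
      rintro s ⟨v, hv, rfl⟩
      refine Real.le_sqrt_of_sq_le ?_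
      rw [le_div_iff₀ hp, sq_abs]
      have h2 := hd.norm_sq_mul_prod_le (vecNorm_sq_le_norm_mul θ) v
      have h3 : (l v) ^ 2 ≤ ‖l‖ ^ 2 * ‖v‖ ^ 2 := by
        rw [← mul_pow, ← sq_abs]
        exact pow_le_pow_left₀ (abs_nonneg _) (l.le_opNorm v) 2
      have h4 : vecNorm θ v ^ 2 ≤ 1 := pow_le_one₀ (vecNorm_nonneg _ _) hv
      calc (l v) ^ 2 * ∏ j, μ j ≤ ‖l‖ ^ 2 * ‖v‖ ^ 2 * ∏ j, μ j := by gcongr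
        _ = ‖l‖ ^ 2 * (‖v‖ ^ 2 * ∏ j, μ j) := by ring
        _ ≤ ‖l‖ ^ 2 * (‖θ‖ ^ (m - 1) * 1) := by
            refine mul_le_mul_of_nonneg_left (h2.trans ?_) (by positivity)
            exact mul_le_mul_of_nonneg_left h4 (by positivity)
        _ = _ := by ring
    have h2 : dualNorm θ l ^ 2 ≤ ‖l‖ ^ 2 * ‖θ‖ ^ (m - 1) / ∏ j, μ j := by
      rw [← Real.sq_sqrt (show 0 ≤ ‖l‖ ^ 2 * ‖θ‖ ^ (m - 1) / ∏ j, μ j by positivity)]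
      exact pow_le_pow_left₀ (dualNorm_nonneg _ _) h1 2
    rw [le_div_iff₀ hp] at h2
    nlinarith

end Density

/-! ### A common treatment of ∂ and ∂̄ -/

section HalfPart

variable {E : Type*} [NormedAddCommGroup E] [NormedSpace ℂ E] {k l : ℕ}

/-- The map `½(L - c L(i ·))`, of which `linPart` and `antilinPart` are the cases `c = i`, `-i`. -/
def halfPart (c : ℂ) (L : E →L[ℝ] (E [⋀^Fin k]→L[ℝ] ℂ)) : E →L[ℝ] (E [⋀^Fin k]→L[ℝ] ℂ) :=
  (1 / 2 : ℂ) • (L - c • L ∘L mulI E)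

theorem linPart_eq_halfPart (L : E →L[ℝ] (E [⋀^Fin k]→L[ℝ] ℂ)) :
    linPart L = halfPart Complex.I L := rfl

theorem antilinPart_eq_halfPart (L : E →L[ℝ] (E [⋀^Fin k]→L[ℝ] ℂ)) :
    antilinPart L = halfPart (-Complex.I) L := by
  ext v w
  simp [antilinPart, halfPart]
  ring

theorem halfPart_apply (c : ℂ) (L : E →L[ℝ] (E [⋀^Fin k]→L[ℝ] ℂ)) (v : E) (w : Fin k → E) :
    halfPart c L v w = 1 / 2 * (L v w - c * L (Complex.I • v) w) := rfl

theorem castDegree_apply (h : k = l) (η : E [⋀^Fin k]→L[ℝ] ℂ) (v : Fin l → E) :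
    castDegree h η v = η (v ∘ Fin.cast h) := by
  subst h
  rfl

theorem alternatizeUncurryFin_halfPart_apply (c : ℂ) (L : E →L[ℝ] (E [⋀^Fin k]→L[ℝ] ℂ))
    (v : Fin (k + 1) → E) :
    ContinuousAlternatingMap.alternatizeUncurryFin (halfPart c L) v =
      ∑ i : Fin (k + 1), (-1 : ℂ) ^ (i : ℕ) *
        (1 / 2 * (L (v i) (i.removeNth v) - c * L (Complex.I • v i) (i.removeNth v))) := by
  rw [ContinuousAlternatingMap.alternatizeUncurryFin_apply]
  refine Finset.sum_congr rfl fun i _ => ?_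
  rw [halfPart_apply, zsmul_eq_mul]
  push_cast
  rfl

theorem vecNorm_smul_I {θ : E [⋀^Fin 2]→L[ℝ] ℂ} (h : IsSemipositive θ) (v : E) :
    vecNorm θ (Complex.I • v) = vecNorm θ v := by
  rw [vecNorm, h.type_one_one, vecNorm]

end HalfPart

/-! ### Pointwise bound for the boundary integrand in Stokes' theorem -/

section TopForms

variable {m : ℕ} {θ : CSpace m [⋀^Fin 2]→L[ℝ] ℂ}

/-- For l = dτ this bounds ∂τ ∧ α or ∂̄τ ∧ α. Each of the j + 1 terms pairs `l` with one argument
and with i times it; both have the same norm, and the resulting factor 2 cancels the ½. -/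
theorem IsSemipositive.norm_halfPart_smulRight_le (h : IsSemipositive θ)
    (hpos : 0 < topDensity θ) (l : CSpace m →L[ℝ] ℝ) {j : ℕ} {α : CSpace m [⋀^Fin j]→L[ℝ] ℂ}
    {C : ℝ} (hα : ∀ v, ‖α v‖ ≤ C * ∏ i, vecNorm θ (v i)) {c : ℂ} (hc : ‖c‖ = 1)
    (v : Fin (j + 1) → CSpace m) :
    ‖ContinuousAlternatingMap.alternatizeUncurryFin (halfPart c (l.smulRight α)) v‖ ≤
      (j + 1) * C * dualNorm θ l * ∏ i, vecNorm θ (v i) := by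
  rw [alternatizeUncurryFin_halfPart_apply]
  have hterm : ∀ i : Fin (j + 1), ‖(-1 : ℂ) ^ (i : ℕ) *
      (1 / 2 * (l.smulRight α (v i) (i.removeNth v) -
        c * l.smulRight α (Complex.I • v i) (i.removeNth v)))‖ ≤
      C * dualNorm θ l * ∏ i, vecNorm θ (v i) := by
    intro i
    have e : (l.smulRight α (v i) (i.removeNth v) -
        c * l.smulRight α (Complex.I • v i) (i.removeNth v)) =
        ((l (v i) : ℂ) - c * l (Complex.I • v i)) * α (i.removeNth v) := by
      simp only [ContinuousLinearMap.smulRight_apply, ContinuousAlternatingMap.smul_apply,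
        Complex.real_smul]
      ring
    have h1 : ‖((l (v i) : ℂ) - c * l (Complex.I • v i))‖ ≤
        2 * (dualNorm θ l * vecNorm θ (v i)) := by
      refine (norm_sub_le _ _).trans ?_
      rw [norm_mul, hc, one_mul, Complex.norm_real, Complex.norm_real, Real.norm_eq_abs,
        Real.norm_eq_abs]
      have h2 := h.abs_le_dualNorm_mul hpos l (v i)
      have h3 := h.abs_le_dualNorm_mul hpos l (Complex.I • v i)
      rw [vecNorm_smul_I h] at h3
      linarith
    rw [e, norm_mul, norm_pow, norm_neg, norm_one, one_pow, one_mul, norm_mul, norm_mul,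
      Fin.prod_univ_succAbove _ i]
    have h4 := hα (i.removeNth v)
    have h5 : ‖(1 / 2 : ℂ)‖ = 1 / 2 := by norm_num
    rw [h5]
    have h6 := mul_le_mul h1 h4 (norm_nonneg _)
      (mul_nonneg zero_le_two (mul_nonneg (dualNorm_nonneg _ _) (vecNorm_nonneg _ _)))
    simp only [Fin.removeNth] at h6 ⊢
    linarith
  refine (norm_sum_le _ _).trans ((Finset.sum_le_sum fun i _ => hterm i).trans (le_of_eq ?_))
  simp
  ring

/-- At a degenerate point the dual norm gives no control, but the frame contains two vectors of norm
zero, u_p and iu_p. After one argument is removed, at least one of them is left for `α`, which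
therefore vanishes. -/
theorem IsDiagonalization.alternatizeUncurryFin_halfPart_unitaryFrame
    {u : OrthonormalBasis (Fin m) ℂ (CSpace m)} {μ : Fin m → ℝ} (h : IsDiagonalization θ u μ)
    {p : Fin m} (hp : μ p = 0) (l : CSpace m →L[ℝ] ℝ) {j : ℕ} (hj : j + 1 = 2 * m)
    {α : CSpace m [⋀^Fin j]→L[ℝ] ℂ} {C : ℝ} (hα : ∀ v, ‖α v‖ ≤ C * ∏ i, vecNorm θ (v i)) (c : ℂ) :
    ContinuousAlternatingMap.alternatizeUncurryFin (halfPart c (l.smulRight α))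
      (unitaryFrame u ∘ Fin.cast hj) = 0 := by
  rw [alternatizeUncurryFin_halfPart_apply]
  refine Finset.sum_eq_zero fun i _ => ?_
  have hp2 := p.2
  obtain ⟨i', hi', hz⟩ : ∃ i' : Fin (j + 1), i' ≠ i ∧
      vecNorm θ ((unitaryFrame u ∘ Fin.cast hj) i') = 0 := by
    have hz : ∀ i' : Fin (j + 1), (i' : ℕ) / 2 = p →
        vecNorm θ ((unitaryFrame u ∘ Fin.cast hj) i') = 0 := by
      intro i' hi'
      rw [Function.comp_apply, h.vecNorm_frame]
      have : (⟨((Fin.cast hj i' : Fin (2 * m)) : ℕ) / 2, by omega⟩ : Fin m) = p := Fin.ext hi'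
      rw [this, hp, Real.sqrt_zero]
    by_cases hi : (i : ℕ) = 2 * p
    · exact ⟨⟨2 * p + 1, by omega⟩, by simp [Fin.ext_iff, hi], hz _ (by simp; omega)⟩
    · exact ⟨⟨2 * p, by omega⟩, by simp [Fin.ext_iff, Ne.symm hi], hz _ (by simp)⟩
  obtain ⟨k, hk⟩ := Fin.exists_succAbove_eq hi'
  have h0 : α (i.removeNth (unitaryFrame u ∘ Fin.cast hj)) = 0 := by
    refine norm_le_zero_iff.1 ((hα _).trans (le_of_eq ?_))
    rw [Finset.prod_eq_zero (Finset.mem_univ k), mul_zero]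
    rw [Fin.removeNth, hk, hz]
  simp [h0]

variable (m) in
-- Where `θ` is non-degenerate, the dual-norm estimate is combined with the bound of a top form by
-- the density. Where it degenerates, the left side is zero.
theorem exists_norm_alternatizeUncurryFin_stdFrame_le : ∃ K₁ : ℝ, 0 < K₁ ∧
    ∀ (θ : CSpace m [⋀^Fin 2]→L[ℝ] ℂ) (l : CSpace m →L[ℝ] ℝ) (j : ℕ) (hj : j + 1 = 2 * m)
      (α : CSpace m [⋀^Fin j]→L[ℝ] ℂ) (C : ℝ) (c : ℂ), IsSemipositive θ → 0 ≤ C → ‖c‖ = 1 →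
      (∀ v, ‖α v‖ ≤ C * ∏ i, vecNorm θ (v i)) →
      ‖ContinuousAlternatingMap.alternatizeUncurryFin (halfPart c (l.smulRight α))
        (stdFrame m ∘ Fin.cast hj)‖ ≤ K₁ * C * (dualNorm θ l * topDensity θ) := by
  obtain ⟨K₀, hK₀, hK₀'⟩ := exists_norm_apply_stdFrame_le m
  refine ⟨K₀ * (2 * m + 1), by positivity, fun θ l j hj α C c h hC hc hα => ?_⟩
  set ψ := ContinuousAlternatingMap.alternatizeUncurryFin (halfPart c (l.smulRight α)) with hψ
  have hd := h.topDensity_nonneg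
  have hn := dualNorm_nonneg θ l
  rcases hd.eq_or_lt with h0 | hpos
  · obtain ⟨u, μ, hdi⟩ := h.isDiagonalization
    obtain ⟨c', hc', hc''⟩ := exists_topDensity_eq m
    rw [hc'' θ u μ hdi, eq_comm, mul_eq_zero, Finset.prod_eq_zero_iff] at h0
    obtain ⟨p, -, hp⟩ := h0.resolve_left hc'.ne'
    have h1 : ψ (stdFrame m ∘ Fin.cast hj) = 0 := by
      rw [← castDegree_apply hj ψ, ← apply_unitaryFrame _ u, castDegree_apply]
      exact hdi.alternatizeUncurryFin_halfPart_unitaryFrame hp l hj hα c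
    rw [h1, norm_zero]
    positivity
  · have h1 := hK₀' θ (castDegree hj ψ) ((j + 1) * C * dualNorm θ l) h (by
      intro v
      rw [castDegree_apply]
      refine (h.norm_halfPart_smulRight_le hpos l hα hc _).trans (le_of_eq ?_)
      congr 1
      exact Fintype.prod_equiv (finCongr hj) _ _ fun i => rfl)
    rw [castDegree_apply] at h1
    refine h1.trans ?_
    have hj' : (j : ℝ) + 1 ≤ 2 * m + 1 := by
      have : ((j + 1 : ℕ) : ℝ) = ((2 * m : ℕ) : ℝ) := by rw [hj]
      push_cast at this
      linarith
    calc K₀ * ((j + 1) * C * dualNorm θ l) * topDensity θ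
        = (K₀ * C * (dualNorm θ l * topDensity θ)) * (j + 1) := by ring
      _ ≤ (K₀ * C * (dualNorm θ l * topDensity θ)) * (2 * m + 1) := by gcongr
      _ = _ := by ring

end TopForms

/-! ### Measurability of the dual norm -/

section Measurability

open MeasureTheory Set

variable {m : ℕ} {θ : CSpace m → CSpace m [⋀^Fin 2]→L[ℝ] ℂ} {U : Set (CSpace m)}

theorem continuous_vecNorm_left (v : CSpace m) :
    Continuous fun θ : CSpace m [⋀^Fin 2]→L[ℝ] ℂ => vecNorm θ v := by
  unfold vecNorm
  refine Real.continuous_sqrt.comp (Complex.continuous_re.comp ?_)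
  exact (ContinuousAlternatingMap.apply ℝ (CSpace m) ℂ ![v, Complex.I • v]).continuous

open Classical in
-- On the non-degenerate set the dual norm is lower semicontinuous: the set where it exceeds `a` is
-- the union over `v` of the open conditions vecNorm < 1 and |l v| > a.
theorem measurable_indicator_dualNorm (hU : IsOpen U) (hθ : ContinuousOn θ U)
    (hs : ∀ z ∈ U, IsSemipositive (θ z)) (hd : ContinuousOn (fun z => topDensity (θ z)) U)
    {l : CSpace m → CSpace m →L[ℝ] ℝ} (hl : Continuous l) :
    Measurable ({z | z ∈ U ∧ 0 < topDensity (θ z)}.indicator fun z => dualNorm (θ z) (l z)) := by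
  refine measurable_of_Ioi fun a => ?_
  by_cases ha : a < 0
  · convert MeasurableSet.univ
    ext z
    simp only [mem_preimage, mem_Ioi, mem_univ, iff_true]
    exact ha.trans_le (indicator_nonneg (fun z _ => dualNorm_nonneg _ _) z)
  push Not at ha
  have heq : ({z | z ∈ U ∧ 0 < topDensity (θ z)}.indicator fun z => dualNorm (θ z) (l z)) ⁻¹'
      Ioi a = ⋃ v : CSpace m, {z | z ∈ U ∧ 0 < topDensity (θ z) ∧ vecNorm (θ z) v < 1 ∧
        a < |l z v|} := by
    ext z
    simp only [mem_preimage, mem_Ioi, mem_iUnion, mem_ofPred_eq]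
    constructor
    · intro h
      by_cases hz : z ∈ U ∧ 0 < topDensity (θ z)
      · rw [indicator_of_mem (show z ∈ {z | z ∈ U ∧ 0 < topDensity (θ z)} from hz)] at h
        have hne : {s | ∃ v : CSpace m, vecNorm (θ z) v ≤ 1 ∧ s = |l z v|}.Nonempty := by
          refine ⟨_, 0, ?_, rfl⟩
          have := vecNorm_smul (θ z) 0 0
          rw [zero_smul, abs_zero, zero_mul] at this
          rw [this]
          exact zero_le_one
        obtain ⟨s, ⟨v, hv, rfl⟩, has⟩ := exists_lt_of_lt_csSup hne h
        have hpos : 0 < |l z v| := ha.trans_lt has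
        -- Scaling `v` by s slightly below 1 makes the constraint vecNorm ≤ 1 strict and keeps |l v|
        -- above `a`.
        obtain ⟨s, hs1, hs2⟩ := exists_between ((div_lt_one hpos).2 has)
        have hs0 : 0 ≤ s := (div_nonneg ha hpos.le).trans hs1.le
        refine ⟨s • v, hz.1, hz.2, ?_, ?_⟩
        · rw [vecNorm_smul, abs_of_nonneg hs0]
          exact (mul_le_of_le_one_right hs0 hv).trans_lt hs2
        · rw [map_smul, smul_eq_mul, abs_mul, abs_of_nonneg hs0]
          exact (div_lt_iff₀ hpos).1 hs1
      · rw [indicator_of_notMem (show z ∉ {z | z ∈ U ∧ 0 < topDensity (θ z)} from hz)] at h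
        exact absurd h (not_lt.2 ha)
    · rintro ⟨v, hz, hpos, hv, hav⟩
      rw [indicator_of_mem (show z ∈ {z | z ∈ U ∧ 0 < topDensity (θ z)} from ⟨hz, hpos⟩)]
      exact hav.trans_le (le_csSup ((hs z hz).bddAbove_of_topDensity_pos hpos _) ⟨v, hv.le, rfl⟩)
  rw [heq]
  refine (isOpen_iUnion fun v => isOpen_iff_mem_nhds.2 ?_).measurableSet
  rintro z ⟨hz, hpos, hv, hav⟩
  have hUz := hU.mem_nhds hz
  filter_upwards [hUz, (hd.continuousAt hUz).eventually (lt_mem_nhds hpos),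
    ((continuous_vecNorm_left v).continuousAt.comp (hθ.continuousAt hUz)).eventually
      (gt_mem_nhds hv),
    ((hl.clm_apply continuous_const).abs.continuousAt (x := z)).eventually
      (lt_mem_nhds hav)] with y h1 h2 h3 h4
  exact ⟨h1, h2, h3, h4⟩

end Measurability

/-! ### Stokes' theorem and the isoperimetric inequality on balls of ℂ^m -/

section Isoperimetric

open MeasureTheory Set Metric

variable {m : ℕ}

theorem finrank_real_cspace (m : ℕ) : Module.finrank ℝ (CSpace m) = 2 * m := by
  rw [← Module.finrank_mul_finrank ℝ ℂ (CSpace m)]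
  simp

theorem sphereIntegral_eq_sphereMean (t : ℝ) (h : CSpace m → ℝ) :
    sphereIntegral t h = sphereMean volume h t := by
  rw [sphereIntegral, sphereMean, finrank_real_cspace]

theorem contDiff_cspace_norm_sq : ContDiff ℝ ∞ (fun x : CSpace m => ‖x‖ ^ 2) :=
  contDiff_norm_sq ℂ

theorem integrable_sphere_of_continuousOn {f : CSpace m → ℝ} {t : ℝ} (ht : 0 ≤ t)
    (hf : ContinuousOn f (sphere 0 t)) :
    Integrable (fun u : sphere (0 : CSpace m) 1 => f (t • (u : CSpace m)))
      (volume : Measure (CSpace m)).toSphere := by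
  refine Continuous.integrable_of_hasCompactSupport ?_ (HasCompactSupport.of_compactSpace _)
  refine hf.comp_continuous (by fun_prop) fun u => ?_
  simp [norm_smul, abs_of_nonneg ht]

/-- Stokes' theorem on a ball for `∂α` and `∂̄α`. -/
theorem setIntegral_ball_halfPart_fderiv [Nontrivial (CSpace m)] {j : ℕ}
    {α : CSpace m → CSpace m [⋀^Fin j]→L[ℝ] ℂ} {R : ℝ} (hα : ContDiffOn ℝ 1 α (ball 0 R))
    (c : ℂ) (F : Fin (j + 1) → CSpace m) {t : ℝ} (ht : 0 < t) (htR : t < R) :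
    IntegrableOn (fun z => (ContinuousAlternatingMap.alternatizeUncurryFin
      (halfPart c (fderiv ℝ α z)) F).re) (ball 0 t) ∧
    ∫ z in ball 0 t, (ContinuousAlternatingMap.alternatizeUncurryFin
        (halfPart c (fderiv ℝ α z)) F).re =
      sphereMean volume (fun z => (ContinuousAlternatingMap.alternatizeUncurryFin
        (halfPart c ((fderiv ℝ (fun x : CSpace m => ‖x‖ ^ 2) z).smulRight (α z))) F).re /
          (2 * ‖z‖)) t := by
  -- Each summand of the alternation is a derivative of a scalar function `Λ a w ∘ α` in one of the
  -- constant directions `F i` or `i F i`, so the divergence theorem applies term by term.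
  set Λ : ℂ → (Fin j → CSpace m) → (CSpace m [⋀^Fin j]→L[ℝ] ℂ) →L[ℝ] ℝ := fun a w =>
    Complex.reCLM ∘L (a • ContinuousAlternatingMap.apply ℝ (CSpace m) ℂ w) with hΛ
  have hΛa : ∀ a w η, Λ a w η = (a * η w).re := fun a w η => rfl
  set a : Fin (j + 1) → ℂ := fun i => (-1) ^ (i : ℕ) * (1 / 2) with ha
  set τ' : CSpace m → CSpace m →L[ℝ] ℝ := fderiv ℝ (fun x : CSpace m => ‖x‖ ^ 2) with hτ'
  have hτc : Continuous τ' := contDiff_cspace_norm_sq.continuous_fderiv (by simp)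
  have hY : ∀ a w, ContDiffOn ℝ 1 (fun z => Λ a w (α z)) (ball 0 R) := fun a w =>
    (Λ a w).contDiff.comp_contDiffOn hα
  have hYd : ∀ a w b z, z ∈ ball (0 : CSpace m) R →
      fderiv ℝ (fun z => Λ a w (α z)) z b = (a * fderiv ℝ α z b w).re := by
    intro a w b z hz
    have h1 : DifferentiableAt ℝ α z :=
      (hα.contDiffAt (isOpen_ball.mem_nhds hz)).differentiableAt (by simp)
    have h2 := ((Λ a w).hasFDerivAt.comp z h1.hasFDerivAt).fderiv
    have h3 : fderiv ℝ (fun z => Λ a w (α z)) z = Λ a w ∘L fderiv ℝ α z := h2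
    rw [h3]
    rfl
  have hdiv : ∀ a w b, ∫ z in ball 0 t, fderiv ℝ (fun z => Λ a w (α z)) z b =
      sphereMean volume (fun z => τ' z b / (2 * ‖z‖) * Λ a w (α z)) t := fun a w b =>
    setIntegral_ball_fderiv volume contDiff_cspace_norm_sq (hY a w) b ht htR
  have hint : ∀ a w b, IntegrableOn (fun z => fderiv ℝ (fun z => Λ a w (α z)) z b) (ball 0 t) := by
    intro a w b
    have h1 : ContinuousOn (fun z => fderiv ℝ (fun z => Λ a w (α z)) z b) (ball 0 R) :=
      ((hY a w).continuousOn_fderiv_of_isOpen isOpen_ball le_rfl).clm_apply continuousOn_const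
    exact ((h1.mono (closedBall_subset_ball htR)).integrableOn_compact
      (isCompact_closedBall 0 t)).mono_set ball_subset_closedBall
  have hsint : ∀ a w b, Integrable (fun u : sphere (0 : CSpace m) 1 =>
      τ' (t • (u : CSpace m)) b / (2 * ‖t • (u : CSpace m)‖) * Λ a w (α (t • (u : CSpace m))))
      (volume : Measure (CSpace m)).toSphere := by
    intro a w b
    refine integrable_sphere_of_continuousOn ht.le
      (f := fun z => τ' z b / (2 * ‖z‖) * Λ a w (α z)) ?_
    refine ContinuousOn.mul (ContinuousOn.div (by fun_prop) (by fun_prop) ?_)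
      ((hY a w).continuousOn.mono ?_)
    · intro z hz
      rw [mem_sphere_zero_iff_norm] at hz
      rw [hz]
      positivity
    · exact sphere_subset_closedBall.trans (closedBall_subset_ball htR)
  have hL : ∀ z ∈ ball (0 : CSpace m) t, (ContinuousAlternatingMap.alternatizeUncurryFin
      (halfPart c (fderiv ℝ α z)) F).re = ∑ i, (fderiv ℝ (fun z => Λ (a i) (i.removeNth F) (α z)) z
        (F i) + fderiv ℝ (fun z => Λ (-(a i * c)) (i.removeNth F) (α z)) z (Complex.I • F i)) := by
    intro z hz
    have hz' := ball_subset_ball htR.le hz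
    rw [alternatizeUncurryFin_halfPart_apply, Complex.re_sum]
    refine Finset.sum_congr rfl fun i _ => ?_
    rw [hYd _ _ _ _ hz', hYd _ _ _ _ hz', ← Complex.add_re]
    congr 1
    simp only [ha]
    ring
  have hR : ∀ z : CSpace m, (ContinuousAlternatingMap.alternatizeUncurryFin
      (halfPart c ((τ' z).smulRight (α z))) F).re / (2 * ‖z‖) =
      ∑ i, (τ' z (F i) / (2 * ‖z‖) * Λ (a i) (i.removeNth F) (α z) +
        τ' z (Complex.I • F i) / (2 * ‖z‖) * Λ (-(a i * c)) (i.removeNth F) (α z)) := by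
    intro z
    rw [alternatizeUncurryFin_halfPart_apply, Complex.re_sum, Finset.sum_div]
    refine Finset.sum_congr rfl fun i _ => ?_
    have e : (-1 : ℂ) ^ (i : ℕ) * (1 / 2 * ((τ' z).smulRight (α z) (F i) (i.removeNth F) -
        c * (τ' z).smulRight (α z) (Complex.I • F i) (i.removeNth F))) =
        (τ' z (F i) : ℂ) * (a i * α z (i.removeNth F)) +
          (τ' z (Complex.I • F i) : ℂ) * (-(a i * c) * α z (i.removeNth F)) := by
      simp only [ha, ContinuousLinearMap.smulRight_apply, ContinuousAlternatingMap.smul_apply,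
        Complex.real_smul]
      ring
    rw [hΛa, hΛa, e, Complex.add_re, Complex.re_ofReal_mul, Complex.re_ofReal_mul]
    ring
  have hint2 : ∀ a w b a' w' b', IntegrableOn (fun z => fderiv ℝ (fun z => Λ a w (α z)) z b +
      fderiv ℝ (fun z => Λ a' w' (α z)) z b') (ball 0 t) := fun a w b a' w' b' =>
    (hint a w b).add (hint a' w' b')
  have hsint2 : ∀ a w b a' w' b', Integrable (fun u : sphere (0 : CSpace m) 1 =>
      τ' (t • (u : CSpace m)) b / (2 * ‖t • (u : CSpace m)‖) * Λ a w (α (t • (u : CSpace m))) +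
      τ' (t • (u : CSpace m)) b' / (2 * ‖t • (u : CSpace m)‖) * Λ a' w' (α (t • (u : CSpace m))))
      (volume : Measure (CSpace m)).toSphere := fun a w b a' w' b' =>
    (hsint a w b).add (hsint a' w' b')
  constructor
  · refine IntegrableOn.congr_fun ?_ (fun z hz => (hL z hz).symm) measurableSet_ball
    exact integrable_finsetSum _ fun i _ => hint2 _ _ _ _ _ _
  rw [setIntegral_congr_fun measurableSet_ball hL,
    integral_finsetSum _ fun i _ => hint2 _ _ _ _ _ _]
  simp only [hR]
  rw [sphereMean, integral_finsetSum _ fun i _ => hsint2 _ _ _ _ _ _, Finset.mul_sum]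
  refine Finset.sum_congr rfl fun i _ => ?_
  rw [integral_add (hint _ _ _) (hint _ _ _), integral_add (hsint _ _ _) (hsint _ _ _), hdiv, hdiv,
    sphereMean, sphereMean, mul_add]

theorem continuous_wedgePow {E : Type*} [NormedAddCommGroup E] [NormedSpace ℂ E] (p : ℕ) :
    Continuous fun θ : E [⋀^Fin 2]→L[ℝ] ℂ => wedgePow θ p := by
  induction p with
  | zero => exact continuous_const
  | succ p ih =>
    have : (fun θ : E [⋀^Fin 2]→L[ℝ] ℂ => wedgePow θ (p + 1)) =
        fun θ => wedgeCLM E (2 * p) 2 (wedgePow θ p) θ := by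
      funext θ
      rw [wedgePow_succ]
      rfl
    rw [this]
    exact ((wedgeCLM E (2 * p) 2).continuous.comp ih).clm_apply continuous_id

theorem continuous_topDensity : Continuous (topDensity (m := m)) := by
  unfold topDensity
  have h : Continuous fun θ : CSpace m [⋀^Fin 2]→L[ℝ] ℂ => wedgePow θ m (stdFrame m) :=
    (ContinuousAlternatingMap.apply ℝ (CSpace m) ℂ (stdFrame m)).continuous.comp
      (continuous_wedgePow m)
  have h2 := h.const_smul ((m.factorial : ℝ)⁻¹)
  exact Complex.continuous_re.comp h2

/-- The quadratic polynomial s ↦ ∫ (f - s)² g is nonnegative, so its discriminant is not positive.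
-/
theorem integral_mul_sq_le {Ω : Type*} [MeasurableSpace Ω] {σ : Measure Ω} {f g : Ω → ℝ}
    (hg0 : ∀ x, 0 ≤ g x) (hg : Integrable g σ) (hfg : Integrable (fun x => f x * g x) σ)
    (hffg : Integrable (fun x => f x ^ 2 * g x) σ) :
    (∫ x, f x * g x ∂σ) ^ 2 ≤ (∫ x, f x ^ 2 * g x ∂σ) * ∫ x, g x ∂σ := by
  have h : ∀ s : ℝ, 0 ≤ (∫ x, g x ∂σ) * (s * s) + (-2 * ∫ x, f x * g x ∂σ) * s +
      ∫ x, f x ^ 2 * g x ∂σ := by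
    intro s
    have h1 : 0 ≤ ∫ x, (f x - s) ^ 2 * g x ∂σ :=
      integral_nonneg fun x => mul_nonneg (sq_nonneg _) (hg0 x)
    have h2 : ∀ x, (f x - s) ^ 2 * g x = (f x ^ 2 * g x + (-2 * s) * (f x * g x)) +
        (s * s) * g x := fun x => by ring
    simp only [h2] at h1
    have h3 : Integrable (fun x => f x ^ 2 * g x + (-2 * s) * (f x * g x)) σ :=
      hffg.add (hfg.const_mul _)
    rw [integral_add h3 (hg.const_mul _),
      integral_add hffg (hfg.const_mul _), integral_const_mul, integral_const_mul] at h1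
    linarith
  have := discrim_le_zero h
  unfold discrim at this
  nlinarith

theorem integrable_sphere_dtauNorm {θ : CSpace m → CSpace m [⋀^Fin 2]→L[ℝ] ℂ} {R : ℝ}
    (hθ : ContinuousOn θ (ball 0 R)) (hs : ∀ z ∈ ball 0 R, IsSemipositive (θ z)) {t : ℝ}
    (ht : 0 < t) (htR : t < R) :
    Integrable (fun u : sphere (0 : CSpace m) 1 =>
      dtauNorm θ (t • (u : CSpace m)) * volDensity θ (t • (u : CSpace m)))
      (volume : Measure (CSpace m)).toSphere ∧
    Integrable (fun u : sphere (0 : CSpace m) 1 =>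
      dtauNorm θ (t • (u : CSpace m)) ^ 2 * volDensity θ (t • (u : CSpace m)))
      (volume : Measure (CSpace m)).toSphere := by
  set τ' : CSpace m → CSpace m →L[ℝ] ℝ := fderiv ℝ (fun x : CSpace m => ‖x‖ ^ 2) with hτ'
  have hτc : Continuous τ' := contDiff_cspace_norm_sq.continuous_fderiv (by simp)
  have hvc : ContinuousOn (fun z => topDensity (θ z)) (ball 0 R) :=
    continuous_topDensity.comp_continuousOn hθ
  have hmeas := measurable_indicator_dualNorm isOpen_ball hθ hs hvc hτc
  set D := {z | z ∈ ball 0 R ∧ 0 < topDensity (θ z)}.indicator fun z => dualNorm (θ z) (τ' z)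
    with hD
  have hsub : sphere (0 : CSpace m) t ⊆ ball 0 R :=
    sphere_subset_closedBall.trans (closedBall_subset_ball htR)
  have hmem : ∀ u : sphere (0 : CSpace m) 1, t • (u : CSpace m) ∈ sphere (0 : CSpace m) t := by
    intro u
    simp [norm_smul, abs_of_pos ht]
  -- At degenerate points the density vanishes, so the dual norm may be replaced there by 0, which
  -- gives the measurable function `D`.
  have hDeq : ∀ u : sphere (0 : CSpace m) 1, ∀ k : ℕ, k ≠ 0 →
      dtauNorm θ (t • (u : CSpace m)) ^ k * volDensity θ (t • (u : CSpace m)) =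
      D (t • (u : CSpace m)) ^ k * volDensity θ (t • (u : CSpace m)) := by
    intro u k hk
    rcases ((hs _ (hsub (hmem u))).topDensity_nonneg).eq_or_lt with h0 | hpos
    · rw [volDensity_eq, ← h0, mul_zero, mul_zero]
    · rw [hD, indicator_of_mem
        (show t • (u : CSpace m) ∈ {z | z ∈ ball 0 R ∧ 0 < topDensity (θ z)} from
          ⟨hsub (hmem u), hpos⟩), dtauNorm_eq]
  have hDm : Measurable fun u : sphere (0 : CSpace m) 1 => D (t • (u : CSpace m)) :=
    hmeas.comp (by fun_prop)
  have hvi := integrable_sphere_of_continuousOn ht.le (hvc.mono hsub)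
  have hvm : AEStronglyMeasurable (fun u : sphere (0 : CSpace m) 1 =>
      volDensity θ (t • (u : CSpace m))) (volume : Measure (CSpace m)).toSphere :=
    hvi.aestronglyMeasurable
  obtain ⟨c, hc, hc'⟩ := exists_dualNorm_sq_mul_topDensity_le m
  have h2 : Integrable (fun u : sphere (0 : CSpace m) 1 =>
      dtauNorm θ (t • (u : CSpace m)) ^ 2 * volDensity θ (t • (u : CSpace m)))
      (volume : Measure (CSpace m)).toSphere := by
    have hb := integrable_sphere_of_continuousOn ht.le
      (f := fun z => c * ‖τ' z‖ ^ 2 * ‖θ z‖ ^ (m - 1))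
      (((hτc.norm.pow 2).const_mul c).continuousOn.mul (((hθ.mono hsub).norm).pow _))
    refine hb.mono' ?_ (.of_forall fun u => ?_)
    · simp only [fun u => hDeq u 2 two_ne_zero]
      exact (hDm.pow_const 2).aestronglyMeasurable.mul hvm
    · have h3 := hs _ (hsub (hmem u))
      rw [volDensity_eq, Real.norm_of_nonneg (mul_nonneg (sq_nonneg _) h3.topDensity_nonneg)]
      exact hc' _ _ h3
  refine ⟨?_, h2⟩
  -- The first power is dominated by means of |dτ| ≤ |dτ|² + 1.
  refine (h2.add hvi).mono' ?_ (.of_forall fun u => ?_)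
  · have : ∀ u : sphere (0 : CSpace m) 1,
        dtauNorm θ (t • (u : CSpace m)) * volDensity θ (t • (u : CSpace m)) =
        D (t • (u : CSpace m)) * volDensity θ (t • (u : CSpace m)) := by
      intro u
      simpa using hDeq u 1 one_ne_zero
    simp only [this]
    exact hDm.aestronglyMeasurable.mul hvm
  · have h3 := (hs _ (hsub (hmem u))).topDensity_nonneg
    have h4 := dualNorm_nonneg (θ (t • (u : CSpace m))) (τ' (t • (u : CSpace m)))
    rw [dtauNorm_eq, volDensity_eq, Real.norm_of_nonneg (mul_nonneg h4 h3)]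
    simp only [Pi.add_apply, dtauNorm_eq, volDensity_eq]
    nlinarith [sq_nonneg (dualNorm (θ (t • (u : CSpace m))) (τ' (t • (u : CSpace m))) - 1)]

/-- Stokes' theorem and the pointwise boundary estimate bound the volume by a multiple of the area.
Cauchy–Schwarz with weight `volDensity` then splits the squared area into ∫ |dτ| dσ and the
spherical integral of the density, which is the radial derivative of the volume. The constant
depends only on `C` and `m`. -/
theorem exists_isoperimetric [Nontrivial (CSpace m)] {C : ℝ} (hC : 0 ≤ C) : ∃ K : ℝ, 0 < K ∧
    ∀ (θ : CSpace m → CSpace m [⋀^Fin 2]→L[ℝ] ℂ) (j : ℕ) (hj : j + 1 = 2 * m)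
      (α β : CSpace m → CSpace m [⋀^Fin j]→L[ℝ] ℂ) (R : ℝ),
      ContinuousOn θ (ball 0 R) → (∀ z ∈ ball 0 R, IsSemipositive (θ z)) →
      ContDiffOn ℝ 1 α (ball 0 R) → ContDiffOn ℝ 1 β (ball 0 R) →
      (∀ z ∈ ball 0 R, ∀ v, ‖α z v‖ ≤ C * ∏ i, vecNorm (θ z) (v i)) →
      (∀ z ∈ ball 0 R, ∀ v, ‖β z v‖ ≤ C * ∏ i, vecNorm (θ z) (v i)) →
      (∀ z ∈ ball 0 R, powForm θ m z = castDegree hj (delForm α z + delbarForm β z)) →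
      ∀ t, 0 < t → t < R → ballVolume θ t ^ 2 ≤
        K * sphereIntegral t (fun z => dtauNorm θ z * areaDensity θ z) *
          (sphereIntegral t (volDensity θ) / t) := by
  obtain ⟨K₁, hK₁, hK₁'⟩ := exists_norm_alternatizeUncurryFin_stdFrame_le m
  set B : ℝ := (m.factorial : ℝ)⁻¹ * (2 * (K₁ * C)) with hB
  have hB0 : 0 ≤ B := by positivity
  -- The summand 1 keeps the constant positive when `C = 0`. The factor ½ remains because the
  -- squared area carries 1/(2t)², whereas the two factors on the right carry 1/(2t) and 1/t.
  refine ⟨(B ^ 2 + 1) / 2, by positivity, ?_⟩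
  intro θ j hj α β R hθ hs hα hβ hαb hβb hψ t ht htR
  set F := stdFrame m ∘ Fin.cast hj with hF
  set τ' : CSpace m → CSpace m →L[ℝ] ℝ := fderiv ℝ (fun x : CSpace m => ‖x‖ ^ 2) with hτ'
  have hsub : sphere (0 : CSpace m) t ⊆ ball 0 R :=
    sphere_subset_closedBall.trans (closedBall_subset_ball htR)
  have hmem : ∀ u : sphere (0 : CSpace m) 1, t • (u : CSpace m) ∈ ball (0 : CSpace m) R := by
    intro u
    refine hsub ?_
    simp [norm_smul, abs_of_pos ht]
  have hnorm : ∀ u : sphere (0 : CSpace m) 1, ‖t • (u : CSpace m)‖ = t := by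
    intro u
    simp [norm_smul, abs_of_pos ht]
  obtain ⟨hi1, hi2⟩ := integrable_sphere_dtauNorm hθ hs ht htR
  have hvi := integrable_sphere_of_continuousOn ht.le
    ((continuous_topDensity.comp_continuousOn hθ).mono hsub)
  obtain ⟨hαi, hαS⟩ := setIntegral_ball_halfPart_fderiv hα Complex.I F ht htR
  obtain ⟨hβi, hβS⟩ := setIntegral_ball_halfPart_fderiv hβ (-Complex.I) F ht htR
  have hvol : ∀ z ∈ ball (0 : CSpace m) t, volDensity θ z = (m.factorial : ℝ)⁻¹ *
      ((ContinuousAlternatingMap.alternatizeUncurryFin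
        (halfPart Complex.I (fderiv ℝ α z)) F).re +
      (ContinuousAlternatingMap.alternatizeUncurryFin
        (halfPart (-Complex.I) (fderiv ℝ β z)) F).re) := by
    intro z hz
    rw [volDensity, hψ z (ball_subset_ball htR.le hz), delForm_vectorSpace, delbarForm_vectorSpace,
      castDegree_apply, linPart_eq_halfPart, antilinPart_eq_halfPart, Complex.smul_re,
      ContinuousAlternatingMap.add_apply, Complex.add_re, smul_eq_mul]
  have hbound : ∀ (γ : CSpace m → CSpace m [⋀^Fin j]→L[ℝ] ℂ) (c : ℂ), ‖c‖ = 1 →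
      (∀ z ∈ ball 0 R, ∀ v, ‖γ z v‖ ≤ C * ∏ i, vecNorm (θ z) (v i)) →
      sphereMean volume (fun z => (ContinuousAlternatingMap.alternatizeUncurryFin
        (halfPart c ((τ' z).smulRight (γ z))) F).re / (2 * ‖z‖)) t ≤
      K₁ * C * sphereIntegral t (areaDensity θ) := by
    intro γ c hc hγ
    rw [sphereIntegral_eq_sphereMean, sphereMean, sphereMean, mul_left_comm]
    refine mul_le_mul_of_nonneg_left ?_ (pow_nonneg ht.le _)
    rw [← integral_const_mul]
    have hpt : ∀ u : sphere (0 : CSpace m) 1,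
        (ContinuousAlternatingMap.alternatizeUncurryFin
          (halfPart c ((τ' (t • (u : CSpace m))).smulRight (γ (t • (u : CSpace m))))) F).re /
          (2 * ‖t • (u : CSpace m)‖) ≤ K₁ * C * areaDensity θ (t • (u : CSpace m)) := by
      intro u
      have h1 := hK₁' (θ (t • (u : CSpace m))) (τ' (t • (u : CSpace m))) j hj
        (γ (t • (u : CSpace m))) C c (hs _ (hmem u)) hC hc (hγ _ (hmem u))
      rw [areaDensity, hnorm, dtauNorm_eq, volDensity_eq, mul_div_assoc']
      gcongr
      exact (Complex.re_le_norm _).trans h1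
    -- Integrability of the boundary integrand need not be known: otherwise its integral is 0 by
    -- convention, and the right side is nonnegative.
    by_cases hint : Integrable (fun u : sphere (0 : CSpace m) 1 =>
        (ContinuousAlternatingMap.alternatizeUncurryFin
          (halfPart c ((τ' (t • (u : CSpace m))).smulRight (γ (t • (u : CSpace m))))) F).re /
          (2 * ‖t • (u : CSpace m)‖)) (volume : Measure (CSpace m)).toSphere
    · refine integral_mono hint ?_ hpt
      refine Integrable.const_mul ?_ _
      have := hi1.div_const (2 * t)
      refine this.congr (.of_forall fun u => ?_)
      simp only [areaDensity, hnorm]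
    · rw [integral_undef hint]
      refine integral_nonneg fun u => ?_
      have h3 := (hs _ (hmem u)).topDensity_nonneg
      have h4 := dualNorm_nonneg (θ (t • (u : CSpace m))) (τ' (t • (u : CSpace m)))
      simp only [areaDensity, dtauNorm_eq, volDensity_eq, Pi.zero_apply]
      positivity
  have hW : ballVolume θ t ≤ B * sphereIntegral t (areaDensity θ) := by
    rw [ballVolume, setIntegral_congr_fun measurableSet_ball hvol, integral_const_mul,
      integral_add hαi hβi, hαS, hβS, hB]
    have h1 := hbound α Complex.I (by simp) hαb
    have h2 := hbound β (-Complex.I) (by simp) hβb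
    rw [mul_assoc]
    refine mul_le_mul_of_nonneg_left ?_ (by positivity)
    linarith
  have hW0 : 0 ≤ ballVolume θ t := by
    refine setIntegral_nonneg measurableSet_ball fun z hz => ?_
    exact (hs z (ball_subset_ball htR.le hz)).topDensity_nonneg
  have hCS := integral_mul_sq_le (σ := (volume : Measure (CSpace m)).toSphere)
    (f := fun u : sphere (0 : CSpace m) 1 => dtauNorm θ (t • (u : CSpace m)))
    (g := fun u : sphere (0 : CSpace m) 1 => volDensity θ (t • (u : CSpace m)))
    (fun u => (hs _ (hmem u)).topDensity_nonneg) hvi hi1 hi2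
  set P := ∫ u : sphere (0 : CSpace m) 1, dtauNorm θ (t • (u : CSpace m)) ^ 2 *
    volDensity θ (t • (u : CSpace m)) ∂(volume : Measure (CSpace m)).toSphere with hP
  set Q := ∫ u : sphere (0 : CSpace m) 1, volDensity θ (t • (u : CSpace m))
    ∂(volume : Measure (CSpace m)).toSphere with hQ
  set A := ∫ u : sphere (0 : CSpace m) 1, dtauNorm θ (t • (u : CSpace m)) *
    volDensity θ (t • (u : CSpace m)) ∂(volume : Measure (CSpace m)).toSphere with hA
  have hP0 : 0 ≤ P := integral_nonneg fun u =>
    mul_nonneg (sq_nonneg _) (hs _ (hmem u)).topDensity_nonneg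
  have hQ0 : 0 ≤ Q := integral_nonneg fun u => (hs _ (hmem u)).topDensity_nonneg
  have eA : sphereIntegral t (areaDensity θ) = t ^ (2 * m - 1) * (A / (2 * t)) := by
    rw [sphereIntegral, hA, ← integral_div]
    simp only [areaDensity, hnorm]
  have eP : sphereIntegral t (fun z => dtauNorm θ z * areaDensity θ z) =
      t ^ (2 * m - 1) * (P / (2 * t)) := by
    rw [sphereIntegral, hP, ← integral_div]
    simp only [areaDensity, hnorm]
    congr 2
    ext u
    ring
  have eQ : sphereIntegral t (volDensity θ) = t ^ (2 * m - 1) * Q := rfl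
  calc ballVolume θ t ^ 2 ≤ (B * sphereIntegral t (areaDensity θ)) ^ 2 := by gcongr
    _ = B ^ 2 * (t ^ (2 * m - 1) / (2 * t)) ^ 2 * A ^ 2 := by rw [eA]; ring
    _ ≤ (B ^ 2 + 1) * (t ^ (2 * m - 1) / (2 * t)) ^ 2 * (P * Q) := by
        gcongr
        linarith
    _ = _ := by
        rw [eP, eQ]
        field_simp

end Isoperimetric

/-! ### Lifting holomorphic maps to the universal cover -/

section Lifting

open Set Metric

/-- The image is open. It is also closed, since an evenly covered open set that meets the image is
contained in it. -/
theorem _root_.IsCoveringMap.surjective_of_connected {A B : Type*} [TopologicalSpace A]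
    [TopologicalSpace B] [Nonempty A] [PreconnectedSpace B] {p : A → B} (hp : IsCoveringMap p) :
    Function.Surjective p := by
  have hclosed : IsClosed (range p) := by
    refine ⟨isOpen_iff_mem_nhds.2 fun x hx => ?_⟩
    obtain ⟨-, U, hxU, hU, -, H, -⟩ := hp x
    filter_upwards [hU.mem_nhds hxU] with y hy
    rintro ⟨a, rfl⟩
    exact hx ⟨(H ⟨a, hy⟩).2.1, (H ⟨a, hy⟩).2.2⟩
  have : range p = univ := IsClopen.eq_univ ⟨hclosed, hp.isOpenMap.isOpen_range⟩ (range_nonempty p)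
  exact range_eq_univ.1 this

variable {V : Type*} [NormedAddCommGroup V] [NormedSpace ℂ V]
  {E : Type*} [NormedAddCommGroup E] [NormedSpace ℂ E]
  {X : Type*} [TopologicalSpace X] [ChartedSpace E X]
  {X' : Type*} [TopologicalSpace X'] [ChartedSpace E X'] {π : X' → X}

/-- The radial retraction `ρ` onto the closed ball of radius `r` extends `f` from that ball to a
continuous map on all of `V`, to which the lifting theorem applies. The lift is locally a local
inverse of `π` composed with `f`, hence holomorphic. -/
theorem IsUniversalCover.exists_lift [ConnectedSpace X]
    (hπ : IsUniversalCover (E := E) π) {f : V → X} {R r : ℝ} (hr : 0 < r) (hrR : r < R)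
    (hf : ∀ z ∈ ball (0 : V) R, IsHolomorphicAt V E f z) :
    ∃ F : V → X', ∀ z ∈ ball (0 : V) r, IsHolomorphicAt V E F z ∧ π (F z) = f z := by
  let : NormedSpace ℝ V := NormedSpace.restrictScalars ℝ ℂ V
  have := hπ.simplyConnected
  have hsurj := hπ.isCoveringMap.surjective_of_connected
  have hfc : ContinuousOn f (ball 0 R) := fun z hz =>
    (hf z hz).mdifferentiableAt.continuousAt.continuousWithinAt
  set ρ : V → V := fun z => (r / max r ‖z‖) • z with hρ
  have hmax : ∀ z : V, 0 < max r ‖z‖ := fun z => lt_max_of_lt_left hr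
  have hρc : Continuous ρ :=
    (continuous_const.div (by fun_prop) fun z => (hmax z).ne').smul continuous_id
  have hρR : ∀ z, ρ z ∈ ball (0 : V) R := by
    intro z
    rw [mem_ball_zero_iff, hρ, norm_smul, Real.norm_of_nonneg (div_nonneg hr.le (hmax z).le),
      div_mul_eq_mul_div, div_lt_iff₀ (hmax z)]
    have h1 : r * ‖z‖ ≤ r * max r ‖z‖ := mul_le_mul_of_nonneg_left (le_max_right _ _) hr.le
    exact h1.trans_lt (mul_lt_mul_of_pos_right hrR (hmax z))
  have hρid : ∀ z ∈ ball (0 : V) r, ρ z = z := by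
    intro z hz
    rw [mem_ball_zero_iff] at hz
    simp [hρ, max_eq_left hz.le, div_self hr.ne']
  let g : C(V, X) := ⟨f ∘ ρ, hfc.comp_continuous hρc hρR⟩
  obtain ⟨e₀, he₀⟩ := hsurj (g 0)
  obtain ⟨F, ⟨-, hF⟩, -⟩ := hπ.isCoveringMap.existsUnique_continuousMap_lifts g 0 e₀ he₀
  have hFf : ∀ z ∈ ball (0 : V) r, π (F z) = f z := by
    intro z hz
    have := congrFun hF z
    simpa [g, hρid z hz] using this
  refine ⟨F, fun z hz => ⟨?_, hFf z hz⟩⟩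
  have hloc := hπ.isLocalDiffeomorph (F z)
  have heq : (hloc.localInverse : X → X') ∘ f =ᶠ[𝓝 z] F := by
    filter_upwards [isOpen_ball.mem_nhds hz, F.continuous.continuousAt.eventually
      (hloc.localInverse.open_target.mem_nhds hloc.localInverse_mem_target)] with y hy hy2
    rw [Function.comp_apply, ← hFf y hy]
    exact hloc.localInverse_left_inv hy2
  have hinv : IsHolomorphicAt E E (hloc.localInverse : X → X') (f z) := by
    rw [← hFf z hz]
    filter_upwards [hloc.localInverse.open_source.mem_nhds hloc.localInverse_mem_source] with y hy
    exact (hloc.localInverse_contMDiffOn.contMDiffAt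
      (hloc.localInverse.open_source.mem_nhds hy)).mdifferentiableAt (by simp)
  have hcomp := hinv.comp (E := V) (hf z (ball_subset_ball hrR.le hz))
  filter_upwards [hcomp, heq.eventuallyEq_nhds] with y h1 h2
  exact h1.congr_of_eventuallyEq h2.symm

end Lifting

/-! ### The isoperimetric inequality for holomorphic maps into X -/

section IsoperimetricMaps

open Set Metric MeasureTheory

variable {E : Type*} [NormedAddCommGroup E] [NormedSpace ℂ E] [FiniteDimensional ℂ E]
  {X : Type*} [TopologicalSpace X] [ChartedSpace E X] [IsManifold 𝓘(ℂ, E) ω X]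
  {X' : Type*} [TopologicalSpace X'] [ChartedSpace E X'] [IsManifold 𝓘(ℂ, E) ω X']
  {π : X' → X} {m : ℕ}

theorem IsHermitianMetric.isSemipositive_pullback {V : Type*} [NormedAddCommGroup V]
    [NormedSpace ℂ V] {Ω : X → E [⋀^Fin 2]→L[ℝ] ℂ} (hΩ : IsHermitianMetric Ω) (f : V → X) (z : V) :
    IsSemipositive (pullback f Ω z : V [⋀^Fin 2]→L[ℝ] ℂ) := by
  have key : ∀ v w : V, (pullback f Ω z : V [⋀^Fin 2]→L[ℝ] ℂ) ![v, w] =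
      Ω (f z) ![(complexDeriv f z v : E), complexDeriv f z w] := by
    intro v w
    have : (fun i => realDeriv (E := V) (F := E) f z (![v, w] i)) =
        ![complexDeriv f z v, complexDeriv f z w] := by
      funext i
      fin_cases i <;> simp [realDeriv]
    simp only [pullback, ContinuousAlternatingMap.compContinuousLinearMap_apply]
    rw [← this]
    rfl
  refine ⟨fun v w => ?_, fun v w => ?_, fun v => ?_⟩
  · rw [key]
    exact hΩ.real _ _ _
  · rw [key, key, map_smul, map_smul]
    exact hΩ.type_one_one _ _ _
  · rw [key, map_smul]
    by_cases h : (complexDeriv f z v : E) = 0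
    · rw [h]
      have := (Ω (f z)).toAlternatingMap.map_coord_zero (m := ![0, Complex.I • 0]) 0 rfl
      exact (congrArg Complex.re this).ge
    · exact (hΩ.pos _ _ h).le

theorem contDiffOn_pullback {V : Type*} [NormedAddCommGroup V] [NormedSpace ℂ V]
    [FiniteDimensional ℂ V] {k : ℕ} {φ : X → E [⋀^Fin k]→L[ℝ] ℂ} (hφ : IsSmoothForm φ)
    {f : V → X} {U : Set V} (hf : ∀ z ∈ U, IsHolomorphicAt V E f z) :
    ContDiffOn ℝ ∞ (pullback f φ : V → V [⋀^Fin k]→L[ℝ] ℂ) U := by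
  intro z hz
  have h := contDiffAt_inChart_pullback (g := f) hφ (c := z) (e := z)
    (mem_univ _) (hf z hz)
  rw [inChart_self] at h
  exact h.contDiffWithinAt

/-- The isoperimetric inequality for holomorphic maps to a manifold with a
`(∂ + ∂̄)~`-bounded power of a Hermitian metric. -/
theorem IsTildeDelDelbarBounded.exists_isoperimetric [ConnectedSpace X] [Nontrivial (CSpace m)]
    (hπ : IsUniversalCover (E := E) π) {Ω : X → E [⋀^Fin 2]→L[ℝ] ℂ} (hΩ : IsHermitianMetric Ω)
    (h : IsTildeDelDelbarBounded π Ω (powForm Ω m)) : ∃ K : ℝ, 0 < K ∧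
    ∀ (f : CSpace m → X) (R : ℝ), (∀ z ∈ ball (0 : CSpace m) R, IsHolomorphicAt (CSpace m) E f z) →
      ∀ t, 0 < t → t < R → ballVolume (pullback f Ω) t ^ 2 ≤
        K * sphereIntegral t (fun z => dtauNorm (pullback f Ω) z * areaDensity (pullback f Ω) z) *
          (sphereIntegral t (volDensity (pullback f Ω)) / t) := by
  obtain ⟨j, hj, α, β, hα, hβ, ⟨C₁, hαb⟩, ⟨C₂, hβb⟩, heq⟩ := h
  obtain ⟨K, hK, hK'⟩ := HermitianHyperbolicity.exists_isoperimetric (m := m)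
    (C := max 0 (max C₁ C₂)) (le_max_left _ _)
  refine ⟨K, hK, fun f R hf t ht htR => ?_⟩
  -- The lift is only available on a ball strictly smaller than the domain of `f`, whence an
  -- intermediate radius.
  have hr : t < (t + R) / 2 := by linarith
  obtain ⟨F, hF⟩ := hπ.exists_lift (r := (t + R) / 2) (by linarith) (by linarith) hf
  have hFh : ∀ z ∈ ball (0 : CSpace m) ((t + R) / 2), IsHolomorphicAt (CSpace m) E F z :=
    fun z hz => (hF z hz).1
  have hfr : ∀ z ∈ ball (0 : CSpace m) ((t + R) / 2), IsHolomorphicAt (CSpace m) E f z :=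
    fun z hz => hf z (ball_subset_ball (by linarith) hz)
  have hπd : MDifferentiable 𝓘(ℂ, E) 𝓘(ℂ, E) π :=
    hπ.isLocalDiffeomorph.mdifferentiable (by simp)
  have hpull : ∀ {k : ℕ} (φ : X → E [⋀^Fin k]→L[ℝ] ℂ), ∀ z ∈ ball (0 : CSpace m) ((t + R) / 2),
      (pullback f φ z : CSpace m [⋀^Fin k]→L[ℝ] ℂ) =
        pullback F (pullback π φ : X' → E [⋀^Fin k]→L[ℝ] ℂ) z := by
    intro k φ z hz
    have h1 : π ∘ F =ᶠ[𝓝 z] f := by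
      filter_upwards [isOpen_ball.mem_nhds hz] with y hy
      exact (hF y hy).2
    rw [← pullback_congr φ h1]
    exact pullback_comp φ (hπd _) (hFh z hz).mdifferentiableAt
  have hbd : ∀ (γ : X' → E [⋀^Fin j]→L[ℝ] ℂ) (C : ℝ), C ≤ max 0 (max C₁ C₂) →
      (∀ x v, ‖γ x v‖ ≤ C * ∏ i, vecNorm (pullback π Ω x : E [⋀^Fin 2]→L[ℝ] ℂ) (v i)) →
      ∀ z ∈ ball (0 : CSpace m) ((t + R) / 2), ∀ v, ‖(pullback F γ z : CSpace m [⋀^Fin j]→L[ℝ] ℂ) v‖ ≤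
        max 0 (max C₁ C₂) * ∏ i, vecNorm (pullback f Ω z : CSpace m [⋀^Fin 2]→L[ℝ] ℂ) (v i) := by
    intro γ C hC hγ z hz v
    rw [hpull Ω z hz]
    simp only [vecNorm_pullback F]
    refine (hγ (F z) fun i => complexDeriv F z (v i)).trans ?_
    exact mul_le_mul_of_nonneg_right hC (Finset.prod_nonneg fun i _ => vecNorm_nonneg _ _)
  refine hK' (pullback f Ω) j hj (pullback F α) (pullback F β) ((t + R) / 2)
    (contDiffOn_pullback hΩ.smooth hfr).continuousOn
    (fun z _ => hΩ.isSemipositive_pullback f z)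
    ((contDiffOn_pullback hα hFh).of_le (by simp)) ((contDiffOn_pullback hβ hFh).of_le (by simp))
    (hbd α C₁ ((le_max_left _ _).trans (le_max_right _ _)) hαb)
    (hbd β C₂ ((le_max_right _ _).trans (le_max_right _ _)) hβb) ?_ t ht hr
  intro z hz
  rw [← pullback_powForm, hpull _ z hz, delForm_pullback hα (hFh z hz),
    delbarForm_pullback hβ (hFh z hz)]
  have e := heq (F z)
  rw [pullback, e]
  ext v
  rw [castDegree_apply, ContinuousAlternatingMap.compContinuousLinearMap_apply, castDegree_apply]
  rfl

end IsoperimetricMaps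

/-! ### Comparison of two semipositive forms -/

section Comparison

variable {m : ℕ} {θ θ' : CSpace m [⋀^Fin 2]→L[ℝ] ℂ}

theorem IsSemipositive.topDensity_pos (h : IsSemipositive θ)
    (hpos : ∀ v, v ≠ 0 → vecNorm θ v ≠ 0) : 0 < topDensity θ := by
  obtain ⟨c, hc, hc'⟩ := exists_topDensity_eq m
  obtain ⟨u, μ, hd⟩ := h.isDiagonalization
  rw [hc' θ u μ hd]
  refine mul_pos hc (Finset.prod_pos fun j _ => lt_of_le_of_ne (hd.nonneg j) fun h0 => ?_)
  have h1 := hd.vecNorm_sq (u j)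
  rw [Finset.sum_eq_single j, ← h0, zero_mul] at h1
  · refine hpos (u j) ?_ (pow_eq_zero_iff two_ne_zero |>.1 h1)
    rw [← norm_ne_zero_iff, u.norm_eq_one]
    exact one_ne_zero
  · intro i _ hij
    rw [u.inner_eq_zero hij]
    simp
  · simp

theorem IsSemipositive.vecNorm_le (h' : IsSemipositive θ') {C : ℝ} (hC : 0 ≤ C)
    (hb : ∀ v, ‖θ v‖ ≤ C * ∏ i, vecNorm θ' (v i)) (v : CSpace m) :
    vecNorm θ v ≤ √C * vecNorm θ' v := by
  have h1 := hb ![v, Complex.I • v]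
  rw [Fin.prod_univ_two] at h1
  simp only [Matrix.cons_val_zero, Matrix.cons_val_one, vecNorm_smul_I h'] at h1
  rw [vecNorm]
  refine (Real.sqrt_le_sqrt ((Complex.re_le_norm _).trans h1)).trans (le_of_eq ?_)
  rw [Real.sqrt_mul hC, Real.sqrt_mul_self (vecNorm_nonneg _ _)]

variable (m) in
-- The hypothesis says that `θ` is bounded by 1 with respect to √C times the norm of `θ'`. So θ^m is
-- bounded with respect to `θ'`, and the estimate for top-degree forms applies.
theorem exists_topDensity_le {C : ℝ} (hC : 0 ≤ C) : ∃ K : ℝ, 0 < K ∧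
    ∀ θ θ' : CSpace m [⋀^Fin 2]→L[ℝ] ℂ, IsSemipositive θ → IsSemipositive θ' →
      (∀ v, ‖θ v‖ ≤ C * ∏ i, vecNorm θ' (v i)) → topDensity θ ≤ K * topDensity θ' := by
  obtain ⟨K₀, hK₀, hK₀'⟩ := exists_norm_apply_stdFrame_le m
  obtain ⟨K₁, hK₁, hK₁'⟩ := exists_norm_wedgePow_apply_le (E := CSpace m) m
  refine ⟨(m.factorial : ℝ)⁻¹ * (K₀ * (K₁ * √C ^ (2 * m) + 1)), by positivity,
    fun θ θ' h h' hb => ?_⟩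
  have h1 := hK₁' θ (fun v => √C * vecNorm θ' v) (by
    intro v
    refine (hb v).trans (le_of_eq ?_)
    rw [Finset.prod_mul_distrib]
    simp [Real.sq_sqrt hC])
  have h2 := hK₀' θ' (wedgePow θ m) (K₁ * √C ^ (2 * m)) h' (by
    intro v
    refine (h1 v).trans (le_of_eq ?_)
    rw [Finset.prod_mul_distrib]
    simp
    ring)
  have h3 := h'.topDensity_nonneg
  rw [topDensity, Complex.smul_re, smul_eq_mul, mul_assoc]
  refine mul_le_mul_of_nonneg_left ((Complex.re_le_norm _).trans (h2.trans ?_)) (by positivity)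
  exact mul_le_mul_of_nonneg_right (mul_le_mul_of_nonneg_left (by linarith) hK₀.le) h3

variable (m) in
-- If the density of `θ` vanishes, so does the left side. Otherwise `θ'` is non-degenerate too, and
-- its dual norm controls that of `θ`, because the unit ball of `θ` lies in √C times that of `θ'`.
theorem exists_dualNorm_sq_mul_topDensity_comparison {C : ℝ} (hC : 0 ≤ C) : ∃ K : ℝ, 0 < K ∧
    ∀ (θ θ' : CSpace m [⋀^Fin 2]→L[ℝ] ℂ) (l : CSpace m →L[ℝ] ℝ), IsSemipositive θ →
      IsSemipositive θ' → (∀ v, ‖θ v‖ ≤ C * ∏ i, vecNorm θ' (v i)) →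
      (∀ v, ‖θ' v‖ ≤ C * ∏ i, vecNorm θ (v i)) →
      dualNorm θ l ^ 2 * topDensity θ ≤ K * (dualNorm θ' l ^ 2 * topDensity θ') := by
  obtain ⟨K, hK, hK'⟩ := exists_topDensity_le m hC
  refine ⟨(C + 1) * K, by positivity, fun θ θ' l h h' hb hb' => ?_⟩
  have h1 := hK' θ θ' h h' hb
  have h3 := h'.topDensity_nonneg
  rcases h.topDensity_nonneg.eq_or_lt with h0 | hpos
  · rw [← h0, mul_zero]
    positivity
  · have hpos' : 0 < topDensity θ' := pos_of_mul_pos_right (hpos.trans_le h1) hK.le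
    have h2 : dualNorm θ l ≤ dualNorm θ' l * √C := by
      refine Real.sSup_le ?_ (mul_nonneg (dualNorm_nonneg _ _) (Real.sqrt_nonneg _))
      rintro s ⟨v, hv, rfl⟩
      refine (h'.abs_le_dualNorm_mul hpos' l v).trans ?_
      refine mul_le_mul_of_nonneg_left ?_ (dualNorm_nonneg _ _)
      exact (h.vecNorm_le hC hb' v).trans (mul_le_of_le_one_right (Real.sqrt_nonneg _) hv)
    have h4 : dualNorm θ l ^ 2 ≤ dualNorm θ' l ^ 2 * C := by
      have := pow_le_pow_left₀ (dualNorm_nonneg θ l) h2 2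
      rwa [mul_pow, Real.sq_sqrt hC] at this
    calc dualNorm θ l ^ 2 * topDensity θ ≤ (dualNorm θ' l ^ 2 * C) * (K * topDensity θ') := by
          gcongr
      _ ≤ (dualNorm θ' l ^ 2 * (C + 1)) * (K * topDensity θ') := by
          gcongr
          linarith
      _ = _ := by ring

end Comparison

/-! ### Exponential growth from a differential inequality -/

section Growth

open Set Filter MeasureTheory

/-- A positive solution of `W ≤ C W'` grows at least exponentially. -/
theorem exists_mul_exp_le {W w : ℝ → ℝ} {C r : ℝ} (hC : 0 < C) (hW : ∀ t, HasDerivAt W (w t) t)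
    (hr : 0 < W r) (hle : ∀ t, r ≤ t → W t ≤ C * w t) :
    ∃ c : ℝ, 0 < c ∧ ∀ t, r ≤ t → c * Real.exp (t / C) ≤ W t := by
  have hd : ∀ t, HasDerivAt (fun t => W t * Real.exp (-(t / C)))
      ((w t - W t / C) * Real.exp (-(t / C))) t := by
    intro t
    have h1 : HasDerivAt (fun t : ℝ => Real.exp (-(t / C))) (Real.exp (-(t / C)) * -(1 / C)) t :=
      (((hasDerivAt_id t).div_const C).neg).exp
    refine ((hW t).mul h1).congr_deriv ?_
    ring
  have hmono : MonotoneOn (fun t => W t * Real.exp (-(t / C))) (Ici r) := by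
    refine monotoneOn_of_deriv_nonneg (convex_Ici r)
      (fun t _ => (hd t).continuousAt.continuousWithinAt)
      (fun t _ => (hd t).differentiableAt.differentiableWithinAt) fun t ht => ?_
    rw [interior_Ici] at ht
    rw [(hd t).deriv]
    refine mul_nonneg ?_ (Real.exp_pos _).le
    rw [sub_nonneg, div_le_iff₀ hC, mul_comm]
    exact hle t (le_of_lt ht)
  refine ⟨W r * Real.exp (-(r / C)), mul_pos hr (Real.exp_pos _), fun t ht => ?_⟩
  have := hmono (self_mem_Ici) ht ht
  calc W r * Real.exp (-(r / C)) * Real.exp (t / C)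
      ≤ W t * Real.exp (-(t / C)) * Real.exp (t / C) := by gcongr
    _ = W t := by rw [mul_assoc, ← Real.exp_add]; simp

/-- The integral over the last unit interval [b - 1, b] alone has logarithm at least log c + (b -
1)/C, so the difference is eventually at most 1/C - log c. -/
theorem limsup_sub_log_integral_ne_top {W : ℝ → ℝ} {C c r : ℝ} (hC : 0 < C) (hc : 0 < c)
    (hWc : Continuous W) (hW0 : ∀ t, 0 ≤ t → 0 ≤ W t)
    (hle : ∀ t, r ≤ t → c * Real.exp (t / C) ≤ W t) :
    limsup (fun b : ℝ => ((b / C - Real.log (∫ t in (0 : ℝ)..b, W t) : ℝ) : EReal)) atTop ≠ ⊤ := by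
  have hev : ∀ᶠ b : ℝ in atTop, ((b / C - Real.log (∫ t in (0 : ℝ)..b, W t) : ℝ) : EReal) ≤
      ((1 / C - Real.log c : ℝ) : EReal) := by
    filter_upwards [eventually_ge_atTop (max r 0 + 1)] with b hb
    have hb0 : 0 ≤ b - 1 := by linarith [le_max_right r 0]
    have hbr : r ≤ b - 1 := by linarith [le_max_left r 0]
    have h1 : c * Real.exp ((b - 1) / C) ≤ ∫ t in (0 : ℝ)..b, W t := by
      rw [← intervalIntegral.integral_add_adjacent_intervals
        (hWc.intervalIntegrable 0 (b - 1)) (hWc.intervalIntegrable (b - 1) b)]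
      have h2 : 0 ≤ ∫ t in (0 : ℝ)..(b - 1), W t :=
        intervalIntegral.integral_nonneg hb0 fun t ht => hW0 t ht.1
      have h3 : ∫ _ in (b - 1)..b, c * Real.exp ((b - 1) / C) ≤ ∫ t in (b - 1)..b, W t := by
        refine intervalIntegral.integral_mono_on (by linarith) (by simp)
          (hWc.intervalIntegrable _ _) fun t ht => ?_
        refine le_trans ?_ (hle t (hbr.trans ht.1))
        gcongr
        exact ht.1
      rw [intervalIntegral.integral_const] at h3
      simp at h3
      linarith
    have h4 : Real.log c + (b - 1) / C ≤ Real.log (∫ t in (0 : ℝ)..b, W t) := by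
      rw [← Real.log_exp ((b - 1) / C), ← Real.log_mul hc.ne' (Real.exp_pos _).ne']
      exact Real.log_le_log (mul_pos hc (Real.exp_pos _)) h1
    rw [EReal.coe_le_coe_iff]
    have : (b - 1) / C = b / C - 1 / C := by ring
    linarith
  exact ne_top_of_le_ne_top (EReal.coe_ne_top _) (limsup_le_of_le (by isBoundedDefault) hev)

end Growth

/-! ### The volume of balls as a function of the radius -/

section BallVolume

open Set Metric MeasureTheory

variable {m : ℕ} {θ : CSpace m → CSpace m [⋀^Fin 2]→L[ℝ] ℂ}

theorem ballVolume_eq_integral [Nontrivial (CSpace m)] {R : ℝ} (hθ : ContinuousOn θ (ball 0 R))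
    {t : ℝ} (ht : 0 ≤ t) (htR : t < R) :
    ballVolume θ t = ∫ r in (0 : ℝ)..t, sphereIntegral r (volDensity θ) := by
  rw [ballVolume, setIntegral_ball_polar volume ht]
  · simp only [sphereIntegral_eq_sphereMean]
  · have h1 : ContinuousOn (volDensity θ) (ball 0 R) := continuous_topDensity.comp_continuousOn hθ
    exact ((h1.mono (closedBall_subset_ball htR)).integrableOn_compact
      (isCompact_closedBall 0 t)).mono_set ball_subset_closedBall

theorem ballVolume_pos {R : ℝ} (hθ : ContinuousOn θ (ball 0 R))
    (hs : ∀ z ∈ ball 0 R, IsSemipositive (θ z)) {z₀ : CSpace m} (hz₀ : 0 < volDensity θ z₀)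
    {t : ℝ} (ht : ‖z₀‖ < t) (htR : t < R) : 0 < ballVolume θ t := by
  have h1 : ContinuousOn (volDensity θ) (ball 0 R) := continuous_topDensity.comp_continuousOn hθ
  have hint : IntegrableOn (volDensity θ) (ball 0 t) :=
    ((h1.mono (closedBall_subset_ball htR)).integrableOn_compact
      (isCompact_closedBall 0 t)).mono_set ball_subset_closedBall
  rw [ballVolume, setIntegral_pos_iff_support_of_nonneg_ae _ hint]
  · have hmem : z₀ ∈ ball (0 : CSpace m) t := mem_ball_zero_iff.2 ht
    have hev : Function.support (volDensity θ) ∩ ball 0 t ∈ 𝓝 z₀ := by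
      refine Filter.inter_mem ?_ (isOpen_ball.mem_nhds hmem)
      have := (h1.continuousAt (isOpen_ball.mem_nhds (ball_subset_ball htR.le hmem))).eventually
        (lt_mem_nhds hz₀)
      filter_upwards [this] with z hz
      exact hz.ne'
    exact Measure.measure_pos_of_mem_nhds _ hev
  · refine (ae_restrict_iff' measurableSet_ball).2 (.of_forall fun z hz => ?_)
    exact (hs z (ball_subset_ball htR.le hz)).topDensity_nonneg

theorem continuous_sphereIntegral_volDensity [Nontrivial (CSpace m)] (hθ : Continuous θ) :
    Continuous fun t => sphereIntegral t (volDensity θ) := by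
  simp only [sphereIntegral_eq_sphereMean]
  exact continuous_sphereMean volume (continuous_topDensity.comp hθ)

end BallVolume

/-! ### Gauduchon hyperbolic manifolds are divisorially hyperbolic -/

section Divisorial

open Set Metric MeasureTheory

variable {E : Type*} [NormedAddCommGroup E] [NormedSpace ℂ E] [FiniteDimensional ℂ E]
  {X : Type*} [TopologicalSpace X] [ChartedSpace E X] [IsManifold 𝓘(ℂ, E) ω X]
  {X' : Type*} [TopologicalSpace X'] [ChartedSpace E X'] [IsManifold 𝓘(ℂ, E) ω X']
  {π : X' → X}

theorem vecNorm_pullback_bound {V : Type*} [NormedAddCommGroup V] [NormedSpace ℂ V] {k : ℕ}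
    {Ω : X → E [⋀^Fin 2]→L[ℝ] ℂ} {φ : X → E [⋀^Fin k]→L[ℝ] ℂ} {C C' : ℝ}
    (h : ∀ x v, ‖φ x v‖ ≤ C * ∏ i, vecNorm (Ω x) (v i)) (hC : C ≤ C') (f : V → X) (z : V)
    (v : Fin k → V) : ‖(pullback f φ z : V [⋀^Fin k]→L[ℝ] ℂ) v‖ ≤
      C' * ∏ i, vecNorm (pullback f Ω z : V [⋀^Fin 2]→L[ℝ] ℂ) (v i) := by
  simp only [vecNorm_pullback f]
  refine (h (f z) fun i => complexDeriv f z (v i)).trans ?_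
  exact mul_le_mul_of_nonneg_right hC (Finset.prod_nonneg fun i _ => vecNorm_nonneg _ _)

/-- The isoperimetric inequality holds for the Gauduchon hyperbolic metric `Ω`, while growth is
measured by an arbitrary `Ω'`; compactness makes the two comparable. Inserting growth condition (i)
gives W² ≤ D W W' for the volume of f^*Ω'. Once the ball contains `z₀`, W is positive and can be
cancelled, and the exponential growth that follows contradicts condition (ii). -/
theorem GauduchonHyperbolic.divisoriallyHyperbolic [CompactSpace X] [ConnectedSpace X] {n : ℕ}
    (hn : 2 ≤ n) (hπ : IsUniversalCover (E := E) π) (h : GauduchonHyperbolic (E := E) n π) :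
    DivisoriallyHyperbolic E X n := by
  obtain ⟨Ω, hΩ, hb⟩ := h
  rintro Ω' f hΩ' hf ⟨z₀, hz₀⟩ ⟨⟨C₁, hC₁, r₀, hr₀, hgrowth⟩, hlim⟩
  have hnt : Nontrivial (CSpace (n - 1)) := by
    have : Nonempty (Fin (n - 1)) := ⟨⟨0, by omega⟩⟩
    infer_instance
  obtain ⟨K, hK, hiso⟩ := hb.exists_isoperimetric hπ hΩ
  obtain ⟨A, hA⟩ := hΩ.smooth.isBoundedForm hΩ'
  obtain ⟨A', hA'⟩ := hΩ'.smooth.isBoundedForm hΩ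
  set C := max 0 (max A A') with hCdef
  have hC : 0 ≤ C := le_max_left _ _
  obtain ⟨K₁, hK₁, hK₁'⟩ := exists_topDensity_le (n - 1) hC
  obtain ⟨K₂, hK₂, hK₂'⟩ := exists_dualNorm_sq_mul_topDensity_comparison (n - 1) hC
  set θ : CSpace (n - 1) → CSpace (n - 1) [⋀^Fin 2]→L[ℝ] ℂ := pullback f Ω with hθ
  set θ' : CSpace (n - 1) → CSpace (n - 1) [⋀^Fin 2]→L[ℝ] ℂ := pullback f Ω' with hθ'
  have hfh : ∀ z, IsHolomorphicAt (CSpace (n - 1)) E f z := hf.isHolomorphicAt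
  have hs : ∀ z, IsSemipositive (θ z) := hΩ.isSemipositive_pullback f
  have hs' : ∀ z, IsSemipositive (θ' z) := hΩ'.isSemipositive_pullback f
  have hcθ : Continuous θ := continuousOn_univ.1
    (contDiffOn_pullback hΩ.smooth fun z _ => hfh z).continuousOn
  have hcθ' : Continuous θ' := continuousOn_univ.1
    (contDiffOn_pullback hΩ'.smooth fun z _ => hfh z).continuousOn
  have hAb : ∀ z v, ‖θ z v‖ ≤ C * ∏ i, vecNorm (θ' z) (v i) := fun z v =>
    vecNorm_pullback_bound hA ((le_max_left _ _).trans (le_max_right _ _)) f z v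
  have hAb' : ∀ z v, ‖θ' z v‖ ≤ C * ∏ i, vecNorm (θ z) (v i) := fun z v =>
    vecNorm_pullback_bound hA' ((le_max_right _ _).trans (le_max_right _ _)) f z v
  have hvol : ∀ z, volDensity θ z ≤ K₁ * volDensity θ' z := fun z =>
    hK₁' _ _ (hs z) (hs' z) (hAb z)
  have hvol' : ∀ z, volDensity θ' z ≤ K₁ * volDensity θ z := fun z =>
    hK₁' _ _ (hs' z) (hs z) (hAb' z)
  have hvc : Continuous (volDensity θ) := continuous_topDensity.comp hcθ
  have hvc' : Continuous (volDensity θ') := continuous_topDensity.comp hcθ'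
  have hnorm : ∀ t : ℝ, 0 < t → ∀ u : sphere (0 : CSpace (n - 1)) 1,
      ‖t • (u : CSpace (n - 1))‖ = t := by
    intro t ht u
    simp [norm_smul, abs_of_pos ht]
  have hW0 : ∀ t, 0 ≤ ballVolume θ' t := fun t =>
    setIntegral_nonneg measurableSet_ball fun z _ => (hs' z).topDensity_nonneg
  have hWW : ∀ t, ballVolume θ' t ≤ K₁ * ballVolume θ t := by
    intro t
    have hi : ∀ g : CSpace (n - 1) → ℝ, Continuous g → IntegrableOn g (ball 0 t) := fun g hg =>
      (hg.continuousOn.integrableOn_compact (isCompact_closedBall 0 t)).mono_set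
        ball_subset_closedBall
    rw [ballVolume, ballVolume, ← integral_const_mul]
    exact setIntegral_mono (hi _ hvc') (hi _ (hvc.const_mul K₁)) hvol'
  have hSS : ∀ t, 0 < t → sphereIntegral t (volDensity θ) ≤
      K₁ * sphereIntegral t (volDensity θ') := by
    intro t ht
    have hi : ∀ g : CSpace (n - 1) → ℝ, Continuous g → Integrable
        (fun u : sphere (0 : CSpace (n - 1)) 1 => g (t • (u : CSpace (n - 1))))
        (volume : Measure (CSpace (n - 1))).toSphere := fun g hg =>
      integrable_sphere_of_continuousOn ht.le hg.continuousOn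
    rw [sphereIntegral, sphereIntegral, mul_left_comm, ← integral_const_mul K₁]
    refine mul_le_mul_of_nonneg_left ?_ (pow_nonneg ht.le _)
    exact integral_mono (hi _ hvc) (hi _ (hvc'.const_mul K₁)) fun u => hvol _
  have hPP : ∀ t, 0 < t → sphereIntegral t (fun z => dtauNorm θ z * areaDensity θ z) ≤
      K₂ * sphereIntegral t (fun z => dtauNorm θ' z * areaDensity θ' z) := by
    intro t ht
    have hint : ∀ η : CSpace (n - 1) → CSpace (n - 1) [⋀^Fin 2]→L[ℝ] ℂ, Continuous η →
        (∀ z, IsSemipositive (η z)) → Integrable (fun u : sphere (0 : CSpace (n - 1)) 1 =>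
          dtauNorm η (t • (u : CSpace (n - 1))) * areaDensity η (t • (u : CSpace (n - 1))))
          (volume : Measure (CSpace (n - 1))).toSphere := by
      intro η hη hηs
      have := ((integrable_sphere_dtauNorm (R := t + 1) hη.continuousOn (fun z _ => hηs z) ht
        (by linarith)).2).div_const (2 * t)
      refine this.congr (.of_forall fun u => ?_)
      simp only [areaDensity, hnorm t ht]
      ring
    rw [sphereIntegral, sphereIntegral, mul_left_comm, ← integral_const_mul K₂]
    refine mul_le_mul_of_nonneg_left ?_ (pow_nonneg ht.le _)
    refine integral_mono (hint θ hcθ hs) ((hint θ' hcθ' hs').const_mul K₂) fun u => ?_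
    have h1 := hK₂' (θ (t • (u : CSpace (n - 1)))) (θ' (t • (u : CSpace (n - 1))))
      (fderiv ℝ (fun x : CSpace (n - 1) => ‖x‖ ^ 2) (t • (u : CSpace (n - 1)))) (hs _) (hs' _)
      (hAb _) (hAb' _)
    simp only [areaDensity, hnorm t ht, dtauNorm_eq, volDensity_eq]
    have h2 := div_le_div_of_nonneg_right h1 (show 0 ≤ 2 * t by linarith)
    calc _ = _ := by ring
      _ ≤ _ := h2
      _ = _ := by ring
  -- K₁² compares the squared volumes, K is isoperimetric, K₂ C₁ comes from ∫ |dτ| dσ and the growth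
  -- condition, and the last K₁ compares the radial derivatives.
  set D : ℝ := K₁ ^ 2 * (K * (K₂ * C₁) * K₁) with hD
  have hD0 : 0 < D := by positivity
  have hvz : 0 < volDensity θ' z₀ := by
    refine (hs' z₀).topDensity_pos fun v hv => ?_
    rw [hθ', vecNorm_pullback f]
    have hne : (complexDeriv f z₀ v : E) ≠ 0 :=
      fun h0 => hv (hz₀ (h0.trans (map_zero (complexDeriv f z₀ : CSpace (n - 1) →L[ℂ] E)).symm))
    exact (Real.sqrt_pos.2 (hΩ'.pos _ _ hne)).ne'
  have hWpos : ∀ t, ‖z₀‖ < t → 0 < ballVolume θ' t := fun t ht =>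
    ballVolume_pos (R := t + 1) hcθ'.continuousOn (fun z _ => hs' z) hvz ht (by linarith)
  -- This primitive is differentiable on the whole line and agrees with the volume for t ≥ 0.
  set W : ℝ → ℝ := fun t => ∫ r in (0 : ℝ)..t, sphereIntegral r (volDensity θ') with hWdef
  have hWeq : ∀ t, 0 ≤ t → ballVolume θ' t = W t := fun t ht =>
    ballVolume_eq_integral (R := t + 1) hcθ'.continuousOn ht (by linarith)
  have hWd : ∀ t, HasDerivAt W (sphereIntegral t (volDensity θ')) t := fun t =>
    ((continuous_sphereIntegral_volDensity hcθ').integral_hasStrictDerivAt 0 t).hasDerivAt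
  have hWc : Continuous W := continuous_iff_continuousAt.2 fun t => (hWd t).continuousAt
  set r := max r₀ ‖z₀‖ + 1 with hr
  have hrpos : 0 < r := by linarith [le_max_left r₀ ‖z₀‖]
  have hmain : ∀ t, r ≤ t → W t ≤ D * sphereIntegral t (volDensity θ') := by
    intro t ht
    have ht0 : 0 < t := hrpos.trans_le ht
    have htr₀ : r₀ < t := by linarith [le_max_left r₀ ‖z₀‖]
    have htz : ‖z₀‖ < t := by linarith [le_max_right r₀ ‖z₀‖]
    have h1 := hiso f (t + 1) (fun z _ => hfh z) t ht0 (by linarith)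
    have h2 := hgrowth t htr₀
    have hWp := hWpos t htz
    have hS0 : 0 ≤ sphereIntegral t (volDensity θ') :=
      mul_nonneg (pow_nonneg ht0.le _) (integral_nonneg fun u => (hs' _).topDensity_nonneg)
    have hS0' : 0 ≤ sphereIntegral t (volDensity θ) :=
      mul_nonneg (pow_nonneg ht0.le _) (integral_nonneg fun u => (hs _).topDensity_nonneg)
    have h3 : ballVolume θ' t ^ 2 ≤ D * ballVolume θ' t * sphereIntegral t (volDensity θ') := by
      calc ballVolume θ' t ^ 2 ≤ (K₁ * ballVolume θ t) ^ 2 := by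
            have := hWW t
            have := hW0 t
            gcongr
        _ = K₁ ^ 2 * ballVolume θ t ^ 2 := by ring
        _ ≤ K₁ ^ 2 * (K * sphereIntegral t (fun z => dtauNorm θ z * areaDensity θ z) *
              (sphereIntegral t (volDensity θ) / t)) := by gcongr
        _ ≤ K₁ ^ 2 * (K * (K₂ * (C₁ * t * ballVolume θ' t)) *
              (K₁ * sphereIntegral t (volDensity θ') / t)) := by
            have h4 := hSS t ht0
            have h5 := (hPP t ht0).trans (mul_le_mul_of_nonneg_left h2 hK₂.le)
            gcongr
        _ = _ := by
            rw [hD]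
            field_simp
    rw [← hWeq t ht0.le]
    rw [sq, mul_right_comm] at h3
    exact le_of_mul_le_mul_right h3 hWp
  obtain ⟨c, hc, hexp⟩ := exists_mul_exp_le hD0 hWd
    (by rw [← hWeq r hrpos.le]; exact hWpos r (by linarith [le_max_right r₀ ‖z₀‖])) hmain
  have hne := limsup_sub_log_integral_ne_top hD0 hc hWc
    (fun t ht => by rw [← hWeq t ht]; exact hW0 t) hexp
  refine hne ?_
  rw [← hlim D hD0]
  refine Filter.limsup_congr ?_
  filter_upwards [Filter.eventually_ge_atTop 0] with b hb
  have : ∫ t in (0 : ℝ)..b, W t = ∫ t in (0 : ℝ)..b, ballVolume θ' t := by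
    refine intervalIntegral.integral_congr fun t ht => ?_
    rw [uIcc_of_le hb] at ht
    exact (hWeq t ht.1).symm
  rw [this]

end Divisorial

/-! ### Kobayashi hyperbolic manifolds are divisorially hyperbolic -/

section KobayashiDivisorial

open Set Metric Filter

variable {E : Type*} [NormedAddCommGroup E] [NormedSpace ℂ E]
  {X : Type*} [TopologicalSpace X] [ChartedSpace E X]

theorem discDist_le {f : ℂ → X} (hf : MDifferentiableOn 𝓘(ℂ, ℂ) 𝓘(ℂ, E) f (ball 0 1)) {a b : ℂ}
    (ha : a ∈ ball (0 : ℂ) 1) (hb : b ∈ ball (0 : ℂ) 1) :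
    discDist E (f a) (f b) ≤ ENNReal.ofReal (poincareDist a b) :=
  iInf_le_of_le f (iInf_le_of_le a (iInf_le_of_le b (iInf_le_of_le hf (iInf_le_of_le ha
    (iInf_le_of_le hb (iInf_le_of_le rfl (iInf_le_of_le rfl le_rfl)))))))

theorem kobayashiDist_le_discDist (x y : X) : kobayashiDist E x y ≤ discDist E x y := by
  refine iInf_le_of_le 1 (iInf_le_of_le (fun i => if i = 0 then x else y) ?_)
  simp

theorem poincareDist_zero_left (b : ℂ) : poincareDist 0 b = 2 * Real.artanh ‖b‖ := by
  simp [poincareDist]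

theorem tendsto_artanh_zero : Tendsto Real.artanh (𝓝 0) (𝓝 0) := by
  have h : ContinuousAt (fun x : ℝ => 1 / 2 * Real.log ((1 + x) / (1 - x))) 0 := by
    refine continuousAt_const.mul (ContinuousAt.log ?_ (by simp))
    exact ContinuousAt.div (by fun_prop) (by fun_prop) (by simp)
  have h2 : Tendsto (fun x : ℝ => 1 / 2 * Real.log ((1 + x) / (1 - x))) (𝓝 0) (𝓝 0) := by
    simpa [ContinuousAt] using h
  refine h2.congr' ?_
  filter_upwards [Ioo_mem_nhds (show (-1 : ℝ) < 0 by norm_num) (show (0 : ℝ) < 1 by norm_num)]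
    with x hx
  exact (Real.artanh_eq_half_log ⟨hx.1.le, hx.2.le⟩).symm

/-- The Kobayashi pseudo-distance vanishes along entire curves. -/
theorem discDist_entire_eq_zero {g : ℂ → X} (hg : MDifferentiable 𝓘(ℂ, ℂ) 𝓘(ℂ, E) g) (t : ℂ) :
    discDist E (g 0) (g t) = 0 := by
  -- The disc ζ ↦ g(Rζ) takes 0 and t/R to the two points, and the Poincaré distance of 0 and t/R
  -- tends to 0.
  have hle : ∀ᶠ R : ℝ in atTop, discDist E (g 0) (g t) ≤
      ENNReal.ofReal (2 * Real.artanh (‖t‖ / R)) := by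
    filter_upwards [eventually_gt_atTop ‖t‖] with R hR
    have hR0 : 0 < R := (norm_nonneg t).trans_lt hR
    have hR0' : (R : ℂ) ≠ 0 := by exact_mod_cast hR0.ne'
    have hd : MDifferentiableOn 𝓘(ℂ, ℂ) 𝓘(ℂ, E) (g ∘ fun ζ : ℂ => (R : ℂ) * ζ) (ball 0 1) := by
      refine (hg.comp ?_).mdifferentiableOn
      exact (differentiable_id.const_mul (R : ℂ)).mdifferentiable
    have hn : ‖t / R‖ = ‖t‖ / R := by
      rw [norm_div, Complex.norm_real, Real.norm_of_nonneg hR0.le]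
    have h1 := discDist_le hd (mem_ball_self one_pos)
      (show t / R ∈ ball (0 : ℂ) 1 by rwa [mem_ball_zero_iff, hn, div_lt_one hR0])
    rwa [poincareDist_zero_left, hn, Function.comp_apply, Function.comp_apply, mul_zero,
      mul_div_cancel₀ _ hR0'] at h1
  have hlim : Tendsto (fun R : ℝ => ENNReal.ofReal (2 * Real.artanh (‖t‖ / R))) atTop (𝓝 0) := by
    have h1 : Tendsto (fun R : ℝ => ‖t‖ / R) atTop (𝓝 0) := tendsto_const_nhds.div_atTop tendsto_id
    have h2 := (tendsto_artanh_zero.comp h1).const_mul 2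
    simpa using ENNReal.tendsto_ofReal h2
  exact le_antisymm (ge_of_tendsto hlim hle) zero_le

theorem KobayashiHyperbolic.entire_eq (h : KobayashiHyperbolic E X) {g : ℂ → X}
    (hg : MDifferentiable 𝓘(ℂ, ℂ) 𝓘(ℂ, E) g) (t : ℂ) : g 0 = g t :=
  h _ _ (le_antisymm ((kobayashiDist_le_discDist _ _).trans (discDist_entire_eq_zero hg t).le)
    zero_le)

/-- The restriction of `f` to a complex line through `z₀` is an entire curve, hence constant, so the
differential of `f` at `z₀` kills the direction of that line. -/
theorem KobayashiHyperbolic.divisoriallyHyperbolic {n : ℕ} (hn : 2 ≤ n)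
    (h : KobayashiHyperbolic E X) : DivisoriallyHyperbolic E X n := by
  rintro Ω f - hf ⟨z₀, hz₀⟩ -
  set v : CSpace (n - 1) := EuclideanSpace.single ⟨0, by omega⟩ 1 with hv
  have hv0 : v ≠ 0 := by simp [hv]
  set ℓ : ℂ → CSpace (n - 1) := fun t => z₀ + t • v with hℓ
  have hℓd : ∀ t, HasFDerivAt ℓ ((1 : ℂ →L[ℂ] ℂ).smulRight v) t := fun t =>
    ((hasFDerivAt_id t).smul_const v).const_add z₀
  have hℓm : MDifferentiable 𝓘(ℂ, ℂ) 𝓘(ℂ, CSpace (n - 1)) ℓ := fun t =>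
    (hℓd t).differentiableAt.mdifferentiableAt
  have hconst : f ∘ ℓ = fun _ => f (ℓ 0) := by
    funext t
    exact (h.entire_eq (hf.comp hℓm) t).symm
  have h1 := complexDeriv_comp (E := ℂ) (F := CSpace (n - 1)) (G := E) (g := f) (f := ℓ) (x := 0)
    (hf _) (hℓm 0)
  have h2 : (complexDeriv (f ∘ ℓ) (0 : ℂ) : ℂ →L[ℂ] E) = 0 := by
    rw [hconst]
    exact mfderiv_const
  have h3 : ℓ 0 = z₀ := by simp [hℓ]
  rw [h2, complexDeriv_eq_fderiv, (hℓd 0).fderiv, h3] at h1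
  have h4 : (0 : E) = (complexDeriv f z₀ : CSpace (n - 1) →L[ℂ] E) v := by
    simpa using congrArg (fun L : ℂ →L[ℂ] E => L 1) h1
  exact hv0 (hz₀ (h4.symm.trans (map_zero (complexDeriv f z₀ : CSpace (n - 1) →L[ℂ] E)).symm))

end KobayashiDivisorial

/-! ### The area of small concentric discs -/

section DiscArea

open Set Metric MeasureTheory

/-- Near `z` one has | ‖x‖² - ‖z‖² | ≤ 3‖z‖ ‖x - z‖; the sharp constant 2 is not needed. -/
theorem norm_fderiv_norm_sq_le {V : Type*} [NormedAddCommGroup V] [NormedSpace ℝ V] {z : V}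
    (hz : z ≠ 0) : ‖fderiv ℝ (fun x : V => ‖x‖ ^ 2) z‖ ≤ 3 * ‖z‖ := by
  have hz' : 0 < ‖z‖ := norm_pos_iff.2 hz
  refine norm_fderiv_le_of_lip' ℝ (by positivity) ?_
  have : ∀ᶠ x in 𝓝 z, ‖x‖ < 2 * ‖z‖ :=
    continuous_norm.continuousAt.eventually (gt_mem_nhds (by linarith))
  filter_upwards [this] with x hx
  have h1 : ‖x‖ ^ 2 - ‖z‖ ^ 2 = (‖x‖ - ‖z‖) * (‖x‖ + ‖z‖) := by ring
  rw [h1, Real.norm_eq_abs, abs_mul, abs_of_nonneg (show 0 ≤ ‖x‖ + ‖z‖ by positivity), mul_comm]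
  refine mul_le_mul (by linarith) (abs_norm_sub_norm_le x z) (abs_nonneg _) (by positivity)

/-- A function with `W² ≤ C t W'` is small at `r` if it is defined up to `T` much larger
than `r`. -/
theorem mul_log_div_le {W w : ℝ → ℝ} {C r T : ℝ} (hC : 0 ≤ C) (hr : 0 < r) (hrT : r ≤ T)
    (hW : ∀ t ∈ Icc r T, HasDerivAt W (w t) t) (hpos : ∀ t ∈ Icc r T, 0 < W t)
    (hle : ∀ t ∈ Icc r T, W t ^ 2 ≤ C * t * w t) : W r * Real.log (T / r) ≤ C := by
  have hrI : r ∈ Icc r T := left_mem_Icc.2 hrT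
  have hTI : T ∈ Icc r T := right_mem_Icc.2 hrT
  -- The inequality says exactly that -C/W - log t is nondecreasing; comparing its values at `r` and
  -- `T` gives the claim.
  have hd : ∀ t ∈ Icc r T, HasDerivAt (fun t => -(C * (W t)⁻¹) - Real.log t)
      (C * w t / W t ^ 2 - t⁻¹) t := by
    intro t ht
    have h1 := ((((hW t ht).inv (hpos t ht).ne').const_mul C).neg).sub
      (Real.hasDerivAt_log (hr.trans_le ht.1).ne')
    refine h1.congr_deriv ?_
    ring
  have hmono : MonotoneOn (fun t => -(C * (W t)⁻¹) - Real.log t) (Icc r T) := by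
    refine monotoneOn_of_deriv_nonneg (convex_Icc r T)
      (fun t ht => (hd t ht).continuousAt.continuousWithinAt)
      (fun t ht => (hd t (interior_subset ht)).differentiableAt.differentiableWithinAt)
      fun t ht => ?_
    have ht' := interior_subset ht
    have ht0 : 0 < t := hr.trans_le ht'.1
    rw [(hd t ht').deriv, sub_nonneg, le_div_iff₀ (pow_pos (hpos t ht') 2), inv_mul_le_iff₀ ht0]
    have := hle t ht'
    linarith
  have h1 := hmono hrI hTI hrT
  simp only at h1
  have hWr := hpos r hrI
  have hWT : 0 ≤ C * (W T)⁻¹ := mul_nonneg hC (inv_nonneg.2 (hpos T hTI).le)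
  have h2 : Real.log (T / r) ≤ C * (W r)⁻¹ := by
    rw [Real.log_div (hr.trans_le hrT).ne' hr.ne']
    linarith
  calc W r * Real.log (T / r) ≤ W r * (C * (W r)⁻¹) := mul_le_mul_of_nonneg_left h2 hWr.le
    _ = C := by field_simp

variable {E : Type*} [NormedAddCommGroup E] [NormedSpace ℂ E] [FiniteDimensional ℂ E]
  {X : Type*} [TopologicalSpace X] [ChartedSpace E X] [IsManifold 𝓘(ℂ, E) ω X]
  {X' : Type*} [TopologicalSpace X'] [ChartedSpace E X'] [IsManifold 𝓘(ℂ, E) ω X']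
  {π : X' → X}

/-- In dimension one |dτ|² times the density is at most c‖dτ‖² ≤ 9ct², independently of `θ`.
Division by 2t leaves 9ct/2 ≤ 5ct, and the circle contributes another factor t. -/
theorem exists_sphereIntegral_dtauNorm_le : ∃ C : ℝ, 0 < C ∧
    ∀ (θ : CSpace 1 → CSpace 1 [⋀^Fin 2]→L[ℝ] ℂ) (R : ℝ), ContinuousOn θ (ball 0 R) →
      (∀ z ∈ ball 0 R, IsSemipositive (θ z)) → ∀ t, 0 < t → t < R →
        sphereIntegral t (fun z => dtauNorm θ z * areaDensity θ z) ≤ C * t ^ 2 := by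
  obtain ⟨c, hc, hc'⟩ := exists_dualNorm_sq_mul_topDensity_le 1
  set σ := (volume : Measure (CSpace 1)).toSphere with hσ
  refine ⟨5 * c * (σ.real univ + 1), by positivity, fun θ R hθ hs t ht htR => ?_⟩
  have hnorm : ∀ u : sphere (0 : CSpace 1) 1, ‖t • (u : CSpace 1)‖ = t := by
    intro u
    simp [norm_smul, abs_of_pos ht]
  have hint : Integrable (fun u : sphere (0 : CSpace 1) 1 =>
      dtauNorm θ (t • (u : CSpace 1)) * areaDensity θ (t • (u : CSpace 1))) σ := by
    refine ((integrable_sphere_dtauNorm hθ hs ht htR).2.div_const (2 * t)).congr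
      (.of_forall fun u => ?_)
    simp only [areaDensity, hnorm]
    ring
  have hle : ∀ u : sphere (0 : CSpace 1) 1,
      dtauNorm θ (t • (u : CSpace 1)) * areaDensity θ (t • (u : CSpace 1)) ≤ 5 * c * t := by
    intro u
    have hmem : t • (u : CSpace 1) ∈ ball (0 : CSpace 1) R := by rwa [mem_ball_zero_iff, hnorm]
    have h1 := hc' (θ (t • (u : CSpace 1)))
      (fderiv ℝ (fun x : CSpace 1 => ‖x‖ ^ 2) (t • (u : CSpace 1))) (hs _ hmem)
    have h2 := norm_fderiv_norm_sq_le (z := t • (u : CSpace 1))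
      (norm_pos_iff.1 (by rw [hnorm]; exact ht))
    rw [hnorm] at h2
    have h3 := mul_le_mul_of_nonneg_left (pow_le_pow_left₀ (norm_nonneg _) h2 2) hc.le
    rw [Nat.sub_self, pow_zero, mul_one] at h1
    simp only [areaDensity, hnorm, dtauNorm_eq, volDensity_eq]
    rw [← mul_div_assoc, div_le_iff₀ (by positivity), ← mul_assoc, ← sq]
    have h4 : 0 ≤ c * t ^ 2 := by positivity
    nlinarith
  have h1 : ∫ u : sphere (0 : CSpace 1) 1,
      dtauNorm θ (t • (u : CSpace 1)) * areaDensity θ (t • (u : CSpace 1)) ∂σ ≤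
        ∫ _, 5 * c * t ∂σ := integral_mono hint (integrable_const _) hle
  rw [integral_const, smul_eq_mul] at h1
  rw [sphereIntegral]
  calc t ^ (2 * 1 - 1) * ∫ u : sphere (0 : CSpace 1) 1,
      dtauNorm θ (t • (u : CSpace 1)) * areaDensity θ (t • (u : CSpace 1)) ∂σ
      ≤ t ^ (2 * 1 - 1) * (σ.real univ * (5 * c * t)) := by gcongr
    _ ≤ t * ((σ.real univ + 1) * (5 * c * t)) := by
      simp only [Nat.mul_one, Nat.add_one_sub_one, pow_one]
      gcongr
      linarith
    _ = _ := by ring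

/-- For m = 1 the isoperimetric inequality and the universal bound for ∫ |dτ| dσ give W² ≤ K C t²
W'/t, which `mul_log_div_le` integrates. -/
theorem IsTildeDelDelbarBounded.exists_ballVolume_mul_log_le [ConnectedSpace X]
    (hπ : IsUniversalCover (E := E) π) {Ω : X → E [⋀^Fin 2]→L[ℝ] ℂ} (hΩ : IsHermitianMetric Ω)
    (h : IsTildeDelDelbarBounded π Ω Ω) : ∃ C : ℝ, 0 < C ∧
    ∀ (f : CSpace 1 → X) (R : ℝ), (∀ z ∈ ball (0 : CSpace 1) R, IsHolomorphicAt (CSpace 1) E f z) →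
      ∀ r T, 0 < r → r ≤ T → T < R →
        ballVolume (pullback f Ω) r * Real.log (T / r) ≤ C := by
  have hpow : powForm Ω 1 = Ω := funext fun x => wedgePow_one (Ω x)
  obtain ⟨K, hK, hiso⟩ := IsTildeDelDelbarBounded.exists_isoperimetric (m := 1) hπ hΩ
    (by rw [hpow]; exact h)
  obtain ⟨C, hC, hC'⟩ := exists_sphereIntegral_dtauNorm_le
  refine ⟨K * C, by positivity, fun f R hf r T hr hrT hTR => ?_⟩
  set θ : CSpace 1 → CSpace 1 [⋀^Fin 2]→L[ℝ] ℂ := pullback f Ω with hθ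
  have hc : ContinuousOn θ (ball 0 R) := (contDiffOn_pullback hΩ.smooth hf).continuousOn
  have hs : ∀ z, IsSemipositive (θ z) := hΩ.isSemipositive_pullback f
  have hvc : ContinuousOn (volDensity θ) (ball 0 R) := continuous_topDensity.comp_continuousOn hc
  have hS0 : ∀ t, 0 < t → 0 ≤ sphereIntegral t (volDensity θ) := fun t ht =>
    mul_nonneg (pow_nonneg ht.le _) (integral_nonneg fun u => (hs _).topDensity_nonneg)
  have hlog : 0 ≤ Real.log (T / r) := Real.log_nonneg ((one_le_div hr).2 hrT)
  have hW0 : ∀ t, 0 ≤ ballVolume θ t := fun t =>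
    setIntegral_nonneg measurableSet_ball fun z _ => (hs z).topDensity_nonneg
  rcases (hW0 r).eq_or_lt with h0 | hpos
  · rw [← h0, zero_mul]
    positivity
  have hmono : ∀ t ∈ Icc r T, 0 < ballVolume θ t := by
    intro t ht
    refine hpos.trans_le (setIntegral_mono_set ?_ (.of_forall fun z => (hs z).topDensity_nonneg)
      (ball_subset_ball ht.1).eventuallyLE)
    exact ((hvc.mono (closedBall_subset_ball (ht.2.trans_lt hTR))).integrableOn_compact
      (isCompact_closedBall 0 t)).mono_set ball_subset_closedBall
  have hSc : ContinuousOn (fun t => sphereIntegral t (volDensity θ)) (Ioo (-R) R) := by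
    simp only [sphereIntegral_eq_sphereMean]
    refine continuousOn_sphereMean volume (hvc.mono ?_)
    rintro x ⟨t, ht, hx⟩
    rw [mem_ball_zero_iff, hx, abs_lt]
    exact ht
  have hR : 0 < R := hr.trans_le (hrT.trans hTR.le)
  have hderiv : ∀ t ∈ Icc r T, HasDerivAt (fun t => ∫ s in (0 : ℝ)..t,
      sphereIntegral s (volDensity θ)) (sphereIntegral t (volDensity θ)) t := by
    intro t ht
    have htm : t ∈ Ioo (-R) R := ⟨by linarith [ht.1], ht.2.trans_lt hTR⟩
    refine intervalIntegral.integral_hasDerivAt_right ?_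
      (hSc.stronglyMeasurableAtFilter isOpen_Ioo t htm) (hSc.continuousAt (isOpen_Ioo.mem_nhds htm))
    refine (hSc.mono ?_).intervalIntegrable
    rw [uIcc_of_le (hr.le.trans ht.1)]
    exact fun s hs => ⟨by linarith [hs.1], hs.2.trans_lt htm.2⟩
  have hWeq : ∀ t ∈ Icc r T, ballVolume θ t = ∫ s in (0 : ℝ)..t, sphereIntegral s (volDensity θ) :=
    fun t ht => ballVolume_eq_integral hc (hr.le.trans ht.1) (ht.2.trans_lt hTR)
  have key := mul_log_div_le (C := K * C) (by positivity) hr hrT hderiv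
    (fun t ht => by rw [← hWeq t ht]; exact hmono t ht) (fun t ht => ?_)
  · rw [hWeq r (left_mem_Icc.2 hrT)]
    exact key
  · rw [← hWeq t ht]
    have ht0 : 0 < t := hr.trans_le ht.1
    have htR := ht.2.trans_lt hTR
    have h1 := hC' θ R hc (fun z _ => hs z) t ht0 htR
    have h2 := hS0 t ht0
    calc _ ≤ _ := hiso f R hf t ht0 htR
      _ ≤ K * (C * t ^ 2) * (sphereIntegral t (volDensity θ) / t) := by gcongr
      _ = _ := by field_simp

end DiscArea

/-! ### The speed of a holomorphic disc -/

section Speed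

open Set Metric

theorem IsSemipositive.vecNorm_complex_smul {E : Type*} [NormedAddCommGroup E] [NormedSpace ℂ E]
    {θ : E [⋀^Fin 2]→L[ℝ] ℂ} (h : IsSemipositive θ) (c : ℂ) (v : E) :
    vecNorm θ (c • v) = ‖c‖ * vecNorm θ v := by
  have hself : ∀ w : E, θ ![w, w] = 0 := fun w =>
    θ.toAlternatingMap.map_eq_zero_of_eq ![w, w] (i := 0) (j := 1) rfl (by simp)
  have key : ∀ w : E, ((hermitianForm θ w w).re) = vecNorm θ w ^ 2 := by
    intro w
    rw [hermitianForm_apply, hself, mul_zero, add_zero, vecNorm, Real.sq_sqrt (h.nonneg w)]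
  have h1 : hermitianForm θ (c • v) (c • v) = (‖c‖ ^ 2 : ℝ) * hermitianForm θ v v := by
    rw [map_smul, ← h.hermitianForm_symm, map_smul, smul_eq_mul, smul_eq_mul, map_mul,
      h.hermitianForm_symm, ← mul_assoc, Complex.mul_conj, Complex.normSq_eq_norm_sq]
  have h2 := key (c • v)
  rw [h1, Complex.re_ofReal_mul, key, ← mul_pow] at h2
  exact (pow_left_inj₀ (vecNorm_nonneg _ _) (mul_nonneg (norm_nonneg _) (vecNorm_nonneg _ _))
    two_ne_zero).1 h2.symm

variable {E : Type*} [NormedAddCommGroup E] [NormedSpace ℂ E] [FiniteDimensional ℂ E]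
  {X : Type*} [TopologicalSpace X] [ChartedSpace E X] [IsManifold 𝓘(ℂ, E) ω X]
  {Ω : X → E [⋀^Fin 2]→L[ℝ] ℂ}

theorem IsHermitianMetric.isSemipositive (hΩ : IsHermitianMetric Ω) (x : X) :
    IsSemipositive (Ω x) := by
  refine ⟨hΩ.real x, hΩ.type_one_one x, fun v => ?_⟩
  by_cases h : v = 0
  · have := (Ω x).toAlternatingMap.map_coord_zero (m := ![v, Complex.I • v]) 0 h
    exact (congrArg Complex.re this).ge
  · exact (hΩ.pos x v h).le

/-- The length of the derivative of a holomorphic map defined on an open subset of `ℂ`. -/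
def speed (Ω : X → E [⋀^Fin 2]→L[ℝ] ℂ) (g : ℂ → X) (z : ℂ) : ℝ :=
  vecNorm (Ω (g z)) (complexDeriv (E := ℂ) (F := E) g z 1)

theorem speed_nonneg (Ω : X → E [⋀^Fin 2]→L[ℝ] ℂ) (g : ℂ → X) (z : ℂ) : 0 ≤ speed Ω g z :=
  vecNorm_nonneg _ _

theorem speed_eq_vecNorm_pullback (g : ℂ → X) (z : ℂ) :
    speed Ω g z = vecNorm (pullback g Ω z : ℂ [⋀^Fin 2]→L[ℝ] ℂ) 1 :=
  (vecNorm_pullback g Ω z 1).symm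

theorem continuousOn_speed (hΩ : IsHermitianMetric Ω) {g : ℂ → X} {U : Set ℂ}
    (hg : ∀ z ∈ U, IsHolomorphicAt ℂ E g z) : ContinuousOn (speed Ω g) U := by
  have h := (contDiffOn_pullback hΩ.smooth hg).continuousOn
  have h1 : ContinuousOn (fun z => ((pullback g Ω z : ℂ [⋀^Fin 2]→L[ℝ] ℂ)
      ![1, Complex.I • 1]).re) U :=
    Complex.continuous_re.comp_continuousOn
      (continuousOn_apply_pair h continuousOn_const continuousOn_const)
  have : speed Ω g = fun z => vecNorm (pullback g Ω z : ℂ [⋀^Fin 2]→L[ℝ] ℂ) 1 :=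
    funext (speed_eq_vecNorm_pullback g)
  rw [this]
  exact h1.sqrt

theorem speed_comp (hΩ : IsHermitianMetric Ω) {f : ℂ → X} {ψ : ℂ → ℂ} {z c : ℂ}
    (hf : IsHolomorphicAt ℂ E f (ψ z)) (hψ : HasDerivAt ψ c z) :
    speed Ω (f ∘ ψ) z = ‖c‖ * speed Ω f (ψ z) := by
  have h1 := complexDeriv_comp (E := ℂ) (F := ℂ) (G := E) (g := f) (f := ψ) (x := z)
    hf.mdifferentiableAt hψ.differentiableAt.mdifferentiableAt
  have h2 : (complexDeriv (f ∘ ψ) z : ℂ →L[ℂ] E) 1 =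
      c • (complexDeriv f (ψ z) : ℂ →L[ℂ] E) 1 := by
    rw [h1, complexDeriv_eq_fderiv, hψ.hasFDerivAt.fderiv, ← map_smul]
    simp
  rw [speed, speed, h2]
  exact (hΩ.isSemipositive (f (ψ z))).vecNorm_complex_smul c _

theorem isHolomorphicAt_of_eventually_differentiableAt {ψ : ℂ → ℂ} {z : ℂ}
    (h : ∀ᶠ w in 𝓝 z, DifferentiableAt ℂ ψ w) : IsHolomorphicAt ℂ ℂ ψ z :=
  h.mono fun _ hw => hw.mdifferentiableAt

theorem differentiableAt_chart_comp {g : ℂ → X} {p : X} {z : ℂ} (hg : IsHolomorphicAt ℂ E g z)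
    (hz : g z ∈ (chartAt E p).source) : DifferentiableAt ℂ (chartAt E p ∘ g) z :=
  mdifferentiableAt_iff_differentiableAt.1
    ((isHolomorphicAt_chart p hz).comp (E := ℂ) hg).mdifferentiableAt

theorem speed_eq_vecNorm_inChart {g : ℂ → X} {p : X} {z : ℂ} (hg : IsHolomorphicAt ℂ E g z)
    (hz : g z ∈ (chartAt E p).source) :
    speed Ω g z = vecNorm (inChart p Ω (chartAt E p (g z))) (deriv (chartAt E p ∘ g) z) := by
  have h1 := complexDeriv_comp (E := ℂ) (F := E) (G := E) (g := chartAt E p) (f := g) (x := z)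
    (isHolomorphicAt_chart p hz).mdifferentiableAt hg.mdifferentiableAt
  rw [complexDeriv_eq_fderiv] at h1
  have h2 : deriv (chartAt E p ∘ g) z = (complexDeriv (chartAt E p) (g z) : E →L[ℂ] E)
      ((complexDeriv g z : ℂ →L[ℂ] E) 1) := by
    rw [← fderiv_apply_one_eq_deriv, h1]
    rfl
  rw [speed, vecNorm_eq_vecNorm_inChart Ω p hz, h2]

/-- Cut-off functions with compact support in a chart, whose variation along holomorphic discs is
controlled by the speed. -/
theorem IsHermitianMetric.exists_cutoff [T2Space X] (hΩ : IsHermitianMetric Ω) (p : X) {N : Set X}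
    (hN : N ∈ 𝓝 p) : ∃ (u : X → ℝ) (U : Set X) (L : ℝ), U ∈ 𝓝 p ∧ 0 < L ∧ (∀ x ∈ U, u x = 1) ∧
      (∀ x ∉ N, u x = 0) ∧ ∀ (g : ℂ → X) (z : ℂ), IsHolomorphicAt ℂ E g z →
        ∃ D : ℂ →L[ℝ] ℝ, HasFDerivAt (u ∘ g) D z ∧ ‖D‖ ≤ L * speed Ω g z := by
  classical
  let : NormedSpace ℝ E := NormedSpace.complexToReal
  have : FiniteDimensional ℝ E := FiniteDimensional.complexToReal E
  have : ProperSpace E := FiniteDimensional.proper ℂ E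
  have hp := mem_chart_source E p
  have hN' : (chartAt E p).symm ⁻¹' N ∈ 𝓝 (chartAt E p p) := by
    refine ((chartAt E p).continuousAt_symm ((chartAt E p).map_source hp)).preimage_mem_nhds ?_
    rwa [(chartAt E p).left_inv hp]
  obtain ⟨r, hr, hrt⟩ := nhds_basis_closedBall.mem_iff.1 (Filter.inter_mem
    ((chartAt E p).open_target.mem_nhds ((chartAt E p).map_source hp)) hN')
  have hK := isCompact_closedBall (chartAt E p p) r
  have hKt : closedBall (chartAt E p p) r ⊆ (chartAt E p).target := fun e he => (hrt he).1
  obtain ⟨δ, hδ, hle⟩ := hΩ.exists_mul_norm_le p hK hKt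
  let χ : ContDiffBump (chartAt E p p) := ⟨r / 3, r / 2, by linarith, by linarith⟩
  have hχ0 : ∀ e ∉ closedBall (chartAt E p p) (r / 2), χ e = 0 := by
    intro e he
    refine χ.zero_of_le_dist ?_
    rw [mem_closedBall, not_le] at he
    exact he.le
  have hχd : ContDiff ℝ ∞ χ := χ.contDiff
  obtain ⟨A, hA⟩ : ∃ A, ∀ e, ‖fderiv ℝ χ e‖ ≤ A := by
    have h1 : HasCompactSupport (fderiv ℝ χ) := χ.hasCompactSupport.fderiv ℝ
    exact h1.exists_bound_of_continuous (hχd.continuous_fderiv (by simp))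
  have hA0 : 0 ≤ A := (norm_nonneg _).trans (hA 0)
  -- The support of the cut-off lies in this compact set, closed because X is Hausdorff. So the
  -- extension by zero vanishes near every point outside it.
  set K' : Set X := (chartAt E p).symm '' closedBall (chartAt E p p) (r / 2) with hK'
  have hsub : closedBall (chartAt E p p) (r / 2) ⊆ closedBall (chartAt E p p) r :=
    closedBall_subset_closedBall (by linarith)
  have hK'c : IsClosed K' := ((isCompact_closedBall _ _).image_of_continuousOn
    ((chartAt E p).continuousOn_symm.mono (hsub.trans hKt))).isClosed
  have hK'N : K' ⊆ N := by
    rintro _ ⟨e, he, rfl⟩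
    exact (hrt (hsub he)).2
  set u : X → ℝ := fun x => if x ∈ (chartAt E p).source then χ (chartAt E p x) else 0 with hu
  have hu0 : ∀ x ∉ K', u x = 0 := by
    intro x hx
    by_cases hxs : x ∈ (chartAt E p).source
    · rw [hu]
      simp only [hxs, if_true]
      refine hχ0 _ fun he => hx ⟨_, he, (chartAt E p).left_inv hxs⟩
    · simp [hu, hxs]
  -- `A` bounds the derivative of the bump function, δ⁻¹ compares the coordinate norm with the
  -- metric, and the summand 1 makes the constant positive.
  refine ⟨u, (chartAt E p).source ∩ chartAt E p ⁻¹' closedBall (chartAt E p p) (r / 3),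
    A * δ⁻¹ + 1, ?_, by positivity, ?_, fun x hx => hu0 x fun h => hx (hK'N h), fun g z hg => ?_⟩
  · exact Filter.inter_mem ((chartAt E p).open_source.mem_nhds hp)
      (((chartAt E p).continuousAt hp).preimage_mem_nhds (closedBall_mem_nhds _ (by linarith)))
  · rintro x ⟨hxs, hx⟩
    simp only [hu, hxs, if_true]
    exact χ.one_of_mem_closedBall hx
  have hgc : ContinuousAt g z := hg.mdifferentiableAt.continuousAt
  have hsp := speed_nonneg Ω g z
  by_cases hz : g z ∈ K'
  · have hzs : g z ∈ (chartAt E p).source := by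
      obtain ⟨e, he, h⟩ := hz
      rw [← h]
      exact (chartAt E p).map_target (hKt (hsub he))
    have hze : chartAt E p (g z) ∈ closedBall (chartAt E p p) r := by
      obtain ⟨e, he, h⟩ := hz
      rw [← h, (chartAt E p).right_inv (hKt (hsub he))]
      exact hsub he
    have hd := differentiableAt_chart_comp hg hzs
    have hdr : HasFDerivAt (𝕜 := ℝ) (chartAt E p ∘ g)
        ((fderiv ℂ (chartAt E p ∘ g) z).restrictScalars ℝ) z :=
      hd.hasFDerivAt.restrictScalars ℝ
    have hχz : HasFDerivAt χ (fderiv ℝ χ (chartAt E p (g z))) ((chartAt E p ∘ g) z) :=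
      (hχd.differentiable (by simp) _).hasFDerivAt
    refine ⟨_, (hχz.comp z hdr).congr_of_eventuallyEq ?_, ?_⟩
    · filter_upwards [hgc.eventually ((chartAt E p).open_source.mem_nhds hzs)] with w hw
      exact if_pos hw
    · have h1 : ‖(fderiv ℂ (chartAt E p ∘ g) z).restrictScalars ℝ‖ ≤ δ⁻¹ * speed Ω g z := by
        refine ContinuousLinearMap.opNorm_le_bound _ (by positivity) fun w => ?_
        have h2 := hle _ hze (deriv (chartAt E p ∘ g) z)
        rw [← speed_eq_vecNorm_inChart hg hzs] at h2
        have h3 : ((fderiv ℂ (chartAt E p ∘ g) z).restrictScalars ℝ) w =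
            w • deriv (chartAt E p ∘ g) z := by
          rw [← fderiv_apply_one_eq_deriv, ← map_smul]
          simp
        rw [h3, norm_smul, mul_comm]
        refine mul_le_mul_of_nonneg_right ?_ (norm_nonneg _)
        rwa [← div_eq_inv_mul, le_div_iff₀ hδ, mul_comm]
      refine (ContinuousLinearMap.opNorm_comp_le _ _).trans ?_
      calc _ ≤ A * (δ⁻¹ * speed Ω g z) := mul_le_mul (hA _) h1 (norm_nonneg _) hA0
        _ ≤ _ := by nlinarith
  · refine ⟨0, (hasFDerivAt_const (0 : ℝ) z).congr_of_eventuallyEq ?_, ?_⟩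
    · filter_upwards [hgc.eventually (hK'c.isOpen_compl.mem_nhds hz)] with w hw
      exact hu0 _ hw
    · rw [norm_zero]
      positivity

/-- Discs of bounded speed whose speed at the centre is one have speed bounded below near the
centre. -/
theorem IsHermitianMetric.exists_le_speed_nhds [T2Space X] (hΩ : IsHermitianMetric Ω) (p : X) :
    ∃ (U : Set X) (δ c : ℝ), U ∈ 𝓝 p ∧ 0 < δ ∧ δ < 1 ∧ 0 < c ∧ ∀ g : ℂ → X,
      (∀ z ∈ ball (0 : ℂ) 1, IsHolomorphicAt ℂ E g z) → g 0 ∈ U → speed Ω g 0 = 1 →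
      (∀ z ∈ ball (0 : ℂ) 1, speed Ω g z ≤ 2) → ∀ z ∈ ball (0 : ℂ) δ, c ≤ speed Ω g z := by
  have : ProperSpace E := FiniteDimensional.proper ℂ E
  have : CompleteSpace E := FiniteDimensional.complete ℂ E
  have hp := mem_chart_source E p
  obtain ⟨r, hr, hrt⟩ := nhds_basis_closedBall.mem_iff.1
    ((chartAt E p).open_target.mem_nhds ((chartAt E p).map_source hp))
  have hK := isCompact_closedBall (chartAt E p p) r
  obtain ⟨δ₀, hδ₀, hle⟩ := hΩ.exists_mul_norm_le p hK hrt
  obtain ⟨M, hM⟩ := hK.exists_bound_of_continuousOn ((hΩ.smooth p).continuousOn.mono hrt)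
  set N : Set X := (chartAt E p).source ∩ chartAt E p ⁻¹' closedBall (chartAt E p p) r with hN
  have hNp : N ∈ 𝓝 p := Filter.inter_mem ((chartAt E p).open_source.mem_nhds hp)
    (((chartAt E p).continuousAt hp).preimage_mem_nhds (closedBall_mem_nhds _ hr))
  obtain ⟨u, U, L, hU, hL, hu1, hu0, hud⟩ := hΩ.exists_cutoff p hNp
  -- Along a disc of speed at most 2 the cut-off is 2L-Lipschitz; it is 1 at the centre and 0 off
  -- `N`. So the disc of radius δ₁ < 1/(2L) is mapped into the coordinate neighbourhood `N`.
  set δ₁ : ℝ := 1 / (2 * L + 1) with hδ₁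
  have hδ₁0 : 0 < δ₁ := by positivity
  have hδ₁1 : δ₁ < 1 := by
    rw [hδ₁, div_lt_one (by positivity)]
    linarith
  set B : ℝ := 2 * δ₀⁻¹ with hB
  have hB0 : 0 < B := by positivity
  have hp0 : chartAt E p p ∈ closedBall (chartAt E p p) r := mem_closedBall_self hr.le
  have hM0 : 0 ≤ M := (norm_nonneg _).trans (hM _ hp0)
  -- Unit speed at the centre gives 1 ≤ (M + 1)‖h'(0)‖² in coordinates, so `a` is a lower bound for
  -- ‖h'(0)‖.
  set a : ℝ := (√(M + 1))⁻¹ with ha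
  have ha0 : 0 < a := by positivity
  -- On the disc of radius δ₁ one has ‖h'‖ ≤ B, so the Cauchy estimate bounds the variation of h' by
  -- (2B + 1)|z|/δ₁. For |z| < δ₂ this is at most a/2.
  set δ₂ : ℝ := min δ₁ (a / 2 * δ₁ / (2 * B + 1)) with hδ₂
  refine ⟨U, δ₂, δ₀ * (a / 2), hU, by positivity, (min_le_left _ _).trans_lt hδ₁1, by positivity,
    fun g hg hg0 hs0 hs z hz => ?_⟩
  have hmemN : ∀ w ∈ ball (0 : ℂ) δ₁, g w ∈ N := by
    intro w hw
    have hw1 : w ∈ ball (0 : ℂ) 1 := ball_subset_ball hδ₁1.le hw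
    choose! D hD hDle using fun w hw => hud g w (hg w hw)
    have h1 := (convex_ball (0 : ℂ) 1).norm_image_sub_le_of_norm_hasFDerivWithin_le
      (f := u ∘ g) (f' := D) (C := L * 2) (fun y hy => (hD y hy).hasFDerivWithinAt)
      (fun y hy => (hDle y hy).trans (mul_le_mul_of_nonneg_left (hs y hy) hL.le))
      (mem_ball_self one_pos) hw1
    by_contra hwN
    rw [Function.comp_apply, Function.comp_apply, hu0 _ hwN, hu1 _ hg0, sub_zero] at h1
    rw [mem_ball_zero_iff] at hw
    rw [zero_sub, norm_neg, norm_one] at h1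
    have h2 : L * 2 * ‖w‖ < 1 := by
      calc L * 2 * ‖w‖ < L * 2 * δ₁ := by gcongr
        _ < 1 := by
          rw [hδ₁, mul_one_div, div_lt_one (by positivity)]
          linarith
    linarith
  set h : ℂ → E := chartAt E p ∘ g with hh
  have hd : DifferentiableOn ℂ h (ball 0 δ₁) := fun w hw =>
    (differentiableAt_chart_comp (hg w (ball_subset_ball hδ₁1.le hw))
      (hmemN w hw).1).differentiableWithinAt
  have hdd : DifferentiableOn ℂ (deriv h) (ball 0 δ₁) := hd.deriv isOpen_ball
  have hspeed : ∀ w ∈ ball (0 : ℂ) δ₁,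
      speed Ω g w = vecNorm (inChart p Ω (h w)) (deriv h w) := fun w hw =>
    speed_eq_vecNorm_inChart (hg w (ball_subset_ball hδ₁1.le hw)) (hmemN w hw).1
  have hlow : ∀ w ∈ ball (0 : ℂ) δ₁, δ₀ * ‖deriv h w‖ ≤ speed Ω g w := by
    intro w hw
    rw [hspeed w hw]
    exact hle _ (hmemN w hw).2 _
  have hup : ∀ w ∈ ball (0 : ℂ) δ₁, ‖deriv h w‖ ≤ B := by
    intro w hw
    have := (hlow w hw).trans (hs w (ball_subset_ball hδ₁1.le hw))
    rw [hB, ← div_eq_mul_inv, le_div_iff₀ hδ₀]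
    linarith
  have h00 : (0 : ℂ) ∈ ball (0 : ℂ) δ₁ := mem_ball_self hδ₁0
  have hinit : a ≤ ‖deriv h 0‖ := by
    have h1 := vecNorm_sq_le_norm_mul (inChart p Ω (h 0)) (deriv h 0)
    rw [← hspeed 0 h00, hs0, one_pow] at h1
    have h2 : 1 ≤ (M + 1) * ‖deriv h 0‖ ^ 2 := by
      refine h1.trans (mul_le_mul_of_nonneg_right ?_ (sq_nonneg _))
      have h3 : ‖inChart p Ω (h 0)‖ ≤ M := hM _ (hmemN 0 h00).2
      linarith
    rw [ha, inv_le_iff_one_le_mul₀ (by positivity), ← Real.sqrt_sq (norm_nonneg (deriv h 0)),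
      ← Real.sqrt_mul (sq_nonneg _), mul_comm]
    exact Real.one_le_sqrt.2 h2
  have hz₁ : z ∈ ball (0 : ℂ) δ₁ := ball_subset_ball (min_le_left _ _) hz
  have hcauchy : dist (deriv h z) (deriv h 0) ≤ (2 * B + 1) / δ₁ * dist z 0 := by
    refine Complex.dist_le_div_mul_dist_of_mapsTo_ball hdd (fun w hw => ?_) hz₁
    rw [mem_closedBall, dist_eq_norm]
    have h1 := norm_sub_le (deriv h w) (deriv h 0)
    have h2 := hup w hw
    have h3 := hup 0 h00
    linarith
  have hzn : dist z 0 ≤ a / 2 * δ₁ / (2 * B + 1) := by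
    rw [mem_ball] at hz
    exact hz.le.trans (min_le_right _ _)
  have hclose : dist (deriv h z) (deriv h 0) ≤ a / 2 := by
    refine hcauchy.trans ((mul_le_mul_of_nonneg_left hzn (by positivity)).trans (le_of_eq ?_))
    field_simp
  have hfin : a / 2 ≤ ‖deriv h z‖ := by
    rw [dist_comm, dist_eq_norm] at hclose
    have := norm_sub_norm_le (deriv h 0) (deriv h z)
    linarith
  exact (mul_le_mul_of_nonneg_left hfin hδ₀.le).trans (hlow z hz₁)

theorem IsHermitianMetric.exists_le_speed [T2Space X] [CompactSpace X] (hΩ : IsHermitianMetric Ω) :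
    ∃ δ c : ℝ, 0 < δ ∧ δ < 1 ∧ 0 < c ∧ ∀ g : ℂ → X,
      (∀ z ∈ ball (0 : ℂ) 1, IsHolomorphicAt ℂ E g z) → speed Ω g 0 = 1 →
      (∀ z ∈ ball (0 : ℂ) 1, speed Ω g z ≤ 2) → ∀ z ∈ ball (0 : ℂ) δ, c ≤ speed Ω g z := by
  classical
  choose U δ c hU hδ hδ1 hc hspeed using hΩ.exists_le_speed_nhds
  obtain ⟨s, hs⟩ := CompactSpace.elim_nhds_subcover U hU
  have hex : ∀ (t : Finset X) (η : X → ℝ), (∀ x, 0 < η x) →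
      ∃ ε : ℝ, 0 < ε ∧ ε < 1 ∧ ∀ x ∈ t, ε ≤ η x := by
    intro t η hη
    induction t using Finset.induction_on with
    | empty => exact ⟨1 / 2, by norm_num, by norm_num, by simp⟩
    | insert x t _ ih =>
      obtain ⟨ε, hε, hε1, hεt⟩ := ih
      refine ⟨min ε (η x), lt_min hε (hη x), (min_le_left _ _).trans_lt hε1, fun y hy => ?_⟩
      rcases Finset.mem_insert.1 hy with rfl | hy
      · exact min_le_right _ _
      · exact (min_le_left _ _).trans (hεt y hy)
  obtain ⟨δ', hδ', hδ'1, hδ's⟩ := hex s δ hδ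
  obtain ⟨c', hc', -, hc's⟩ := hex s c hc
  refine ⟨δ', c', hδ', hδ'1, hc', fun g hg h0 h2 z hz => ?_⟩
  have : g 0 ∈ ⋃ x ∈ s, U x := hs ▸ mem_univ _
  simp only [mem_iUnion, exists_prop] at this
  obtain ⟨x, hx, hgx⟩ := this
  exact (hc's x hx).trans (hspeed x g hg hgx h0 h2 z (ball_subset_ball (hδ's x hx) hz))

end Speed

/-! ### Kobayashi hyperbolicity -/

section DiscSpeed

open Set Metric MeasureTheory

variable {E : Type*} [NormedAddCommGroup E] [NormedSpace ℂ E] [FiniteDimensional ℂ E]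
  {X : Type*} [TopologicalSpace X] [ChartedSpace E X] [IsManifold 𝓘(ℂ, E) ω X]
  {X' : Type*} [TopologicalSpace X'] [ChartedSpace E X'] [IsManifold 𝓘(ℂ, E) ω X']
  {π : X' → X} {Ω : X → E [⋀^Fin 2]→L[ℝ] ℂ}

/-- The coordinate of `ℂ¹`. -/
def coord : CSpace 1 →L[ℂ] ℂ := EuclideanSpace.proj 0

theorem norm_coord (z : CSpace 1) : ‖coord z‖ = ‖z‖ := by
  rw [EuclideanSpace.norm_eq]
  simp [coord, Real.sqrt_sq]

theorem volDensity_pullback_comp_coord (hΩ : IsHermitianMetric Ω) {g : ℂ → X} {z : CSpace 1}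
    (hg : IsHolomorphicAt ℂ E g (coord z)) :
    volDensity (pullback (g ∘ coord) Ω) z = speed Ω g (coord z) ^ 2 := by
  set e : CSpace 1 := EuclideanSpace.single 0 1 with he
  have hframe : stdFrame 1 = ![e, Complex.I • e] := by
    funext i
    fin_cases i
    · simp [stdFrame, he]
    · ext j
      fin_cases j
      simp [stdFrame, he]
  have hs := hΩ.isSemipositive_pullback (g ∘ coord) z
  have h1 : volDensity (pullback (g ∘ coord) Ω) z =
      vecNorm (pullback (g ∘ coord) Ω z : CSpace 1 [⋀^Fin 2]→L[ℝ] ℂ) e ^ 2 := by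
    rw [vecNorm, Real.sq_sqrt (hs.nonneg e), ← hframe, volDensity, powForm, wedgePow_one]
    simp
  have h2 := complexDeriv_comp (E := CSpace 1) (F := ℂ) (G := E) (g := g) (f := coord) (x := z)
    hg.mdifferentiableAt coord.differentiableAt.mdifferentiableAt
  rw [complexDeriv_eq_fderiv, coord.fderiv] at h2
  rw [h1, vecNorm_pullback, h2, speed]
  simp [coord, he]

theorem IsTildeDelDelbarBounded.exists_mul_log_le [ConnectedSpace X]
    (hπ : IsUniversalCover (E := E) π) (hΩ : IsHermitianMetric Ω)
    (h : IsTildeDelDelbarBounded π Ω Ω) : ∃ C : ℝ, 0 < C ∧ ∀ (g : ℂ → X) (R : ℝ),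
      (∀ z ∈ ball (0 : ℂ) R, IsHolomorphicAt ℂ E g z) → ∀ r T c : ℝ, 0 < r → r ≤ T → T < R →
        0 ≤ c → (∀ z ∈ ball (0 : ℂ) r, c ≤ speed Ω g z) →
          c ^ 2 * (volume (ball (0 : CSpace 1) r)).toReal * Real.log (T / r) ≤ C := by
  obtain ⟨C, hC, hC'⟩ := h.exists_ballVolume_mul_log_le hπ hΩ
  refine ⟨C, hC, fun g R hg r T c hr hrT hTR hc hspeed => ?_⟩
  have hmem : ∀ {ρ : ℝ} {z : CSpace 1}, z ∈ ball (0 : CSpace 1) ρ → coord z ∈ ball (0 : ℂ) ρ := by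
    intro ρ z hz
    rwa [mem_ball_zero_iff, norm_coord, ← mem_ball_zero_iff]
  have hf : ∀ z ∈ ball (0 : CSpace 1) R, IsHolomorphicAt (CSpace 1) E (g ∘ coord) z := fun z hz =>
    (hg _ (hmem hz)).comp (E := CSpace 1)
      (coord.differentiable.mdifferentiable.isHolomorphicAt z)
  refine le_trans (mul_le_mul_of_nonneg_right ?_
    (Real.log_nonneg ((one_le_div hr).2 hrT))) (hC' (g ∘ coord) R hf r T hr hrT hTR)
  have hcont : ContinuousOn (volDensity (pullback (g ∘ coord) Ω)) (ball 0 R) :=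
    continuous_topDensity.comp_continuousOn (contDiffOn_pullback hΩ.smooth hf).continuousOn
  have hint : IntegrableOn (volDensity (pullback (g ∘ coord) Ω)) (ball 0 r) :=
    ((hcont.mono (closedBall_subset_ball (hrT.trans_lt hTR))).integrableOn_compact
      (isCompact_closedBall 0 r)).mono_set ball_subset_closedBall
  have h1 : ∫ _ in ball (0 : CSpace 1) r, c ^ 2 ≤ ballVolume (pullback (g ∘ coord) Ω) r := by
    refine setIntegral_mono_on (by simp [measure_ball_lt_top]) hint measurableSet_ball fun z hz => ?_
    rw [volDensity_pullback_comp_coord hΩ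
      (hg _ (hmem (ball_subset_ball (hrT.trans hTR.le) hz)))]
    exact pow_le_pow_left₀ hc (hspeed _ (hmem hz)) 2
  rw [setIntegral_const, smul_eq_mul, mul_comm] at h1
  exact h1

/-- The derivatives at the origin of the holomorphic discs are uniformly bounded. -/
theorem IsTildeDelDelbarBounded.exists_speed_le [ConnectedSpace X] [T2Space X] [CompactSpace X]
    (hπ : IsUniversalCover (E := E) π) (hΩ : IsHermitianMetric Ω)
    (h : IsTildeDelDelbarBounded π Ω Ω) : ∃ A : ℝ, 0 < A ∧ ∀ f : ℂ → X,
      (∀ z ∈ ball (0 : ℂ) 1, IsHolomorphicAt ℂ E f z) → speed Ω f 0 ≤ A := by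
  obtain ⟨C, hC, harea⟩ := h.exists_mul_log_le hπ hΩ
  obtain ⟨δ, c, hδ, hδ1, hc, hlow⟩ := hΩ.exists_le_speed
  set V : ℝ := (volume (ball (0 : CSpace 1) δ)).toReal with hV
  have hV0 : 0 < V := ENNReal.toReal_pos (measure_ball_pos _ _ hδ).ne' measure_ball_lt_top.ne
  -- With `A` the maximum below, the speed at 0 is at most 2A. Either A ≤ 4, or the area estimate
  -- gives A ≤ 4δ exp(C/(c²V)).
  refine ⟨max 8 (8 * (δ * Real.exp (C / (c ^ 2 * V)))), by positivity, fun f hf => ?_⟩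
  have hcont : ContinuousOn (speed Ω f) (closedBall 0 (1 / 2)) :=
    (continuousOn_speed hΩ hf).mono (closedBall_subset_ball (by norm_num))
  -- Brody's reparametrization: at a maximum point of speed times distance to the circle of radius
  -- ½, the speed is at most doubled within distance d/2. Rescaling by a⁻¹ gives a disc of radius
  -- A/2 with speed one at the centre and at most two elsewhere.
  obtain ⟨z₀, hz₀, hmax⟩ := (isCompact_closedBall (0 : ℂ) (1 / 2)).exists_isMaxOn
    ⟨0, mem_closedBall_self (by norm_num)⟩
    (f := fun z => speed Ω f z * (1 / 2 - ‖z‖)) (hcont.mul (by fun_prop))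
  set A := speed Ω f z₀ * (1 / 2 - ‖z₀‖) with hA
  have hmax' : ∀ z : ℂ, ‖z‖ ≤ 1 / 2 → speed Ω f z * (1 / 2 - ‖z‖) ≤ A := fun z hz =>
    hmax (mem_closedBall_zero_iff.2 hz)
  have h0 : speed Ω f 0 ≤ 2 * A := by
    have := hmax' 0 (by norm_num)
    rw [norm_zero, sub_zero] at this
    linarith
  rcases le_or_gt A 4 with hA4 | hA4
  · exact h0.trans (le_max_of_le_left (by linarith))
  rw [mem_closedBall_zero_iff] at hz₀
  set d := 1 / 2 - ‖z₀‖ with hd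
  set a := speed Ω f z₀ with ha
  have ha0 : 0 ≤ a := speed_nonneg _ _ _
  have hd0 : 0 < d := by
    rcases (sub_nonneg.2 hz₀).eq_or_lt with h1 | h1
    · have : A = 0 := by rw [hA, hd, ← h1, mul_zero]
      linarith
    · exact h1
  have ha0' : 0 < a := by
    rcases ha0.eq_or_lt with h1 | h1
    · have : A = 0 := by rw [hA, ← h1, zero_mul]
      linarith
    · exact h1
  set ψ : ℂ → ℂ := fun ζ => z₀ + ζ * (a⁻¹ : ℝ) with hψ
  have hψd : ∀ ζ, HasDerivAt ψ ((a⁻¹ : ℝ) : ℂ) ζ := fun ζ =>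
    (((hasDerivAt_id ζ).mul_const _).const_add z₀).congr_deriv (one_mul _)
  have hψn : ∀ ζ ∈ ball (0 : ℂ) (A / 2), ‖ψ ζ‖ ≤ 1 / 2 - d / 2 := by
    intro ζ hζ
    rw [mem_ball_zero_iff] at hζ
    have h1 : ‖ψ ζ‖ ≤ ‖z₀‖ + ‖ζ * ((a⁻¹ : ℝ) : ℂ)‖ := norm_add_le _ _
    rw [norm_mul, Complex.norm_real, Real.norm_of_nonneg (inv_nonneg.2 ha0)] at h1
    have h2 : ‖ζ‖ * a⁻¹ ≤ d / 2 := by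
      rw [← div_eq_mul_inv, div_le_iff₀ ha0']
      calc ‖ζ‖ ≤ A / 2 := hζ.le
        _ = d / 2 * a := by rw [hA]; ring
    linarith
  have hfψ : ∀ ζ ∈ ball (0 : ℂ) (A / 2), IsHolomorphicAt ℂ E f (ψ ζ) := fun ζ hζ =>
    hf _ (mem_ball_zero_iff.2 ((hψn ζ hζ).trans_lt (by linarith)))
  have hg : ∀ ζ ∈ ball (0 : ℂ) (A / 2), IsHolomorphicAt ℂ E (f ∘ ψ) ζ := fun ζ hζ =>
    (hfψ ζ hζ).comp (E := ℂ)
      (isHolomorphicAt_of_eventually_differentiableAt (.of_forall fun w => (hψd w).differentiableAt))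
  have hsp : ∀ ζ ∈ ball (0 : ℂ) (A / 2), speed Ω (f ∘ ψ) ζ = a⁻¹ * speed Ω f (ψ ζ) := by
    intro ζ hζ
    rw [speed_comp hΩ (hfψ ζ hζ) (hψd ζ), Complex.norm_real,
      Real.norm_of_nonneg (inv_nonneg.2 ha0)]
  have h1A : ball (0 : ℂ) 1 ⊆ ball 0 (A / 2) := ball_subset_ball (by linarith)
  have hψ0 : ψ 0 = z₀ := by simp [hψ]
  have hlow' := hlow (f ∘ ψ) (fun ζ hζ => hg ζ (h1A hζ))
    (by rw [hsp 0 (h1A (mem_ball_self one_pos)), hψ0]; exact inv_mul_cancel₀ ha0'.ne')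
    (fun ζ hζ => by
      rw [hsp ζ (h1A hζ), inv_mul_le_iff₀ ha0']
      have h1 := hψn ζ (h1A hζ)
      have h2 := hmax' (ψ ζ) (by linarith)
      have h3 : speed Ω f (ψ ζ) * (d / 2) ≤ a * 2 * (d / 2) := by
        refine (mul_le_mul_of_nonneg_left (by linarith) (speed_nonneg _ _ _)).trans (h2.trans ?_)
        rw [hA]
        exact le_of_eq (by ring)
      exact le_of_mul_le_mul_right h3 (by linarith))
  -- The rescaled disc has speed at least `c` within δ, so its area there is at least c²V, while A/4
  -- lies strictly inside its radius; the logarithmic estimate then bounds A.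
  have hfin := harea (f ∘ ψ) (A / 2) hg δ (A / 4) c hδ (by linarith) (by linarith) hc.le hlow'
  have hlog : Real.log (A / 4 / δ) ≤ C / (c ^ 2 * V) := by
    rw [le_div_iff₀ (by positivity), mul_comm]
    exact hfin
  rw [Real.log_le_iff_le_exp (by positivity), div_le_iff₀ hδ] at hlog
  refine h0.trans (le_max_of_le_right ?_)
  linarith

/-- This rests on the identity |1 + āw|² - |w + a|² = (1 - |a|²)(1 - |w|²). -/
theorem moebius_norm_lt {a w : ℂ} (ha : ‖a‖ < 1) (hw : ‖w‖ < 1) :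
    1 + (starRingEnd ℂ) a * w ≠ 0 ∧ ‖(w + a) / (1 + (starRingEnd ℂ) a * w)‖ < 1 := by
  have hne : 1 + (starRingEnd ℂ) a * w ≠ 0 := by
    intro h
    have h1 : ‖(starRingEnd ℂ) a * w‖ = 1 := by
      rw [← neg_eq_of_add_eq_zero_right h, norm_neg, norm_one]
    rw [norm_mul, Complex.norm_conj] at h1
    have := mul_lt_one_of_nonneg_of_lt_one_left (norm_nonneg a) ha hw.le
    linarith
  refine ⟨hne, ?_⟩
  rw [norm_div, div_lt_one (norm_pos_iff.2 hne)]
  refine lt_of_pow_lt_pow_left₀ 2 (norm_nonneg _) ?_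
  have h1 : ‖a‖ ^ 2 < 1 := pow_lt_one₀ (norm_nonneg _) ha two_ne_zero
  have h2 : ‖w‖ ^ 2 < 1 := pow_lt_one₀ (norm_nonneg _) hw two_ne_zero
  rw [← Complex.normSq_eq_norm_sq, Complex.normSq_apply] at h1 h2 ⊢
  rw [← Complex.normSq_eq_norm_sq, Complex.normSq_apply]
  simp only [Complex.add_re, Complex.add_im, Complex.one_re, Complex.one_im, Complex.mul_re,
    Complex.mul_im, Complex.conj_re, Complex.conj_im]
  nlinarith [mul_pos (sub_pos.2 h1) (sub_pos.2 h2)]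

theorem neg_log_one_sub_le_artanh {s : ℝ} (hs : 0 ≤ s) (hs1 : s < 1) :
    -Real.log (1 - s) ≤ 2 * Real.artanh s := by
  rw [Real.artanh_eq_half_log ⟨by linarith, hs1.le⟩,
    Real.log_div (by linarith) (by linarith)]
  have := Real.log_nonneg (show 1 ≤ 1 + s by linarith)
  linarith

/-- Functions whose variation is controlled by the speed are Lipschitz along holomorphic discs. -/
theorem abs_sub_le_poincareDist (hΩ : IsHermitianMetric Ω) {A L : ℝ} (hL : 0 < L) (hA0 : 0 < A)
    (hA : ∀ f : ℂ → X, (∀ z ∈ ball (0 : ℂ) 1, IsHolomorphicAt ℂ E f z) → speed Ω f 0 ≤ A)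
    {u : X → ℝ} (hu : ∀ (g : ℂ → X) (z : ℂ), IsHolomorphicAt ℂ E g z →
        ∃ D : ℂ →L[ℝ] ℝ, HasFDerivAt (u ∘ g) D z ∧ ‖D‖ ≤ L * speed Ω g z)
    {f : ℂ → X} (hf : ∀ z ∈ ball (0 : ℂ) 1, IsHolomorphicAt ℂ E f z) {a b : ℂ}
    (ha : a ∈ ball (0 : ℂ) 1) (hb : b ∈ ball (0 : ℂ) 1) :
    |u (f a) - u (f b)| ≤ L * A * poincareDist a b := by
  -- The bound at the centre is applied to the disc of radius 1 - |z| about z, rescaled to the unit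
  -- disc.
  have hspeed : ∀ F : ℂ → X, (∀ z ∈ ball (0 : ℂ) 1, IsHolomorphicAt ℂ E F z) →
      ∀ z ∈ ball (0 : ℂ) 1, speed Ω F z ≤ A * (1 - ‖z‖)⁻¹ := by
    intro F hF z hz
    rw [mem_ball_zero_iff] at hz
    have hd : 0 < 1 - ‖z‖ := sub_pos.2 hz
    set ψ : ℂ → ℂ := fun ζ => z + ζ * ((1 - ‖z‖ : ℝ) : ℂ) with hψ
    have hψd : ∀ ζ, HasDerivAt ψ ((1 - ‖z‖ : ℝ) : ℂ) ζ := fun ζ =>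
      (((hasDerivAt_id ζ).mul_const _).const_add z).congr_deriv (one_mul _)
    have hψm : ∀ ζ ∈ ball (0 : ℂ) 1, ψ ζ ∈ ball (0 : ℂ) 1 := by
      intro ζ hζ
      rw [mem_ball_zero_iff] at hζ ⊢
      have h1 : ‖ψ ζ‖ ≤ ‖z‖ + ‖ζ * ((1 - ‖z‖ : ℝ) : ℂ)‖ := norm_add_le _ _
      rw [norm_mul, Complex.norm_real, Real.norm_of_nonneg hd.le] at h1
      nlinarith
    have h1 := hA (F ∘ ψ) fun ζ hζ => (hF _ (hψm ζ hζ)).comp (E := ℂ)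
      (isHolomorphicAt_of_eventually_differentiableAt
        (.of_forall fun w => (hψd w).differentiableAt))
    rw [speed_comp hΩ (hF _ (hψm 0 (mem_ball_self one_pos))) (hψd 0), Complex.norm_real,
      Real.norm_of_nonneg hd.le] at h1
    have h2 : ψ 0 = z := by simp [hψ]
    rw [h2] at h1
    rw [← div_eq_mul_inv, le_div_iff₀ hd]
    linarith
  rw [mem_ball_zero_iff] at ha hb
  -- This automorphism of the disc takes 0 to `a` and the point `w` below to `b`, and |w| is the
  -- quotient in the Poincaré distance.
  set ψ : ℂ → ℂ := fun w => (w + a) / (1 + (starRingEnd ℂ) a * w) with hψ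
  set F : ℂ → X := f ∘ ψ with hF
  have hFh : ∀ z ∈ ball (0 : ℂ) 1, IsHolomorphicAt ℂ E F z := by
    intro z hz
    refine (hf (ψ z) (mem_ball_zero_iff.2
      (moebius_norm_lt ha (mem_ball_zero_iff.1 hz)).2)).comp (E := ℂ) ?_
    refine isHolomorphicAt_of_eventually_differentiableAt ?_
    filter_upwards [isOpen_ball.mem_nhds hz] with w hw
    exact DifferentiableAt.div (by fun_prop) (by fun_prop)
      (moebius_norm_lt ha (mem_ball_zero_iff.1 hw)).1
  have ha' : ‖-a‖ < 1 := by rwa [norm_neg]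
  have hmb := moebius_norm_lt ha' hb
  have hden : 1 - (starRingEnd ℂ) a * b ≠ 0 := by
    have := hmb.1
    rwa [map_neg, neg_mul, ← sub_eq_add_neg] at this
  set w : ℂ := (b - a) / (1 - (starRingEnd ℂ) a * b) with hw
  have hw1 : ‖w‖ < 1 := by
    have := hmb.2
    rwa [map_neg, neg_mul, ← sub_eq_add_neg, ← sub_eq_add_neg] at this
  have hψ0 : ψ 0 = a := by simp [hψ]
  have hψw : ψ w = b := by
    have h1 : w * (1 - (starRingEnd ℂ) a * b) = b - a := div_mul_cancel₀ _ hden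
    have h2 := (moebius_norm_lt ha hw1).1
    simp only [hψ]
    rw [div_eq_iff h2]
    linear_combination h1
  have hdist : poincareDist a b = 2 * Real.artanh ‖w‖ := by
    rw [poincareDist, hw, norm_div, norm_sub_rev a b]
  have htw : ∀ t ∈ Icc (0 : ℝ) 1, ‖(t : ℂ) * w‖ = t * ‖w‖ ∧ t * ‖w‖ < 1 := by
    intro t ht
    refine ⟨by rw [norm_mul, Complex.norm_real, Real.norm_of_nonneg ht.1], ?_⟩
    exact (mul_le_of_le_one_left (norm_nonneg _) ht.2).trans_lt hw1
  have hmem : ∀ t ∈ Icc (0 : ℝ) 1, (t : ℂ) * w ∈ ball (0 : ℂ) 1 := by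
    intro t ht
    rw [mem_ball_zero_iff, (htw t ht).1]
    exact (htw t ht).2
  choose! D hD hDle using fun z hz => hu F z (hFh z hz)
  have hray : ∀ t : ℝ, HasDerivAt (fun t : ℝ => (t : ℂ) * w) w t := fun t => by
    simpa using ((hasDerivAt_id t).ofReal_comp).mul_const w
  have hd : ∀ t ∈ Icc (0 : ℝ) 1, HasDerivAt (fun t : ℝ => u (F ((t : ℂ) * w)) - u (F 0))
      (D ((t : ℂ) * w) w) t := fun t ht =>
    ((hD _ (hmem t ht)).comp_hasDerivAt t (hray t)).sub_const _
  have hB : ∀ t ∈ Icc (0 : ℝ) 1, HasDerivAt (fun t : ℝ => L * A * -Real.log (1 - t * ‖w‖))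
      (L * A * (‖w‖ / (1 - t * ‖w‖))) t := by
    intro t ht
    have h1 : HasDerivAt (fun t : ℝ => 1 - t * ‖w‖) (-‖w‖) t := by
      simpa using ((hasDerivAt_id t).mul_const ‖w‖).const_sub 1
    have h2 := ((h1.log (sub_pos.2 (htw t ht).2).ne').neg).const_mul (L * A)
    refine h2.congr_deriv ?_
    rw [neg_div, neg_neg]
  -- Integrating the bound A/(1 - t|w|) for the speed along the segment from 0 to `w` gives -A log(1
  -- - |w|), which is at most A times the Poincaré distance.
  have key := image_norm_le_of_norm_deriv_right_le_deriv_boundary'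
    (f := fun t : ℝ => u (F ((t : ℂ) * w)) - u (F 0)) (f' := fun t => D ((t : ℂ) * w) w)
    (a := 0) (b := 1) (B := fun t => L * A * -Real.log (1 - t * ‖w‖))
    (B' := fun t => L * A * (‖w‖ / (1 - t * ‖w‖)))
    (fun t ht => (hd t ht).continuousAt.continuousWithinAt)
    (fun t ht => (hd t (Ico_subset_Icc_self ht)).hasDerivWithinAt) (by simp)
    (fun t ht => (hB t ht).continuousAt.continuousWithinAt)
    (fun t ht => (hB t (Ico_subset_Icc_self ht)).hasDerivWithinAt)
    (fun t ht => by
      have ht' := Ico_subset_Icc_self ht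
      have h1 := hspeed F hFh _ (hmem t ht')
      rw [(htw t ht').1] at h1
      have h2 := (hDle _ (hmem t ht')).trans (mul_le_mul_of_nonneg_left h1 hL.le)
      refine ((D _).le_opNorm w).trans ((mul_le_mul_of_nonneg_right h2 (norm_nonneg _)).trans
        (le_of_eq ?_))
      ring)
    (right_mem_Icc.2 zero_le_one)
  simp only [Complex.ofReal_one, one_mul] at key
  have e0 : F 0 = f a := by rw [hF, Function.comp_apply, hψ0]
  have e1 : F w = f b := by rw [hF, Function.comp_apply, hψw]
  rw [e0, e1, Real.norm_eq_abs] at key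
  rw [abs_sub_comm, hdist]
  exact key.trans (mul_le_mul_of_nonneg_left
    (neg_log_one_sub_le_artanh (norm_nonneg _) hw1) (by positivity))

/-- A function that is Lipschitz along holomorphic discs is Lipschitz for the Kobayashi
pseudo-distance. -/
theorem ofReal_abs_sub_le_kobayashiDist {E X : Type*} [NormedAddCommGroup E] [NormedSpace ℂ E]
    [TopologicalSpace X] [ChartedSpace E X] {u : X → ℝ} {C : ℝ} (hC : 0 < C)
    (hu : ∀ (f : ℂ → X) (a b : ℂ), MDifferentiableOn 𝓘(ℂ, ℂ) 𝓘(ℂ, E) f (ball 0 1) →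
      a ∈ ball (0 : ℂ) 1 → b ∈ ball (0 : ℂ) 1 → |u (f a) - u (f b)| ≤ C * poincareDist a b)
    (x y : X) : ENNReal.ofReal (|u x - u y| / C) ≤ kobayashiDist E x y := by
  have hdisc : ∀ x y : X, ENNReal.ofReal (|u x - u y| / C) ≤ discDist E x y := by
    intro x y
    refine le_iInf fun f => le_iInf fun a => le_iInf fun b => le_iInf fun hf => le_iInf fun ha =>
      le_iInf fun hb => le_iInf fun hx => le_iInf fun hy => ENNReal.ofReal_le_ofReal ?_
    rw [div_le_iff₀ hC, ← hx, ← hy, mul_comm]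
    exact hu f a b hf ha hb
  refine le_iInf fun m => le_iInf fun p => le_iInf fun hx => le_iInf fun hy => ?_
  have hsum : |u (p 0) - u (p m)| ≤ ∑ i ∈ Finset.range m, |u (p i) - u (p (i + 1))| := by
    have := dist_le_range_sum_dist (fun i => u (p i)) m
    simpa [Real.dist_eq] using this
  calc ENNReal.ofReal (|u x - u y| / C)
      ≤ ENNReal.ofReal (∑ i ∈ Finset.range m, |u (p i) - u (p (i + 1))| / C) := by
        rw [← hx, ← hy, ← Finset.sum_div]
        exact ENNReal.ofReal_le_ofReal (by gcongr)
    _ = ∑ i ∈ Finset.range m, ENNReal.ofReal (|u (p i) - u (p (i + 1))| / C) :=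
        ENNReal.ofReal_sum_of_nonneg fun i _ => by positivity
    _ ≤ _ := Finset.sum_le_sum fun i _ => hdisc _ _

/-- A cut-off function equal to 1 at `x` and 0 at `y` is Lipschitz for the Kobayashi pseudo-distance
with constant LA, so the distance of `x` and `y` is at least 1/(LA). -/
theorem SKTHyperbolic.kobayashiHyperbolic [ConnectedSpace X] [T2Space X] [CompactSpace X]
    (hπ : IsUniversalCover (E := E) π) (h : SKTHyperbolic (E := E) π) :
    KobayashiHyperbolic E X := by
  obtain ⟨Ω, ⟨hΩ, -⟩, hb⟩ := h
  obtain ⟨A, hA0, hA⟩ := hb.exists_speed_le hπ hΩ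
  intro x y hxy
  by_contra hne
  obtain ⟨u, U, L, hU, hL, hu1, hu0, hu⟩ := hΩ.exists_cutoff x (isOpen_ne.mem_nhds hne)
  have h1 := ofReal_abs_sub_le_kobayashiDist (E := E) (u := u) (C := L * A) (by positivity)
    (fun f a b hf ha hb => abs_sub_le_poincareDist hΩ hL hA0 hA hu
      (fun z hz => hf.isHolomorphicAt isOpen_ball hz) ha hb) x y
  rw [hxy, nonpos_iff_eq_zero, ENNReal.ofReal_eq_zero, hu1 x (mem_of_mem_nhds hU),
    hu0 y (by simp), sub_zero, abs_one] at h1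
  have : 0 < 1 / (L * A) := by positivity
  linarith

end DiscSpeed

end HermitianHyperbolicity

end

theorem theorem1p1 (n : ℕ)
    (X : Type*) [TopologicalSpace X] [CompactSpace X] [T2Space X] [ConnectedSpace X]
    [ChartedSpace (EuclideanSpace ℂ (Fin n)) X] [IsManifold 𝓘(ℂ, EuclideanSpace ℂ (Fin n)) ω X]
    (X' : Type*) [TopologicalSpace X'] [ChartedSpace (EuclideanSpace ℂ (Fin n)) X']
    [IsManifold 𝓘(ℂ, EuclideanSpace ℂ (Fin n)) ω X']
    (π : X' → X)
    (hπ : HermitianHyperbolicity.IsUniversalCover (E := EuclideanSpace ℂ (Fin n)) π) :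
    (HermitianHyperbolicity.KahlerHyperbolic (E := EuclideanSpace ℂ (Fin n)) π →
      HermitianHyperbolicity.SKTHyperbolic (E := EuclideanSpace ℂ (Fin n)) π) ∧
    (HermitianHyperbolicity.SKTHyperbolic (E := EuclideanSpace ℂ (Fin n)) π →
      HermitianHyperbolicity.KobayashiHyperbolic (EuclideanSpace ℂ (Fin n)) X) ∧
    (2 ≤ n →
      (HermitianHyperbolicity.BalancedHyperbolic (E := EuclideanSpace ℂ (Fin n)) n π →
        HermitianHyperbolicity.GauduchonHyperbolic (E := EuclideanSpace ℂ (Fin n)) n π) ∧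
      (HermitianHyperbolicity.GauduchonHyperbolic (E := EuclideanSpace ℂ (Fin n)) n π →
        HermitianHyperbolicity.DivisoriallyHyperbolic (EuclideanSpace ℂ (Fin n)) X n) ∧
      (HermitianHyperbolicity.KahlerHyperbolic (E := EuclideanSpace ℂ (Fin n)) π →
        HermitianHyperbolicity.BalancedHyperbolic (E := EuclideanSpace ℂ (Fin n)) n π) ∧
      (HermitianHyperbolicity.KobayashiHyperbolic (EuclideanSpace ℂ (Fin n)) X →
        HermitianHyperbolicity.DivisoriallyHyperbolic (EuclideanSpace ℂ (Fin n)) X n) ∧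
      (HermitianHyperbolicity.DegenerateBalanced (EuclideanSpace ℂ (Fin n)) X n →
        HermitianHyperbolicity.BalancedHyperbolic (E := EuclideanSpace ℂ (Fin n)) n π)) := by
  have hπd : MDifferentiable 𝓘(ℂ, EuclideanSpace ℂ (Fin n)) 𝓘(ℂ, EuclideanSpace ℂ (Fin n)) π :=
    hπ.isLocalDiffeomorph.mdifferentiable (by simp)
  exact ⟨fun h => h.sktHyperbolic, fun h => h.kobayashiHyperbolic hπ, fun hn =>
    ⟨fun h => h.gauduchonHyperbolic, fun h => h.divisoriallyHyperbolic hn hπ,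
      fun h => h.balancedHyperbolic hn hπd, fun h => h.divisoriallyHyperbolic hn,
      fun h => h.balancedHyperbolic hπd⟩⟩
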